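/- **Setting.** An episodic loop-free Markov persuasion process (MPP) consists of finite sets $X$ (states), $A\neq\emptyset$ (actions), $\Omega$ (outcomes); a partition of $X$ into layers $X_0,\dots,X_L$, $L\ge 1$, with $X_0=\{x_0\}$, $X_L=\{x_L\}$ (write $k(x)$ for the index of the layer of $x$); priors $\mu(\cdot|x)\in\Delta(\Omega)$; transition probabilities $P(\cdot|x,\omega,a)\in\Delta(X)$ for $x\ne x_L$, with $P(x'|x,\omega,a)>0$ only if $x'\in X_{k(x)+1}$; and a law of pairs of reward functions $(r_S,r_R)$, $X\times\Omega\times A\to[0,1]$, with means $r_S(x,\omega,a)$, $r_R(x,\omega,a)$. (No independence between different triplets, or between the sender and the receivers, is assumed.) In each episode $t=1,\dots,T$, $T\ge 1$: the pair $(r_{S,t},r_{R,t})$ is drawn from this law, independently of everything else; the sender commits to a policy $\phi_t:X\times\Omega\to\Delta(A)$; starting from $x_0$, for $k=0,\dots,L-1$ one draws $\omega_k\sim\mu(\cdot|x_k)$, $a_k\sim\phi_t(\cdot|x_k,\omega_k)$ (the receiver plays $a_k$) and $x_{k+1}\sim P(\cdot|x_k,\omega_k,a_k)$; the sender then observes the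 trajectory and (full feedback) $r_{S,t}(x_k,\omega_k,a)$, $r_{R,t}(x_k,\omega_k,a)$ for all $k<L$ and all $a\in A$. The sender knows the layers, $A$, $\Omega$, $T$, but not $\mu$, $P$ or the rewards and their law. For a policy $\phi$ let $q^{\phi}(x,\omega,a,x')$ be the probability that $(x,\omega,a,x')$ is visited in an episode played with $\phi$. For any vector $q$ write $q(x,\omega,a)=\sum_{x'}q(x,\omega,a,x')$, $q(x,\omega)=\sum_a q(x,\omega,a)$, $q(x)=\sum_\omega q(x,\omega)$, and $r_S^\top q=\sum_{x,\omega,a}r_S(x,\omega,a)\,q(x,\omega,a)$. Let $\mathrm{OPT}$ be the maximum of $r_S^\top q^{\phi}$ over all policies $\phi$ such that $\sum_{\omega}q^{\phi}(x,\omega,a)\,(r_R(x,\omega,a)-r_R(x,\omega,a'))\ge 0$ for all $x\in X$ and $a,a'\in A$. The regret is $R_T=T\cdot\mathrm{OPT}-\sum_{t=1}^T r_S^\top q^{\phi_t}$. **Algorithm OPPS (full feedback, parameter $\delta$).** Let $N_t(\cdot)$ count the episodes before $t$ in which a state, pair, triplet or tuple is visited, and put $$\overline P_t(x'|x,\omega,a)=\tfrac{N_t(x,\omega,a,x')}{\max\{1,N_t(x,\omega,a)\}},\qquad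 \overline\mu_t(\omega|x)=\tfrac{N_t(x,\omega)}{\max\{1,N_t(x)\}},\qquad \overline r_{i,t}(x,\omega,a)=\tfrac{\sum_{\tau<t}r_{i,\tau}(x,\omega,a)\mathbf 1_\tau\{x,\omega\}}{\max\{1,N_t(x,\omega)\}}\quad (i=S,R),$$ where $\mathbf 1_\tau\{x,\omega\}$ indicates that $(x,\omega)$ is visited in episode $\tau$, and $$\epsilon_t(x,\omega,a)=\sqrt{\tfrac{2|X_{k(x)+1}|\ln(T|X||\Omega||A|/\delta)}{\max\{1,N_t(x,\omega,a)\}}},\qquad \zeta_t(x)=\sqrt{\tfrac{2|\Omega|\ln(T|X|/\delta)}{\max\{1,N_t(x)\}}},\qquad \xi_t(x,\omega)=\min\Big\{1,\sqrt{\tfrac{\ln(3T|X||\Omega|/\delta)}{\max\{1,N_t(x,\omega)\}}}\Big\}.$$ In episode $t$ the algorithm solves the linear program Opt-Opt: maximize $\sum_{x,\omega,a}q(x,\omega,a)\,(\overline r_{S,t}(x,\omega,a)+\xi_t(x,\omega))$ over $q\ge 0$ (with $q(x,\omega,a,x')=0$ unless $x'\in X_{k(x)+1}$) and auxiliary variables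 $\epsilon(x,\omega,a,x')$, $\zeta(x,\omega)$, subject to, for all indices with $x\in X\setminus\{x_L\}$: (i) $\sum_{y\in X_k}q(y)=1$ for $0\le k<L$; (ii) $\sum_{y,\omega,a}q(y,\omega,a,x)=q(x)$ for $x\in X_k$, $1\le k<L$; (iii) $|q(x,\omega,a,x')-\overline P_t(x'|x,\omega,a)\,q(x,\omega,a)|\le\epsilon(x,\omega,a,x')$ for $x'\in X_{k(x)+1}$, and $\sum_{x'\in X_{k(x)+1}}\epsilon(x,\omega,a,x')\le\epsilon_t(x,\omega,a)\,q(x,\omega,a)$; (iv) $|q(x,\omega)-\overline\mu_t(\omega|x)\,q(x)|\le\zeta(x,\omega)$ and $\sum_\omega\zeta(x,\omega)\le\zeta_t(x)\,q(x)$; (v) $\sum_\omega q(x,\omega,a)\,\big(\overline r_{R,t}(x,\omega,a)+\xi_t(x,\omega)-\overline r_{R,t}(x,\omega,a')+\xi_t(x,\omega)\big)\ge 0$ for all $a,a'\in A$. It commits to a policy $\phi_t$ with $\phi_t(a|x,\omega)=\widehat q_t(x,\omega,a)/\widehat q_t(x,\omega)$ whenever $\widehat q_t(x,\omega)\neq 0$,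 where $\widehat q_t$ is an optimal solution of Opt-Opt. Ties are broken by any measurable function of the past observations; $\phi_t(\cdot|x,\omega)$ is arbitrary where $\widehat q_t(x,\omega)=0$, and $\phi_t$ is arbitrary if Opt-Opt is infeasible. **Theorem.** There are universal constants $C>0$ and $p\in\mathbb N$ such that for every episodic loop-free MPP, every $T\ge 1$, every $\delta\in(0,1)$ and every implementation of OPPS as above, with probability at least $1-7\delta$, $$R_T\;\le\; C\,L^2|X|\sqrt{T|A||\Omega|\ln(1/\delta)}\;\bigl(1+\ln(T|X||\Omega||A|)\bigr)^{p},$$ that is, $R_T\le\widetilde{\mathcal O}\big(L^2|X|\sqrt{T|A||\Omega|\ln(1/\delta)}\big)$. -/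

import Mathlib

open MeasureTheory ProbabilityTheory

namespace Persuasion

/-- A loop-free layering of the finite state space `X`: the layers are
`X_k = {x | layer x = k}` for `k = 0, …, L`, the first one is `{init}`, the last one `{final}`. -/
structure Layering (X : Type*) (L : ℕ) where
  layer : X → ℕ
  init : X
  final : X
  layer_le : ∀ x, layer x ≤ L
  layer_eq_zero_iff : ∀ x, layer x = 0 ↔ x = init
  layer_eq_last_iff : ∀ x, layer x = L ↔ x = final

/-- An episodic loop-free Markov persuasion process.  `prior x` is `μ(· | x)`, `trans x ω a x'` is
`P(x' | x, ω, a)` (no transition leaves the final state), and `rewardLaw` is the joint law, on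
tables with entries in `[0,1]`, of the sender's and receivers' reward functions of one episode;
`ν_S(x,ω,a)` and `ν_R(x,ω,a)` are its one-dimensional marginals. -/
structure MPP (X Ω A : Type*) [Fintype X] [Fintype Ω] [Fintype A] (L : ℕ)
    extends Layering X L where
  prior : X → stdSimplex ℝ Ω
  trans : X → Ω → A → X → ℝ
  trans_nonneg : ∀ x ω a x', 0 ≤ trans x ω a x'
  trans_sum : ∀ x ω a, x ≠ final → ∑ x', trans x ω a x' = 1
  loop_free : ∀ x ω a x', 0 < trans x ω a x' → layer x' = layer x + 1
  rewardLaw : Measure ((X → Ω → A → ℝ) × (X → Ω → A → ℝ))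
  rewardLaw_prob : IsProbabilityMeasure rewardLaw
  rewardLaw_mem : ∀ᵐ r ∂rewardLaw, ∀ x ω a,
    r.1 x ω a ∈ Set.Icc (0 : ℝ) 1 ∧ r.2 x ω a ∈ Set.Icc (0 : ℝ) 1

attribute [instance] MPP.rewardLaw_prob

/-- Direct signaling policies: `φ x ω a` is the probability `φ(a | x, ω)` of recommending `a`. -/
abbrev Policy (X Ω A : Type*) [Fintype A] := X → Ω → stdSimplex ℝ A

/-- The possible trajectories `(x_0,…,x_L), (ω_0,…,ω_{L-1}), (a_0,…,a_{L-1})` of one episode. -/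
def Traj (X Ω A : Type*) (L : ℕ) := (Fin (L + 1) → X) × (Fin L → Ω) × (Fin L → A)

/-- A trajectory is a triple of sequences. -/
def Traj.equiv (X Ω A : Type*) (L : ℕ) :
    Traj X Ω A L ≃ (Fin (L + 1) → X) × (Fin L → Ω) × (Fin L → A) := Equiv.refl _

section Traj
variable {X Ω A : Type*} {L : ℕ}

def Traj.state (τ : Traj X Ω A L) (k : Fin (L + 1)) : X := τ.1 k
def Traj.outcome (τ : Traj X Ω A L) (k : Fin L) : Ω := τ.2.1 k
def Traj.action (τ : Traj X Ω A L) (k : Fin L) : A := τ.2.2 k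

noncomputable instance [Fintype X] [Fintype Ω] [Fintype A] : Fintype (Traj X Ω A L) :=
  inferInstanceAs (Fintype ((Fin (L + 1) → X) × (Fin L → Ω) × (Fin L → A)))

instance : MeasurableSpace (Traj X Ω A L) := ⊤

instance : DiscreteMeasurableSpace (Traj X Ω A L) := ⟨fun _ => trivial⟩

/-- The state `x` is visited (before the end of the episode). -/
def Traj.VisitsX (τ : Traj X Ω A L) (x : X) : Prop :=
  ∃ k : Fin L, τ.state k.castSucc = x

/-- The pair `(x, ω)` is visited. -/
def Traj.VisitsXO (τ : Traj X Ω A L) (x : X) (ω : Ω) : Prop :=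
  ∃ k : Fin L, τ.state k.castSucc = x ∧ τ.outcome k = ω

/-- The triplet `(x, ω, a)` is visited. -/
def Traj.VisitsXOA (τ : Traj X Ω A L) (x : X) (ω : Ω) (a : A) : Prop :=
  ∃ k : Fin L, τ.state k.castSucc = x ∧ τ.outcome k = ω ∧ τ.action k = a

/-- The tuple `(x, ω, a, x')` is visited. -/
def Traj.VisitsXOAX (τ : Traj X Ω A L) (x : X) (ω : Ω) (a : A) (x' : X) : Prop :=
  ∃ k : Fin L, τ.state k.castSucc = x ∧ τ.outcome k = ω ∧ τ.action k = a ∧ τ.state k.succ = x'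

end Traj

/-- What the sender observes in one episode under full feedback: the trajectory and, for every
step `k` and every action `a`, the rewards `r_{S,t}(x_k,ω_k,a)` and `r_{R,t}(x_k,ω_k,a)`. -/
abbrev Obs (X Ω A : Type*) (L : ℕ) :=
  Traj X Ω A L × (Fin L → A → ℝ) × (Fin L → A → ℝ)

section Observe
variable {X Ω A : Type*} {L : ℕ}

/-- The full feedback generated by a trajectory and the two reward tables of the episode. -/
def observe (τ : Traj X Ω A L) (r : (X → Ω → A → ℝ) × (X → Ω → A → ℝ)) : Obs X Ω A L :=
  (τ, fun k a => r.1 (τ.state k.castSucc) (τ.outcome k) a,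
    fun k a => r.2 (τ.state k.castSucc) (τ.outcome k) a)

theorem measurable_observe (τ : Traj X Ω A L) : Measurable (observe τ) := by
  unfold observe
  fun_prop

end Observe

section Model
variable {X Ω A : Type*} [Fintype X] [Fintype Ω] [Fintype A] {L : ℕ}

open Classical in
/-- Probability of a trajectory: start in `init`; at step `k` draw `ω_k ∼ μ(· | x_k)`,
`a_k ∼ φ(· | x_k, ω_k)` and `x_{k+1} ∼ P(· | x_k, ω_k, a_k)`. -/
noncomputable def MPP.trajProb (M : MPP X Ω A L) (φ : Policy X Ω A) (τ : Traj X Ω A L) : ℝ :=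
  (if τ.state 0 = M.init then 1 else 0) *
    ∏ k : Fin L, M.prior (τ.state k.castSucc) (τ.outcome k) *
      φ (τ.state k.castSucc) (τ.outcome k) (τ.action k) *
      M.trans (τ.state k.castSucc) (τ.outcome k) (τ.action k) (τ.state k.succ)

/-- Law of the full feedback of one episode in which the sender commits to `φ`: the reward tables
have law `M.rewardLaw` and are independent of the trajectory, which has law `M.trajProb φ`. -/
noncomputable def MPP.episodeLaw (M : MPP X Ω A L) (φ : Policy X Ω A) : Measure (Obs X Ω A L) :=
  ∑ τ : Traj X Ω A L, ENNReal.ofReal (M.trajProb φ τ) • M.rewardLaw.map (observe τ)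

theorem MPP.trajProb_nonneg (M : MPP X Ω A L) (φ : Policy X Ω A) (τ : Traj X Ω A L) :
    0 ≤ M.trajProb φ τ := by
  unfold MPP.trajProb
  refine mul_nonneg (by split_ifs <;> norm_num) (Finset.prod_nonneg fun k _ => ?_)
  exact mul_nonneg (mul_nonneg ((M.prior _).2.1 _) ((φ _ _).2.1 _)) (M.trans_nonneg _ _ _ _)

theorem MPP.measurable_trajProb (M : MPP X Ω A L) (τ : Traj X Ω A L) :
    Measurable fun φ : Policy X Ω A => M.trajProb φ τ := by
  unfold MPP.trajProb
  refine Measurable.const_mul (Finset.measurable_prod _ fun k _ => ?_) _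
  refine Measurable.mul_const (Measurable.const_mul ?_ _) _
  exact (measurable_pi_apply (τ.action k)).comp (measurable_subtype_coe.comp
    ((measurable_pi_apply (τ.outcome k)).comp (measurable_pi_apply (τ.state k.castSucc))))

/-- Summing out one step at a time, the weights of the paths that start in `x` add up to one. -/
theorem sum_paths_eq_one (w : X → Ω → A → X → ℝ) (l : X → ℕ) (N : ℕ)
    (hsum : ∀ x, l x < N → ∑ ω, ∑ a, ∑ x', w x ω a x' = 1)
    (hl : ∀ x ω a x', w x ω a x' ≠ 0 → l x' = l x + 1) [DecidableEq X] (n : ℕ) :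
    ∀ x, l x + n ≤ N →
      ∑ s : Fin (n + 1) → X, ∑ o : Fin n → Ω, ∑ b : Fin n → A, (if s 0 = x then (1 : ℝ) else 0) *
        ∏ k : Fin n, w (s k.castSucc) (o k) (b k) (s k.succ) = 1 := by
  induction n with
  | zero =>
    intro x _
    simp only [Finset.univ_unique, Finset.sum_singleton, Finset.univ_eq_empty, Finset.prod_empty,
      mul_one]
    rw [← (Equiv.funUnique (Fin 1) X).symm.sum_comp]
    simp
  | succ n ih =>
    intro x hx
    rw [← (Fin.consEquiv fun _ : Fin (n + 2) => X).sum_comp, Fintype.sum_prod_type]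
    have h1 : ∀ (y : X) (s : Fin (n + 1) → X),
        (∑ o : Fin (n + 1) → Ω, ∑ b : Fin (n + 1) → A,
          (if (Fin.consEquiv fun _ : Fin (n + 2) => X) (y, s) 0 = x then (1 : ℝ) else 0) *
          ∏ k : Fin (n + 1), w ((Fin.consEquiv fun _ : Fin (n + 2) => X) (y, s) k.castSucc) (o k)
            (b k) ((Fin.consEquiv fun _ : Fin (n + 2) => X) (y, s) k.succ)) =
        if y = x then ∑ ω, ∑ a, w x ω a (s 0) * ∑ o : Fin n → Ω, ∑ b : Fin n → A,
          ∏ k : Fin n, w (s k.castSucc) (o k) (b k) (s k.succ) else 0 := by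
      intro y s
      by_cases hy : y = x
      · subst hy
        rw [← (Fin.consEquiv fun _ : Fin (n + 1) => Ω).sum_comp, Fintype.sum_prod_type]
        simp_rw [← (Fin.consEquiv fun _ : Fin (n + 1) => A).sum_comp, Fintype.sum_prod_type]
        simp only [Fin.consEquiv_apply, Fin.cons_zero, if_true, one_mul, Fin.prod_univ_succ,
          Fin.castSucc_zero, Fin.cons_succ, ← Fin.succ_castSucc]
        refine Finset.sum_congr rfl fun ω _ => ?_
        rw [Finset.sum_comm]
        refine Finset.sum_congr rfl fun a _ => ?_
        simp_rw [Finset.mul_sum]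
      · simp [Fin.consEquiv_apply, hy]
    simp_rw [h1]
    rw [Finset.sum_comm]
    simp only [Finset.sum_ite_eq', Finset.mem_univ, if_true]
    rw [← hsum x (by omega), Finset.sum_comm]
    refine Finset.sum_congr rfl fun ω _ => ?_
    rw [Finset.sum_comm]
    refine Finset.sum_congr rfl fun a _ => ?_
    have h2 : ∀ x', w x ω a x' = w x ω a x' *
        ∑ s : Fin (n + 1) → X, ∑ o : Fin n → Ω, ∑ b : Fin n → A,
          (if s 0 = x' then (1 : ℝ) else 0) *
          ∏ k : Fin n, w (s k.castSucc) (o k) (b k) (s k.succ) := by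
      intro x'
      by_cases h0 : w x ω a x' = 0
      · simp [h0]
      · rw [ih x' (by have := hl x ω a x' h0; omega), mul_one]
    rw [Finset.sum_congr rfl fun x' _ => h2 x']
    simp_rw [Finset.mul_sum (s := (Finset.univ : Finset (Fin (n + 1) → X)))]
    rw [Finset.sum_comm]
    refine Finset.sum_congr rfl fun s _ => ?_
    simp_rw [← Finset.mul_sum, ← mul_assoc, mul_ite, mul_one, mul_zero, ite_mul, zero_mul]
    simp

theorem MPP.sum_trajProb (M : MPP X Ω A L) (φ : Policy X Ω A) :
    ∑ τ : Traj X Ω A L, M.trajProb φ τ = 1 := by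
  classical
  have h := sum_paths_eq_one (fun x ω a x' => M.prior x ω * φ x ω a * M.trans x ω a x')
    M.layer L ?_ ?_ L M.init ?_
  · rw [← h]
    rw [← (Traj.equiv X Ω A L).symm.sum_comp, Fintype.sum_prod_type]
    refine Finset.sum_congr rfl fun s _ => ?_
    rw [Fintype.sum_prod_type]
    refine Finset.sum_congr rfl fun o _ => Finset.sum_congr rfl fun b _ => ?_
    simp only [MPP.trajProb, Traj.state, Traj.outcome, Traj.action]
    congr
  · intro x hx
    have hxf : x ≠ M.final := fun h => by
      have := (M.layer_eq_last_iff x).2 h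
      omega
    simp_rw [← Finset.mul_sum, M.trans_sum x _ _ hxf, mul_one, ← Finset.mul_sum]
    have h1 : ∀ ω, ∑ a, φ x ω a = 1 := fun ω => (φ x ω).2.2
    simp_rw [h1, mul_one]
    exact (M.prior x).2.2
  · intro x ω a x' h0
    exact M.loop_free x ω a x'
      (lt_of_le_of_ne (M.trans_nonneg x ω a x') fun h => h0 (by rw [← h, mul_zero]))
  · have := (M.layer_eq_zero_iff M.init).2 rfl
    omega

/-- `M.episodeLaw` as a transition kernel from policies to observations. -/
noncomputable def MPP.episodeKernel (M : MPP X Ω A L) :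
    Kernel (Policy X Ω A) (Obs X Ω A L) where
  toFun := M.episodeLaw
  measurable' := by
    refine Measure.measurable_of_measurable_coe _ fun s hs => ?_
    simp only [MPP.episodeLaw, Measure.coe_finsetSum, Finset.sum_apply, Measure.smul_apply,
      smul_eq_mul]
    exact Finset.measurable_sum _ fun τ _ =>
      (ENNReal.measurable_ofReal.comp (M.measurable_trajProb τ)).mul_const _

instance (M : MPP X Ω A L) : IsMarkovKernel M.episodeKernel := by
  refine ⟨fun φ => ⟨?_⟩⟩
  change M.episodeLaw φ Set.univ = 1
  simp only [MPP.episodeLaw, Measure.coe_finsetSum, Finset.sum_apply, Measure.smul_apply,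
    smul_eq_mul]
  have h : ∀ τ : Traj X Ω A L, M.rewardLaw.map (observe τ) Set.univ = 1 := fun τ => by
    rw [Measure.map_apply (measurable_observe τ) MeasurableSet.univ, Set.preimage_univ,
      measure_univ]
  simp_rw [h, mul_one]
  rw [← ENNReal.ofReal_sum_of_nonneg fun τ _ => M.trajProb_nonneg φ τ, M.sum_trajProb,
    ENNReal.ofReal_one]

/-- A learning algorithm for the sender: `act n h` is the policy committed to in the episode that
follows the `n` episodes whose full feedback is recorded in `h`. -/
structure Learner (X Ω A : Type*) [Fintype A] (L : ℕ) where
  act : (n : ℕ) → (Fin n → Obs X Ω A L) → Policy X Ω A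
  measurable_act : ∀ n, Measurable (act n)

/-- Law of the feedback of the first `n` episodes when the learner interacts with `M`: given the
past `h`, the next episode has law `M.episodeLaw (alg.act n h)`. -/
noncomputable def MPP.historyLaw (M : MPP X Ω A L) (alg : Learner X Ω A L) :
    (n : ℕ) → Measure (Fin n → Obs X Ω A L)
  | 0 => Measure.dirac Fin.elim0
  | n + 1 =>
    (M.historyLaw alg n ⊗ₘ M.episodeKernel.comap (alg.act n) (alg.measurable_act n)).map
      fun p => (Fin.snoc p.1 p.2 : Fin (n + 1) → Obs X Ω A L)

instance (M : MPP X Ω A L) (alg : Learner X Ω A L) (n : ℕ) :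
    IsProbabilityMeasure (M.historyLaw alg n) := by
  induction n with
  | zero => exact Measure.dirac.isProbabilityMeasure
  | succ n ih =>
    refine Measure.isProbabilityMeasure_map (Measurable.aemeasurable ?_)
    refine measurable_pi_lambda _ fun i => ?_
    refine Fin.lastCases ?_ (fun j => ?_) i
    · simpa using measurable_snd
    · simpa [Function.comp_def] using (measurable_pi_apply j).comp measurable_fst

/-- Mean rewards of the sender. -/
noncomputable def MPP.rS (M : MPP X Ω A L) (x : X) (ω : Ω) (a : A) : ℝ :=
  ∫ r, r.1 x ω a ∂M.rewardLaw

/-- Mean rewards of the receivers. -/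
noncomputable def MPP.rR (M : MPP X Ω A L) (x : X) (ω : Ω) (a : A) : ℝ :=
  ∫ r, r.2 x ω a ∂M.rewardLaw

open Classical in
/-- The occupancy measure `q^{P,φ,μ}(x,ω,a,x')`: the probability that `(x,ω,a,x')` is visited in
an episode (this can only happen at step `layer x`). -/
noncomputable def MPP.occ (M : MPP X Ω A L) (φ : Policy X Ω A) (x : X) (ω : Ω) (a : A)
    (x' : X) : ℝ :=
  ∑ τ : Traj X Ω A L, if τ.VisitsXOAX x ω a x' then M.trajProb φ τ else 0

end Model

section Marginals
variable {X Ω A : Type*} [Fintype X] [Fintype Ω] [Fintype A]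

/-- `q(x,ω,a)` -/
def margXOA (q : X → Ω → A → X → ℝ) (x : X) (ω : Ω) (a : A) : ℝ := ∑ x', q x ω a x'

/-- `q(x,ω)` -/
def margXO (q : X → Ω → A → X → ℝ) (x : X) (ω : Ω) : ℝ := ∑ a, margXOA q x ω a

/-- `q(x)` -/
def margX (q : X → Ω → A → X → ℝ) (x : X) : ℝ := ∑ ω, margXO q x ω

/-- The policy `φ` is induced by `q`, i.e. `φ(a | x, ω) = q(x,ω,a) / q(x,ω)`; where
`q(x,ω) = 0` the quotient is undefined and `φ(· | x, ω)` may be any distribution. -/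
def Induces (q : X → Ω → A → X → ℝ) (φ : Policy X Ω A) : Prop :=
  ∀ x ω a, margXO q x ω ≠ 0 → φ x ω a = margXOA q x ω a / margXO q x ω

end Marginals

section Objective
variable {X Ω A : Type*} [Fintype X] [Fintype Ω] [Fintype A] {L : ℕ}

/-- The sender's expected reward `r_S^⊤ q` in an episode played with `φ`, where `q = q^{P,φ,μ}`. -/
noncomputable def MPP.value (M : MPP X Ω A L) (φ : Policy X Ω A) : ℝ :=
  ∑ x, ∑ ω, ∑ a, margXOA (M.occ φ) x ω a * M.rS x ω a

/-- The persuasiveness constraints of the offline problem, for the occupancy measure of `φ`. -/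
def MPP.Persuasive (M : MPP X Ω A L) (φ : Policy X Ω A) : Prop :=
  ∀ x a a', 0 ≤ ∑ ω, margXOA (M.occ φ) x ω a * (M.rR x ω a - M.rR x ω a')

/-- The value `OPT` of the offline problem: the maximum of `r_S^⊤ q` over the valid occupancy
measures `q = q^{P,φ,μ}` that satisfy the persuasiveness constraints. -/
noncomputable def MPP.opt (M : MPP X Ω A L) : ℝ :=
  sSup {v | ∃ φ : Policy X Ω A, M.Persuasive φ ∧ v = M.value φ}

/-- The regret `R_T = T · OPT - ∑_t r_S^⊤ q_t` on the history `h` of `T` episodes. -/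
noncomputable def MPP.regret (M : MPP X Ω A L) (alg : Learner X Ω A L) {T : ℕ}
    (h : Fin T → Obs X Ω A L) : ℝ :=
  T * M.opt - ∑ t : Fin T, M.value (alg.act t fun i : Fin t => h (Fin.castLE t.is_le' i))

end Objective

section Estimators
variable {X Ω A : Type*} {L n : ℕ}

open Classical in
/-- Number of past episodes that visit `x`. -/
noncomputable def cntX (h : Fin n → Obs X Ω A L) (x : X) : ℕ :=
  (Finset.univ.filter fun i => (h i).1.VisitsX x).card

open Classical in
/-- Number of past episodes that visit `(x, ω)`. -/
noncomputable def cntXO (h : Fin n → Obs X Ω A L) (x : X) (ω : Ω) : ℕ :=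
  (Finset.univ.filter fun i => (h i).1.VisitsXO x ω).card

open Classical in
/-- Number of past episodes that visit `(x, ω, a)`. -/
noncomputable def cntXOA (h : Fin n → Obs X Ω A L) (x : X) (ω : Ω) (a : A) : ℕ :=
  (Finset.univ.filter fun i => (h i).1.VisitsXOA x ω a).card

open Classical in
/-- Number of past episodes that visit `(x, ω, a, x')`. -/
noncomputable def cntXOAX (h : Fin n → Obs X Ω A L) (x : X) (ω : Ω) (a : A) (x' : X) : ℕ :=
  (Finset.univ.filter fun i => (h i).1.VisitsXOAX x ω a x').card

/-- Empirical transition probabilities. -/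
noncomputable def estP (h : Fin n → Obs X Ω A L) (x : X) (ω : Ω) (a : A) (x' : X) : ℝ :=
  (cntXOAX h x ω a x' : ℝ) / max 1 (cntXOA h x ω a : ℝ)

/-- Empirical prior. -/
noncomputable def estPrior (h : Fin n → Obs X Ω A L) (x : X) (ω : Ω) : ℝ :=
  (cntXO h x ω : ℝ) / max 1 (cntX h x : ℝ)

open Classical in
/-- Empirical mean of the observed sender's rewards of `(x, ω, a)`; under full feedback such a
reward is observed in every episode that visits `(x, ω)`. -/
noncomputable def estS (h : Fin n → Obs X Ω A L) (x : X) (ω : Ω) (a : A) : ℝ :=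
  (∑ i, ∑ k : Fin L, if (h i).1.state k.castSucc = x ∧ (h i).1.outcome k = ω
    then (h i).2.1 k a else 0) / max 1 (cntXO h x ω : ℝ)

open Classical in
/-- Empirical mean of the observed receivers' rewards of `(x, ω, a)`. -/
noncomputable def estR (h : Fin n → Obs X Ω A L) (x : X) (ω : Ω) (a : A) : ℝ :=
  (∑ i, ∑ k : Fin L, if (h i).1.state k.castSucc = x ∧ (h i).1.outcome k = ω
    then (h i).2.2 k a else 0) / max 1 (cntXO h x ω : ℝ)

end Estimators

section OPPS
variable {X Ω A : Type*} [Fintype X] [Fintype Ω] [Fintype A] {L n : ℕ}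

/-- The layer that follows the one of `x`. -/
def Layering.next (G : Layering X L) (x : X) : Finset X :=
  Finset.univ.filter fun x' => G.layer x' = G.layer x + 1

/-- Confidence bound `ε_t(x,ω,a)` for transitions. -/
noncomputable def confP (G : Layering X L) (T : ℕ) (δ : ℝ) (h : Fin n → Obs X Ω A L)
    (x : X) (ω : Ω) (a : A) : ℝ :=
  √(2 * ((G.next x).card : ℝ) *
    Real.log (T * Fintype.card X * Fintype.card Ω * Fintype.card A / δ) /
      max 1 (cntXOA h x ω a : ℝ))

/-- Confidence bound `ζ_t(x)` for the prior. -/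
noncomputable def confPrior (T : ℕ) (δ : ℝ) (h : Fin n → Obs X Ω A L) (x : X) : ℝ :=
  √(2 * Fintype.card Ω * Real.log (T * Fintype.card X / δ) / max 1 (cntX h x : ℝ))

/-- Confidence bound `ξ_{S,t}(x,ω,a) = ξ_{R,t}(x,ω,a)` for rewards under full feedback. -/
noncomputable def confRew (T : ℕ) (δ : ℝ) (h : Fin n → Obs X Ω A L) (x : X) (ω : Ω) : ℝ :=
  min 1 (√(Real.log (3 * T * Fintype.card X * Fintype.card Ω / δ) / max 1 (cntXO h x ω : ℝ)))

/-- The constraints of the optimistic linear program `Opt-Opt` after the history `h`, in the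
variables `q`, `ζ` and `ε`.  Only entries `q x ω a x'` between consecutive layers are variables
of the program; the other ones are set to zero. -/
structure OptOptFeasible (G : Layering X L) (T : ℕ) (δ : ℝ) (h : Fin n → Obs X Ω A L)
    (q : X → Ω → A → X → ℝ) (ζ : X → Ω → ℝ) (ε : X → Ω → A → X → ℝ) : Prop where
  eq_zero : ∀ x ω a x', x' ∉ G.next x → q x ω a x' = 0
  nonneg : ∀ x ω a x', 0 ≤ q x ω a x'
  sum_layer : ∀ k < L, ∑ x ∈ Finset.univ.filter (fun x => G.layer x = k), margX q x = 1
  flow : ∀ x, 0 < G.layer x → G.layer x < L → ∑ x', ∑ ω, ∑ a, q x' ω a x = margX q x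
  trans_upper : ∀ x ω a, ∀ x' ∈ G.next x,
    q x ω a x' - estP h x ω a x' * margXOA q x ω a ≤ ε x ω a x'
  trans_lower : ∀ x ω a, ∀ x' ∈ G.next x,
    estP h x ω a x' * margXOA q x ω a - q x ω a x' ≤ ε x ω a x'
  trans_sum : ∀ x ω a, ∑ x' ∈ G.next x, ε x ω a x' ≤ confP G T δ h x ω a * margXOA q x ω a
  prior_upper : ∀ x ω, G.layer x < L →
    margXO q x ω - estPrior h x ω * margX q x ≤ ζ x ω
  prior_lower : ∀ x ω, G.layer x < L →
    estPrior h x ω * margX q x - margXO q x ω ≤ ζ x ω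
  prior_sum : ∀ x, G.layer x < L → ∑ ω, ζ x ω ≤ confPrior T δ h x * margX q x
  persuasive : ∀ x a a', G.layer x < L →
    0 ≤ ∑ ω, margXOA q x ω a *
      (estR h x ω a + confRew T δ h x ω - estR h x ω a' + confRew T δ h x ω)

/-- The objective of `Opt-Opt`. -/
noncomputable def optOptObjective (T : ℕ) (δ : ℝ) (h : Fin n → Obs X Ω A L)
    (q : X → Ω → A → X → ℝ) : ℝ :=
  ∑ x, ∑ ω, ∑ a, margXOA q x ω a * (estS h x ω a + confRew T δ h x ω)

/-- `(q, ζ, ε)` is an optimal solution of `Opt-Opt`. -/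
def IsOptOptSolution (G : Layering X L) (T : ℕ) (δ : ℝ) (h : Fin n → Obs X Ω A L)
    (q : X → Ω → A → X → ℝ) (ζ : X → Ω → ℝ) (ε : X → Ω → A → X → ℝ) : Prop :=
  OptOptFeasible G T δ h q ζ ε ∧ ∀ q' ζ' ε', OptOptFeasible G T δ h q' ζ' ε' →
    optOptObjective T δ h q' ≤ optOptObjective T δ h q

/-- The learner runs `OPPS` with full feedback on `T` episodes with confidence parameter `δ`: in
each episode it commits to a policy induced by some optimal solution of `Opt-Opt`.  Ties are
broken arbitrarily, and if `Opt-Opt` is infeasible, any policy may be used. -/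
def IsOPPS (G : Layering X L) (T : ℕ) (δ : ℝ) (alg : Learner X Ω A L) : Prop :=
  ∀ n < T, ∀ h : Fin n → Obs X Ω A L, (∃ q ζ ε, OptOptFeasible G T δ h q ζ ε) →
    ∃ q ζ ε, IsOptOptSolution G T δ h q ζ ε ∧ Induces q (alg.act n h)

end OPPS

end Persuasion

/-!
The proof is the optimism argument for occupancy measures.

*Estimates.* With high probability all empirical quantities stay within their confidence widths at
all times.  Everything probabilistic rests on Ville's maximal inequality for the interaction of the
learner with the process, in its exponential form `MPP.historyLaw_exists_le_sum`: the increments of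
the exponent may depend on the whole past, and the bound is uniform in time.  Applied to the
deviations collected at the visits of a pair or triplet, it gives a Hoeffding bound at the time of
the `m`-th visit (`MPP.historyLaw_visits_le`).  A union bound over the subsets of the next layer, or
of the outcomes, turns it into Weissman's `ℓ¹` inequality for empirical transitions and priors
(`MPP.historyLaw_weissman`).  For the rewards one has a union bound over the actions, which the
confidence widths do not pay for: it is affordable when `|A| ≤ T`, and when `|A| > T` the claimed
regret bound exceeds the trivial bound `T L`.

*Markov property.* The law of a trajectory is a product of step probabilities.  Multiplying the
steps that leave a state `x` by `1 + h`, with `h` centred, keeps the path weights summing to one;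
since a layered path visits `x` at most once, this says that `𝟙{x visited} h` has mean zero
(`MPP.sum_trajProb_mul_step`).  Both the factorization of occupancy measures and the conditional
Hoeffding bounds follow from this identity.

*Optimism.* While the estimates are accurate, the occupancy measure of every persuasive policy is
feasible for `Opt-Opt`, so the optimal value of the program is at least `OPT`.  The optimal solution
`q̂` and the true occupancy measure of the induced policy satisfy the same flow equations, and their
differences add up from layer to layer (`OptOptFeasible.sum_layer_le`), weighted by the true
occupancies.  Hence the loss of one episode is at most the expectation of its *price*, a sum of
confidence widths along the trajectory (`MPP.value_sub_value_le`).

*Summation.* The widths are clipped at one.  This keeps the prices within `[0, 14 L²]`, so that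
replacing expected by realized prices costs only `O(L² √(T ln (1/δ)))`
(`MPP.historyLaw_price_le`); without the clipping a second factor `√(ln (1/δ))` would appear.  The
realized prices are sums of `√(c / N)` over visits, bounded by Cauchy–Schwarz over the visited items
(`sum_width_le`).
-/

namespace Persuasion

open scoped ENNReal

/-! ### Ville's inequality along the interaction -/

/-- The first `j` entries of a history of length `n`. -/
def pre {α : Type*} {j n : ℕ} (hj : j ≤ n) (h : Fin n → α) : Fin j → α :=
  fun i => h (Fin.castLE hj i)

theorem pre_snoc {α : Type*} {j n : ℕ} (hj : j ≤ n) (h : Fin n → α) (o : α) :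
    pre (hj.trans n.le_succ) (Fin.snoc h o : Fin (n + 1) → α) = pre hj h := by
  funext i
  exact Fin.snoc_castSucc (α := fun _ => α) o h (Fin.castLE hj i)

theorem measurable_pre {α : Type*} [MeasurableSpace α] {j n : ℕ} (hj : j ≤ n) :
    Measurable (pre hj : (Fin n → α) → Fin j → α) :=
  measurable_pi_lambda _ fun i => measurable_pi_apply (Fin.castLE hj i)

theorem measurable_snoc {α : Type*} [MeasurableSpace α] {n : ℕ} :
    Measurable fun p : (Fin n → α) × α => (Fin.snoc p.1 p.2 : Fin (n + 1) → α) := by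
  refine measurable_pi_lambda _ fun i => ?_
  refine Fin.lastCases ?_ (fun j => ?_) i
  · simpa using measurable_snd
  · simpa [Function.comp_def] using (measurable_pi_apply j).comp measurable_fst

section Ville
variable {X Ω A : Type*} [Fintype X] [Fintype Ω] [Fintype A] {L : ℕ}

theorem MPP.lintegral_episodeLaw (M : MPP X Ω A L) (φ : Policy X Ω A)
    {F : Obs X Ω A L → ℝ≥0∞} (hF : Measurable F) :
    ∫⁻ o, F o ∂M.episodeLaw φ =
      ∑ τ : Traj X Ω A L, ENNReal.ofReal (M.trajProb φ τ) *
        ∫⁻ r, F (observe τ r) ∂M.rewardLaw := by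
  unfold MPP.episodeLaw
  rw [lintegral_finsetSum_measure]
  refine Finset.sum_congr rfl fun τ _ => ?_
  rw [lintegral_smul_measure, lintegral_map hF (measurable_observe τ), smul_eq_mul]

theorem MPP.lintegral_historyLaw_succ (M : MPP X Ω A L) (alg : Learner X Ω A L) (n : ℕ)
    {F : (Fin (n + 1) → Obs X Ω A L) → ℝ≥0∞} (hF : Measurable F) :
    ∫⁻ h, F h ∂M.historyLaw alg (n + 1) =
      ∫⁻ h, ∫⁻ o, F (Fin.snoc h o) ∂M.episodeLaw (alg.act n h) ∂M.historyLaw alg n := by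
  rw [MPP.historyLaw, lintegral_map hF measurable_snoc]
  exact Measure.lintegral_compProd (hF.comp measurable_snoc)

theorem measurableSet_exists_pre {α : Type*} [MeasurableSpace α] {n : ℕ}
    {B : ∀ n, Set (Fin n → α)} (hB : ∀ n, MeasurableSet (B n)) :
    MeasurableSet {h : Fin n → α | ∃ j, ∃ hj : j ≤ n, pre hj h ∈ B j} := by
  have : {h : Fin n → α | ∃ j, ∃ hj : j ≤ n, pre hj h ∈ B j} =
      ⋃ j, ⋃ hj : j ≤ n, pre hj ⁻¹' B j := by
    ext h; simp
  rw [this]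
  exact MeasurableSet.iUnion fun j => MeasurableSet.iUnion fun hj => measurable_pre hj (hB j)

/-- Ville's maximal inequality for a nonnegative supermartingale along the interaction of the
learner with `M`.  Once the level `c` is reached, freezing the process at `c` keeps it a
supermartingale, which is what the induction carries along. -/
theorem MPP.mul_historyLaw_exists_le (M : MPP X Ω A L) (alg : Learner X Ω A L)
    {f : ∀ n, (Fin n → Obs X Ω A L) → ℝ≥0∞} (hf : ∀ n, Measurable (f n)) (h0 : ∀ h, f 0 h ≤ 1)
    (hstep : ∀ n h, ∫⁻ o, f (n + 1) (Fin.snoc h o) ∂M.episodeLaw (alg.act n h) ≤ f n h)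
    (c : ℝ≥0∞) (T : ℕ) :
    c * M.historyLaw alg T {h | ∃ j, ∃ hj : j ≤ T, c ≤ f j (pre hj h)} ≤ 1 := by
  classical
  set E : ∀ n, Set (Fin n → Obs X Ω A L) := fun n => {h | ∃ j, ∃ hj : j ≤ n, c ≤ f j (pre hj h)}
    with hE
  have hEm : ∀ n, MeasurableSet (E n) := fun n =>
    measurableSet_exists_pre (B := fun n => {h | c ≤ f n h}) fun n =>
      measurableSet_le measurable_const (hf n)
  set g : ∀ n, (Fin n → Obs X Ω A L) → ℝ≥0∞ := fun n h => if h ∈ E n then c else f n h with hg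
  have hgm : ∀ n, Measurable (g n) := fun n => Measurable.ite (hEm n) measurable_const (hf n)
  have hprob : ∀ φ, IsProbabilityMeasure (M.episodeLaw φ) := fun φ =>
    inferInstanceAs (IsProbabilityMeasure (M.episodeKernel φ))
  have key : ∀ n, ∫⁻ h, g n h ∂M.historyLaw alg n ≤ 1 := by
    intro n
    induction n with
    | zero =>
      rw [MPP.historyLaw, lintegral_dirac' _ (hgm 0)]
      simp only [hg]
      split_ifs with h
      · obtain ⟨j, hj, hc⟩ := h
        obtain rfl : j = 0 := by omega
        exact hc.trans (h0 _)
      · exact h0 _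
    | succ n ih =>
      rw [M.lintegral_historyLaw_succ alg n (hgm _)]
      refine le_trans (lintegral_mono fun h => ?_) ih
      by_cases hh : h ∈ E n
      · have h1 : ∀ o, g (n + 1) (Fin.snoc h o) = c := fun o => by
          obtain ⟨j, hj, hc⟩ := hh
          exact if_pos ⟨j, hj.trans n.le_succ, by rw [pre_snoc hj]; exact hc⟩
        simp only [h1, lintegral_const, measure_univ, mul_one]
        simp only [hg, if_pos hh, le_refl]
      · have h1 : ∀ o, g (n + 1) (Fin.snoc h o) ≤ f (n + 1) (Fin.snoc h o) := fun o => by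
          simp only [hg]
          split_ifs with h2
          · obtain ⟨j, hj, hc⟩ := h2
            rcases Nat.lt_or_ge n j with hlt | hle
            · obtain rfl : j = n + 1 := by omega
              exact hc
            · exact absurd ⟨j, hle, by rw [← pre_snoc hle h o]; exact hc⟩ hh
          · exact le_rfl
        refine (lintegral_mono h1).trans ((hstep n h).trans ?_)
        simp only [hg, if_neg hh, le_refl]
  refine le_trans ?_ (key T)
  rw [← lintegral_indicator_const (hEm T)]
  refine lintegral_mono fun h => ?_
  by_cases hh : h ∈ E T
  · simp [hg, hh]
  · simp [hg, hh]

/-- Exponential form of Ville's inequality: if the increments `g` satisfy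
`E[exp (g n h ·)] ≤ 1` given every past `h`, then their partial sums ever reach the level `u`
with probability at most `exp (-u)`. -/
theorem MPP.historyLaw_exists_le_sum (M : MPP X Ω A L) (alg : Learner X Ω A L)
    {g : ∀ n, (Fin n → Obs X Ω A L) → Obs X Ω A L → ℝ}
    (hg : ∀ n, Measurable fun p : (Fin n → Obs X Ω A L) × Obs X Ω A L => g n p.1 p.2)
    (hexp : ∀ n h, ∫⁻ o, ENNReal.ofReal (Real.exp (g n h o)) ∂M.episodeLaw (alg.act n h) ≤ 1)
    (u : ℝ) (T : ℕ) :
    M.historyLaw alg T {h | ∃ n, ∃ hn : n ≤ T,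
      u ≤ ∑ i : Fin n, g i (pre (i.is_lt.le.trans hn) h) (h (Fin.castLE hn i))} ≤
      ENNReal.ofReal (Real.exp (-u)) := by
  set S : ∀ n, (Fin n → Obs X Ω A L) → ℝ := fun n h =>
    ∑ i : Fin n, g i (pre i.is_lt.le h) (h i) with hS
  have hSm : ∀ n, Measurable (S n) := fun n =>
    Finset.measurable_sum _ fun i _ =>
      (hg i).comp ((measurable_pre i.is_lt.le).prodMk (measurable_pi_apply i))
  have hV := M.mul_historyLaw_exists_le alg (f := fun n h => ENNReal.ofReal (Real.exp (S n h)))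
    (fun n => ENNReal.measurable_ofReal.comp (Real.measurable_exp.comp (hSm n)))
    (fun h => by simp [hS]) (fun n h => ?_) (ENNReal.ofReal (Real.exp u)) T
  · rw [Real.exp_neg, ENNReal.ofReal_inv_of_pos (Real.exp_pos u), ← one_div,
      ENNReal.le_div_iff_mul_le (Or.inl (by simpa using Real.exp_pos u)) (Or.inl (by simp)),
      mul_comm]
    refine le_trans (mul_le_mul_right (measure_mono ?_) _) hV
    rintro h ⟨n, hn, hu⟩
    exact ⟨n, hn, ENNReal.ofReal_le_ofReal (Real.exp_le_exp.2 hu)⟩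
  · have h1 : ∀ o, ENNReal.ofReal (Real.exp (S (n + 1) (Fin.snoc h o))) =
        ENNReal.ofReal (Real.exp (S n h)) * ENNReal.ofReal (Real.exp (g n h o)) := fun o => by
      rw [← ENNReal.ofReal_mul (Real.exp_pos _).le, ← Real.exp_add]
      congr 2
      simp only [hS, Fin.sum_univ_castSucc, Fin.snoc_castSucc, Fin.snoc_last]
      congr 1
      · refine Finset.sum_congr rfl fun i _ => ?_
        exact congrArg (fun z => g i z (h i)) (pre_snoc i.is_lt.le h o)
      · exact congrArg (fun z => g n z o) (pre_snoc le_rfl h o)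
    simp_rw [h1]
    rw [lintegral_const_mul]
    · exact mul_le_of_le_one_right' (hexp n h)
    · exact ENNReal.measurable_ofReal.comp
        (Real.measurable_exp.comp ((hg n).comp measurable_prodMk_left))

end Ville

/-! ### Occupancy measures and the Markov property -/

section Steps
variable {X Ω A : Type*} {L : ℕ}

/-- The sum of `F (x_k, ω_k, a_k, x_{k+1})` along a trajectory. -/
def Traj.sumSteps (τ : Traj X Ω A L) (F : X → Ω → A → X → ℝ) : ℝ :=
  ∑ k : Fin L, F (τ.state k.castSucc) (τ.outcome k) (τ.action k) (τ.state k.succ)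

/-- The trajectory is in layer `k` at step `k`. -/
def Layering.Follows (G : Layering X L) (τ : Traj X Ω A L) : Prop :=
  ∀ k : Fin (L + 1), G.layer (τ.state k) = k

theorem Layering.Follows.eq_of_state_eq {G : Layering X L} {τ : Traj X Ω A L} (hτ : G.Follows τ)
    {k k' : Fin L} (h : τ.state k.castSucc = τ.state k'.castSucc) : k = k' := by
  have h1 := hτ k.castSucc
  rw [h, hτ k'.castSucc] at h1
  exact Fin.ext (by simpa using h1.symm)

end Steps

section Occupancy
variable {X Ω A : Type*} [Fintype X] [Fintype Ω] [Fintype A] {L : ℕ}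

/-- The probability of the step `(x, ω, a, x')` from the state `x` under the policy `φ`. -/
noncomputable def MPP.stepProb (M : MPP X Ω A L) (φ : Policy X Ω A) (x : X) (ω : Ω) (a : A)
    (x' : X) : ℝ :=
  M.prior x ω * φ x ω a * M.trans x ω a x'

theorem MPP.layer_lt_iff (M : MPP X Ω A L) (x : X) : M.layer x < L ↔ x ≠ M.final := by
  rw [Ne, ← M.layer_eq_last_iff x]
  exact (M.layer_le x).lt_iff_ne

theorem MPP.layer_init (M : MPP X Ω A L) : M.layer M.init = 0 := (M.layer_eq_zero_iff _).2 rfl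

theorem MPP.stepProb_eq_zero (M : MPP X Ω A L) (φ : Policy X Ω A) {x : X} {ω : Ω} {a : A} {x' : X}
    (h : M.layer x' ≠ M.layer x + 1) : M.stepProb φ x ω a x' = 0 := by
  have h1 : M.trans x ω a x' = 0 := by
    by_contra h0
    exact h (M.loop_free x ω a x' (lt_of_le_of_ne (M.trans_nonneg x ω a x') (Ne.symm h0)))
  rw [MPP.stepProb, h1, mul_zero]

theorem MPP.sum_stepProb (M : MPP X Ω A L) (φ : Policy X Ω A) {x : X} (hx : M.layer x < L) :
    ∑ ω, ∑ a, ∑ x', M.stepProb φ x ω a x' = 1 := by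
  have hxf := (M.layer_lt_iff x).1 hx
  have h1 : ∀ ω, ∑ a, φ x ω a = 1 := fun ω => (φ x ω).2.2
  simp_rw [MPP.stepProb, ← Finset.mul_sum, M.trans_sum x _ _ hxf, mul_one, ← Finset.mul_sum, h1,
    mul_one]
  exact (M.prior x).2.2

theorem MPP.follows_of_trajProb_ne_zero (M : MPP X Ω A L) {φ : Policy X Ω A} {τ : Traj X Ω A L}
    (h : M.trajProb φ τ ≠ 0) : M.Follows τ := by
  unfold MPP.trajProb at h
  have h0 := left_ne_zero_of_mul h
  have h1 := Finset.prod_ne_zero_iff.1 (right_ne_zero_of_mul h)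
  intro k
  induction k using Fin.induction with
  | zero =>
    have : τ.state 0 = M.init := by
      by_contra h2
      simp [h2] at h0
    rw [this, M.layer_init]
    rfl
  | succ k ih =>
    have h2 := right_ne_zero_of_mul (h1 k (Finset.mem_univ k))
    rw [M.loop_free _ _ _ _ (lt_of_le_of_ne (M.trans_nonneg _ _ _ _) h2.symm), ih]
    simp

/-- Two functions that agree on the trajectories that follow the layers have the same
expectation. -/
theorem MPP.sum_trajProb_mul_congr (M : MPP X Ω A L) (φ : Policy X Ω A) {F G : Traj X Ω A L → ℝ}
    (h : ∀ τ, M.Follows τ → F τ = G τ) :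
    ∑ τ, M.trajProb φ τ * F τ = ∑ τ, M.trajProb φ τ * G τ := by
  refine Finset.sum_congr rfl fun τ _ => ?_
  by_cases h0 : M.trajProb φ τ = 0
  · simp [h0]
  · rw [h τ (M.follows_of_trajProb_ne_zero h0)]

theorem prod_one_add_eq {ι : Type*} [Fintype ι] (g : ι → ℝ)
    (h : ∀ i j, g i ≠ 0 → g j ≠ 0 → i = j) : ∏ i, (1 + g i) = 1 + ∑ i, g i := by
  by_cases h0 : ∃ i, g i ≠ 0
  · obtain ⟨i, hi⟩ := h0
    have h1 : ∀ j, j ≠ i → g j = 0 := fun j hj => by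
      by_contra hj0
      exact hj (h j i hj0 hi)
    rw [Fintype.prod_eq_single i fun j hj => by rw [h1 j hj, add_zero],
      Fintype.sum_eq_single i h1]
  · push Not at h0
    simp [h0]

theorem ite_eq_sum_of_iff_exists {ι : Type*} [Fintype ι] {q : Prop} {p : ι → Prop} [Decidable q]
    [DecidablePred p] (hq : q ↔ ∃ i, p i) (h : ∀ i j, p i → p j → i = j) (c : ℝ) :
    (if q then c else 0) = ∑ i, if p i then c else 0 := by
  by_cases h0 : q
  · obtain ⟨i, hi⟩ := hq.1 h0
    rw [if_pos h0, Fintype.sum_eq_single i fun j hj => if_neg fun hpj => hj (h j i hpj hi),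
      if_pos hi]
  · rw [if_neg h0]
    rw [hq] at h0
    push Not at h0
    simp [h0]

open Classical in
/-- The Markov property of an episode.  Since a layered path visits `x` at most once, reweighting
the steps that start in `x` by `1 + h`, where `h` is centred, changes the path weight by the
factor `1 + 𝟙{x visited} h`; the reweighted path weights still add up to one, so
`𝟙{x visited} h` has mean zero. -/
theorem MPP.sum_trajProb_mul_step (M : MPP X Ω A L) (φ : Policy X Ω A) {x : X}
    (hx : M.layer x < L) (f : Ω → A → X → ℝ) :
    ∑ τ, M.trajProb φ τ * τ.sumSteps (fun y ω a y' => if y = x then f ω a y' else 0) =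
      (∑ τ, M.trajProb φ τ * τ.sumSteps (fun y _ _ _ => if y = x then 1 else 0)) *
        ∑ ω, ∑ a, ∑ x', M.stepProb φ x ω a x' * f ω a x' := by
  set c := ∑ ω, ∑ a, ∑ x', M.stepProb φ x ω a x' * f ω a x' with hc
  set h : X → Ω → A → X → ℝ := fun y ω a y' => if y = x then f ω a y' - c else 0 with hh
  have hpaths := sum_paths_eq_one (fun y ω a y' => M.stepProb φ y ω a y' * (1 + h y ω a y'))
    M.layer L ?_ ?_ L M.init ?_
  · have h1 : ∑ τ, M.trajProb φ τ * (1 + τ.sumSteps h) = 1 := by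
      refine Eq.trans ?_ hpaths
      rw [← (Traj.equiv X Ω A L).symm.sum_comp, Fintype.sum_prod_type]
      refine Finset.sum_congr rfl fun s _ => ?_
      rw [Fintype.sum_prod_type]
      refine Finset.sum_congr rfl fun o _ => Finset.sum_congr rfl fun b _ => ?_
      set τ : Traj X Ω A L := (Traj.equiv X Ω A L).symm (s, o, b) with hτ
      rw [Finset.prod_mul_distrib, ← mul_assoc]
      have h2 : M.trajProb φ τ = (if s 0 = M.init then (1 : ℝ) else 0) *
          ∏ k : Fin L, M.stepProb φ (s k.castSucc) (o k) (b k) (s k.succ) := by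
        unfold MPP.trajProb
        congr
      rw [← h2]
      by_cases h0 : M.trajProb φ τ = 0
      · simp [h0]
      · congr 1
        have hf := M.follows_of_trajProb_ne_zero h0
        refine (prod_one_add_eq (fun k : Fin L => h (s k.castSucc) (o k) (b k) (s k.succ))
          fun k k' hk hk' => ?_).symm
        have e : ∀ k : Fin L, h (s k.castSucc) (o k) (b k) (s k.succ) ≠ 0 →
            τ.state k.castSucc = x := fun k hk => by
          by_contra hne
          exact hk (if_neg hne)
        exact hf.eq_of_state_eq ((e k hk).trans (e k' hk').symm)
    simp_rw [mul_add, mul_one, Finset.sum_add_distrib, M.sum_trajProb] at h1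
    have h2 : ∀ τ : Traj X Ω A L, τ.sumSteps h =
        τ.sumSteps (fun y ω a y' => if y = x then f ω a y' else 0) -
          τ.sumSteps (fun y _ _ _ => if y = x then 1 else 0) * c := fun τ => by
      simp only [Traj.sumSteps, hh, Finset.sum_mul, ← Finset.sum_sub_distrib]
      refine Finset.sum_congr rfl fun k _ => ?_
      split_ifs <;> ring
    simp_rw [h2, mul_sub, Finset.sum_sub_distrib, ← mul_assoc, ← Finset.sum_mul] at h1
    linarith
  · intro y hy
    simp_rw [mul_add, mul_one, Finset.sum_add_distrib, M.sum_stepProb φ hy]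
    by_cases hyx : y = x
    · subst hyx
      simp_rw [hh, if_true, mul_sub, Finset.sum_sub_distrib, ← Finset.sum_mul,
        M.sum_stepProb φ hy]
      rw [← hc]; ring
    · simp [hh, hyx]
  · intro y ω a y' h0
    by_contra hne
    exact h0 (by rw [M.stepProb_eq_zero φ hne, zero_mul])
  · rw [M.layer_init, zero_add]

open Classical in
/-- A layered trajectory visits `(x, ω, a, x')` at most once, so the visiting probability is an
expected number of visits. -/
theorem MPP.occ_eq (M : MPP X Ω A L) (φ : Policy X Ω A) (x : X) (ω : Ω) (a : A) (x' : X) :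
    M.occ φ x ω a x' = ∑ τ, M.trajProb φ τ * τ.sumSteps
      (fun y o b y' => if y = x ∧ o = ω ∧ b = a ∧ y' = x' then 1 else 0) := by
  have h1 : M.occ φ x ω a x' =
      ∑ τ, M.trajProb φ τ * (if τ.VisitsXOAX x ω a x' then 1 else 0) := by
    unfold MPP.occ
    refine Finset.sum_congr rfl fun τ _ => ?_
    split_ifs <;> simp
  rw [h1]
  refine M.sum_trajProb_mul_congr φ fun τ hτ => ?_
  exact ite_eq_sum_of_iff_exists (q := τ.VisitsXOAX x ω a x') Iff.rfl
    (fun k k' hk hk' => hτ.eq_of_state_eq (hk.1.trans hk'.1.symm)) _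

/-- Integrating `F` against the occupancy measure gives the expected sum of `F` along an
episode. -/
theorem MPP.sum_occ_mul (M : MPP X Ω A L) (φ : Policy X Ω A) (F : X → Ω → A → X → ℝ) :
    ∑ x, ∑ ω, ∑ a, ∑ x', M.occ φ x ω a x' * F x ω a x' =
      ∑ τ, M.trajProb φ τ * τ.sumSteps F := by
  classical
  have e : ∀ G : X → Ω → A → X → ℝ, ∑ x, ∑ ω, ∑ a, ∑ x', G x ω a x' =
      ∑ z : X × Ω × A × X, G z.1 z.2.1 z.2.2.1 z.2.2.2 := fun G => by
    simp_rw [Fintype.sum_prod_type]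
  rw [e]
  simp_rw [M.occ_eq, Finset.sum_mul]
  rw [Finset.sum_comm]
  refine Finset.sum_congr rfl fun τ _ => ?_
  simp_rw [mul_assoc, ← Finset.mul_sum, Traj.sumSteps, Finset.sum_mul]
  congr 1
  rw [Finset.sum_comm]
  refine Finset.sum_congr rfl fun k _ => ?_
  rw [Fintype.sum_eq_single
    (τ.state k.castSucc, τ.outcome k, τ.action k, τ.state k.succ)]
  · simp
  · rintro ⟨x, ω, a, x'⟩ hz
    rw [if_neg, zero_mul]
    rintro ⟨rfl, rfl, rfl, rfl⟩
    exact hz rfl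

theorem MPP.occ_nonneg (M : MPP X Ω A L) (φ : Policy X Ω A) (x : X) (ω : Ω) (a : A) (x' : X) :
    0 ≤ M.occ φ x ω a x' :=
  Finset.sum_nonneg fun τ _ => by
    split_ifs
    · exact M.trajProb_nonneg φ τ
    · exact le_rfl

open Classical in
theorem MPP.margX_occ (M : MPP X Ω A L) (φ : Policy X Ω A) (x : X) :
    margX (M.occ φ) x =
      ∑ τ, M.trajProb φ τ * τ.sumSteps (fun y _ _ _ => if y = x then 1 else 0) := by
  rw [← M.sum_occ_mul]
  simp only [margX, margXO, margXOA]
  rw [Fintype.sum_eq_single x]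
  · simp
  · intro y hy
    simp [hy]

theorem MPP.occ_eq_zero_of_final (M : MPP X Ω A L) (φ : Policy X Ω A) {x : X}
    (hx : ¬ M.layer x < L) (ω : Ω) (a : A) (x' : X) : M.occ φ x ω a x' = 0 := by
  classical
  rw [M.occ_eq, M.sum_trajProb_mul_congr φ (G := fun _ => 0)]
  · simp
  · intro τ hτ
    refine Finset.sum_eq_zero fun k _ => if_neg fun h => hx ?_
    rw [← h.1, hτ k.castSucc]
    exact k.is_lt

/-- The occupancy measure factorizes as `q(x) μ(ω | x) φ(a | x, ω) P(x' | x, ω, a)`. -/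
theorem MPP.occ_eq_margX_mul (M : MPP X Ω A L) (φ : Policy X Ω A) (x : X) (ω : Ω) (a : A)
    (x' : X) : M.occ φ x ω a x' = margX (M.occ φ) x * M.stepProb φ x ω a x' := by
  classical
  by_cases hx : M.layer x < L
  · have h := M.sum_trajProb_mul_step φ hx fun o b y' => if o = ω ∧ b = a ∧ y' = x' then 1 else 0
    rw [← M.margX_occ] at h
    have h1 : ∑ o, ∑ b, ∑ y', M.stepProb φ x o b y' *
        (if o = ω ∧ b = a ∧ y' = x' then (1 : ℝ) else 0) = M.stepProb φ x ω a x' := by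
      simp only [ite_and, mul_ite, mul_one, mul_zero, Finset.sum_ite_irrel, Finset.sum_const_zero,
        Finset.sum_ite_eq', Finset.mem_univ, if_true]
    rw [h1] at h
    rw [← h, M.occ_eq]
    simp only [ite_and]
  · have h1 : margX (M.occ φ) x = 0 := by
      simp [margX, margXO, margXOA, M.occ_eq_zero_of_final φ hx]
    rw [h1, zero_mul, M.occ_eq_zero_of_final φ hx]

theorem MPP.margXOA_occ (M : MPP X Ω A L) (φ : Policy X Ω A) (x : X) (ω : Ω) (a : A) :
    margXOA (M.occ φ) x ω a = margX (M.occ φ) x * M.prior x ω * φ x ω a := by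
  by_cases hx : M.layer x < L
  · rw [margXOA]
    simp_rw [M.occ_eq_margX_mul φ x, MPP.stepProb]
    rw [← Finset.mul_sum, ← Finset.mul_sum, M.trans_sum x ω a ((M.layer_lt_iff x).1 hx)]
    ring
  · simp [margX, margXO, margXOA, M.occ_eq_zero_of_final φ hx]

theorem MPP.margXO_occ (M : MPP X Ω A L) (φ : Policy X Ω A) (x : X) (ω : Ω) :
    margXO (M.occ φ) x ω = margX (M.occ φ) x * M.prior x ω := by
  have h1 : ∑ a, φ x ω a = 1 := (φ x ω).2.2
  rw [margXO]
  simp_rw [M.margXOA_occ, ← Finset.mul_sum, h1, mul_one]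

theorem MPP.occ_eq_margXOA_mul (M : MPP X Ω A L) (φ : Policy X Ω A) (x : X) (ω : Ω) (a : A)
    (x' : X) : M.occ φ x ω a x' = margXOA (M.occ φ) x ω a * M.trans x ω a x' := by
  rw [M.margXOA_occ, M.occ_eq_margX_mul, MPP.stepProb]; ring

theorem MPP.occ_eq_zero_of_not_mem_next (M : MPP X Ω A L) (φ : Policy X Ω A) {x x' : X}
    (h : x' ∉ M.next x) (ω : Ω) (a : A) : M.occ φ x ω a x' = 0 := by
  rw [M.occ_eq_margX_mul, M.stepProb_eq_zero φ, mul_zero]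
  simpa [Layering.next] using h

theorem MPP.sum_margX_occ_layer (M : MPP X Ω A L) (φ : Policy X Ω A) {k : ℕ} (hk : k < L) :
    ∑ x ∈ Finset.univ.filter (fun x => M.layer x = k), margX (M.occ φ) x = 1 := by
  have h1 : ∑ x ∈ Finset.univ.filter (fun x => M.layer x = k), margX (M.occ φ) x =
      ∑ x, ∑ ω, ∑ a, ∑ x', M.occ φ x ω a x' * (if M.layer x = k then 1 else 0) := by
    rw [Finset.sum_filter]
    refine Finset.sum_congr rfl fun x _ => ?_
    split_ifs <;> simp [margX, margXO, margXOA]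
  rw [h1, M.sum_occ_mul φ fun x _ _ _ => if M.layer x = k then 1 else 0,
    M.sum_trajProb_mul_congr φ (G := fun _ => 1)]
  · simp [M.sum_trajProb]
  · intro τ hτ
    simp only [Traj.sumSteps, hτ _]
    rw [Fintype.sum_eq_single ⟨k, hk⟩]
    · simp
    · intro j hj
      exact if_neg fun h => hj (Fin.ext (by simpa using h))

theorem MPP.flow_occ (M : MPP X Ω A L) (φ : Policy X Ω A) {x : X} (h0 : 0 < M.layer x)
    (hL : M.layer x < L) :
    ∑ x', ∑ ω, ∑ a, M.occ φ x' ω a x = margX (M.occ φ) x := by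
  classical
  have h1 : ∑ x', ∑ ω, ∑ a, M.occ φ x' ω a x =
      ∑ y, ∑ ω, ∑ a, ∑ y', M.occ φ y ω a y' * (if y' = x then 1 else 0) := by
    simp
  rw [h1, M.sum_occ_mul φ fun _ _ _ y' => if y' = x then 1 else 0, M.margX_occ]
  refine M.sum_trajProb_mul_congr φ fun τ hτ => ?_
  have h2 := Fin.sum_univ_succ fun k : Fin (L + 1) => if τ.state k = x then (1 : ℝ) else 0
  rw [Fin.sum_univ_castSucc, if_neg (c := τ.state 0 = x), if_neg (c := τ.state (Fin.last L) = x)]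
    at h2
  · simpa [Traj.sumSteps] using h2.symm
  · rintro rfl
    rw [hτ] at hL
    simp at hL
  · rintro rfl
    rw [hτ] at h0
    simp at h0

end Occupancy

/-! ### Hoeffding bounds at the visits of a set -/

/-- Hoeffding's lemma. -/
theorem lintegral_exp_mul_sub_integral_le {E : Type*} [MeasurableSpace E] (μ : Measure E)
    [IsProbabilityMeasure μ] {Z : E → ℝ} (hZ : Measurable Z) {a b : ℝ}
    (hb : ∀ᵐ e ∂μ, Z e ∈ Set.Icc a b) (l : ℝ) :
    ∫⁻ e, ENNReal.ofReal (Real.exp (l * (Z e - ∫ e, Z e ∂μ) - l ^ 2 * (b - a) ^ 2 / 8)) ∂μ ≤ 1 := by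
  have h := hasSubgaussianMGF_of_mem_Icc hZ.aemeasurable hb
  have h1 := h.mgf_le l
  have hi := h.integrable_exp_mul l
  have hc : ((((‖b - a‖₊ / 2) ^ 2 : NNReal) : ℝ)) * l ^ 2 / 2 = l ^ 2 * (b - a) ^ 2 / 8 := by
    push_cast
    rw [Real.norm_eq_abs, div_pow, sq_abs]
    ring
  rw [hc, mgf] at h1
  simp_rw [sub_eq_add_neg _ (l ^ 2 * (b - a) ^ 2 / 8), Real.exp_add]
  rw [← ofReal_integral_eq_lintegral_ofReal (hi.mul_const _)
    (Filter.Eventually.of_forall fun e => by positivity), integral_mul_const,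
    ← ENNReal.ofReal_one]
  refine ENNReal.ofReal_le_ofReal ?_
  rw [Real.exp_neg, ← div_eq_mul_inv, div_le_one (Real.exp_pos _)]
  exact h1

/-- Hoeffding's lemma for a finite distribution. -/
theorem sum_mul_exp_mul_sub_le {ι : Type*} [Fintype ι] {p : ι → ℝ} (hp : ∀ i, 0 ≤ p i)
    (hp1 : ∑ i, p i = 1) {Z : ι → ℝ} {a b : ℝ} (hZ : ∀ i, Z i ∈ Set.Icc a b)
    (l : ℝ) :
    ∑ i, p i * Real.exp (l * (Z i - ∑ j, p j * Z j) - l ^ 2 * (b - a) ^ 2 / 8) ≤ 1 := by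
  let _ : MeasurableSpace ι := ⊤
  set μ : Measure ι := ∑ i, ENNReal.ofReal (p i) • Measure.dirac i with hμ
  have hm : ∀ f : ι → ℝ, Measurable f := fun f => measurable_from_top
  have : IsProbabilityMeasure μ := ⟨by
    simp only [hμ, Measure.coe_finsetSum, Finset.sum_apply, Measure.smul_apply, measure_univ,
      smul_eq_mul, mul_one]
    rw [← ENNReal.ofReal_sum_of_nonneg fun i _ => hp i, hp1, ENNReal.ofReal_one]⟩
  have hint : ∫ i, Z i ∂μ = ∑ j, p j * Z j := by
    rw [hμ, integral_finsetSum_measure]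
    · refine Finset.sum_congr rfl fun i _ => ?_
      rw [integral_smul_measure, integral_dirac, ENNReal.toReal_ofReal (hp i), smul_eq_mul]
    · intro i _
      exact Integrable.smul_measure (integrable_dirac (by simp)) ENNReal.ofReal_ne_top
  have h := lintegral_exp_mul_sub_integral_le μ (hm Z)
    (Filter.Eventually.of_forall hZ) l
  rw [hint, hμ, lintegral_finsetSum_measure] at h
  simp_rw [lintegral_smul_measure, lintegral_dirac, smul_eq_mul] at h
  simp_rw [← ENNReal.ofReal_mul (hp _)] at h
  rw [← ENNReal.ofReal_sum_of_nonneg fun i _ => mul_nonneg (hp i) (Real.exp_pos _).le,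
    ← ENNReal.ofReal_one] at h
  exact (ENNReal.ofReal_le_ofReal_iff zero_le_one).1 h

section Regular
variable {X Ω A : Type*} {L : ℕ}

/-- The feedback of an episode that follows the layers and whose rewards lie in `[0,1]`; almost
every episode is of this kind. -/
def Layering.Regular (G : Layering X L) (o : Obs X Ω A L) : Prop :=
  G.Follows o.1 ∧ ∀ k a, o.2.1 k a ∈ Set.Icc (0 : ℝ) 1 ∧ o.2.2 k a ∈ Set.Icc (0 : ℝ) 1

theorem measurableSet_traj (s : Set (Traj X Ω A L)) :
    MeasurableSet {o : Obs X Ω A L | o.1 ∈ s} :=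
  measurable_fst (MeasurableSet.of_discrete (s := s))

theorem measurable_traj {β : Type*} [MeasurableSpace β] (f : Traj X Ω A L → β) :
    Measurable fun o : Obs X Ω A L => f o.1 :=
  (Measurable.of_discrete (f := f)).comp measurable_fst

theorem measurable_rewS (k : Fin L) (a : A) : Measurable fun o : Obs X Ω A L => o.2.1 k a := by
  fun_prop

theorem measurable_rewR (k : Fin L) (a : A) : Measurable fun o : Obs X Ω A L => o.2.2 k a := by
  fun_prop

theorem Layering.measurableSet_regular [Countable A] (G : Layering X L) :
    MeasurableSet {o : Obs X Ω A L | G.Regular o} := by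
  refine (measurableSet_traj {τ | G.Follows τ}).inter ?_
  change MeasurableSet {o : Obs X Ω A L | ∀ k a, o.2.1 k a ∈ Set.Icc (0 : ℝ) 1 ∧
    o.2.2 k a ∈ Set.Icc (0 : ℝ) 1}
  simp only [Set.ofPred_forall]
  exact MeasurableSet.iInter fun k => MeasurableSet.iInter fun a =>
    (measurable_rewS k a measurableSet_Icc).inter (measurable_rewR k a measurableSet_Icc)

end Regular

section Concentration
variable {X Ω A : Type*} [Fintype X] [Fintype Ω] [Fintype A] {L : ℕ}

/-- An integral over the feedback of one episode is estimated trajectory by trajectory, and only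
the trajectories that follow the layers matter. -/
theorem MPP.lintegral_episodeLaw_le (M : MPP X Ω A L) (φ : Policy X Ω A)
    {F : Obs X Ω A L → ENNReal} (hF : Measurable F) {H : Traj X Ω A L → ℝ} (hH : ∀ τ, 0 ≤ H τ)
    (hFH : ∀ τ, M.Follows τ → ∫⁻ r, F (observe τ r) ∂M.rewardLaw ≤ ENNReal.ofReal (H τ)) :
    ∫⁻ o, F o ∂M.episodeLaw φ ≤ ENNReal.ofReal (∑ τ, M.trajProb φ τ * H τ) := by
  rw [M.lintegral_episodeLaw φ hF,
    ENNReal.ofReal_sum_of_nonneg fun τ _ => mul_nonneg (M.trajProb_nonneg φ τ) (hH τ)]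
  refine Finset.sum_le_sum fun τ _ => ?_
  rw [ENNReal.ofReal_mul (M.trajProb_nonneg φ τ)]
  by_cases h0 : M.trajProb φ τ = 0
  · simp [h0]
  · gcongr
    exact hFH τ (M.follows_of_trajProb_ne_zero h0)

/-- Almost every history is regular: this is the maximal inequality at the level `⊤` for the
supermartingale that is `0` as long as all episodes are regular. -/
theorem MPP.historyLaw_not_regular (M : MPP X Ω A L) (alg : Learner X Ω A L) (T : ℕ) :
    M.historyLaw alg T {h | ∃ i, ¬ M.Regular (h i)} = 0 := by
  classical
  have hR := M.toLayering.measurableSet_regular (Ω := Ω) (A := A)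
  have hV := M.mul_historyLaw_exists_le alg
    (f := fun n h => if ∀ i, M.Regular (h i) then 0 else ⊤) (fun n => ?_) (fun h => ?_)
    (fun n h => ?_) ⊤ T
  · have hsub : {h : Fin T → Obs X Ω A L | ∃ i, ¬ M.Regular (h i)} ⊆
        {h | ∃ j, ∃ hj : j ≤ T, ⊤ ≤ if ∀ i, M.Regular (pre hj h i) then (0 : ENNReal) else ⊤} := by
      rintro h ⟨i, hi⟩
      refine ⟨T, le_rfl, ?_⟩
      rw [if_neg fun hall => hi (hall i)]
    by_contra h0
    rw [ENNReal.top_mul fun h1 => h0 (measure_mono_null hsub h1)] at hV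
    simp at hV
  · refine Measurable.ite ?_ measurable_const measurable_const
    simp only [Set.ofPred_forall]
    refine MeasurableSet.iInter fun i => ?_
    have hi : Measurable fun h : Fin n → Obs X Ω A L => h i := measurable_pi_apply i
    exact hi hR
  · rw [if_pos fun i => i.elim0]
    exact zero_le_one
  · by_cases hh : ∀ i, M.Regular (h i)
    · rw [if_pos hh]
      have h1 : ∀ o, (if ∀ i, M.Regular ((Fin.snoc h o : Fin (n + 1) → Obs X Ω A L) i)
          then (0 : ENNReal) else ⊤) = if M.Regular o then 0 else ⊤ := fun o => by
        have : (∀ i, M.Regular ((Fin.snoc h o : Fin (n + 1) → Obs X Ω A L) i)) ↔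
            M.Regular o := by
          rw [Fin.forall_fin_succ']
          simp [hh]
        simp only [this]
      simp_rw [h1]
      refine (M.lintegral_episodeLaw_le _ (H := 0)
        (Measurable.ite hR measurable_const measurable_const) (fun _ => le_rfl) ?_).trans (by simp)
      intro τ hτ
      refine le_of_eq ?_
      rw [Pi.zero_apply, ENNReal.ofReal_zero]
      refine lintegral_eq_zero_of_ae_eq_zero ?_
      filter_upwards [M.rewardLaw_mem] with r hr
      exact if_pos ⟨hτ, fun k a => hr _ _ _⟩
    · rw [if_neg hh]
      exact le_top

open Classical in
/-- The sum of the deviations `d` over the episodes in `V`, at the time when `V` has been visited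
`m` times, exceeds `m η` with probability at most `exp (-2 m η ^ 2)`. -/
theorem MPP.historyLaw_visits_le (M : MPP X Ω A L) (alg : Learner X Ω A L) {V : Obs X Ω A L → Prop}
    (hV : MeasurableSet {o | V o}) {d : Obs X Ω A L → ℝ} (hd : Measurable d)
    (hexp : ∀ φ l, ∫⁻ o, ENNReal.ofReal (Real.exp (if V o then l * d o - l ^ 2 / 8 else 0))
      ∂M.episodeLaw φ ≤ 1) (m : ℕ) {η : ℝ} (hη : 0 ≤ η)
    (T : ℕ) :
    M.historyLaw alg T {h | ∃ n, ∃ hn : n ≤ T,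
      (Finset.univ.filter fun i => V (pre hn h i)).card = m ∧
      m * η ≤ ∑ i, if V (pre hn h i) then d (pre hn h i) else 0} ≤
      ENNReal.ofReal (Real.exp (-(2 * m * η ^ 2))) := by
  -- The exponent `4 η` optimizes the bound: `4 η * (m η) - m (4 η)² / 8 = 2 m η²`.
  refine le_trans (measure_mono ?_) (M.historyLaw_exists_le_sum alg
    (g := fun _ _ o => if V o then 4 * η * d o - (4 * η) ^ 2 / 8 else 0) (fun n => ?_)
    (fun n h => hexp _ _) (2 * m * η ^ 2) T)
  · rintro h ⟨n, hn, hm, hs⟩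
    refine ⟨n, hn, ?_⟩
    have h1 : ∀ i : Fin n, (if V (h (Fin.castLE hn i)) then
        4 * η * d (h (Fin.castLE hn i)) - (4 * η) ^ 2 / 8 else 0) =
        4 * η * (if V (pre hn h i) then d (pre hn h i) else 0) -
          2 * η ^ 2 * (if V (pre hn h i) then 1 else 0) := fun i => by
      by_cases hv : V (pre hn h i)
      · rw [if_pos hv, if_pos hv, if_pos (show V (h (Fin.castLE hn i)) from hv)]
        simp only [pre]
        ring
      · rw [if_neg hv, if_neg hv, if_neg (show ¬ V (h (Fin.castLE hn i)) from hv)]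
        ring
    simp_rw [h1]
    rw [Finset.sum_sub_distrib, ← Finset.mul_sum, ← Finset.mul_sum, Finset.sum_boole, hm]
    nlinarith [mul_le_mul_of_nonneg_left hs hη]
  · exact Measurable.ite (measurable_snd hV) (((hd.comp measurable_snd).const_mul _).sub_const _)
      measurable_const

end Concentration

/-! ### Weissman's inequality for empirical distributions -/

/-- The total variation of a signed vector of total mass zero is attained, up to the factor two,
on a proper nonempty subset of the index set. -/
theorem sum_abs_le_of_forall_subset {κ : Type*} [DecidableEq κ] {s : Finset κ} {a : κ → ℝ}
    (h0 : ∑ j ∈ s, a j = 0) {η : ℝ} (hη : 0 ≤ η)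
    (h : ∀ U ⊆ s, U ≠ ∅ → U ≠ s → ∑ j ∈ U, a j ≤ η) : ∑ j ∈ s, |a j| ≤ 2 * η := by
  set U := s.filter fun j => 0 < a j with hU
  have h1 : ∑ j ∈ s, |a j| = 2 * ∑ j ∈ U, a j := by
    have e : ∀ j, |a j| = 2 * (if 0 < a j then a j else 0) - a j := fun j => by
      split_ifs with hj
      · rw [abs_of_pos hj]; ring
      · rw [abs_of_nonpos (not_lt.1 hj)]; ring
    simp_rw [e]
    rw [Finset.sum_sub_distrib, h0, sub_zero, ← Finset.mul_sum, hU, Finset.sum_filter]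
  have h2 : ∑ j ∈ U, a j ≤ η := by
    by_cases hU0 : U = ∅
    · simpa [hU0] using hη
    by_cases hUs : U = s
    · rw [hUs, h0]; exact hη
    exact h U (Finset.filter_subset _ _) hU0 hUs
  linarith

theorem measure_biUnion_finset_le_card_mul {α ι : Type*} [MeasurableSpace α] (μ : Measure α)
    (I : Finset ι) (s : ι → Set α) {b : ℝ} (h : ∀ i ∈ I, μ (s i) ≤ ENNReal.ofReal b) :
    μ (⋃ i ∈ I, s i) ≤ ENNReal.ofReal (I.card * b) := by
  refine (measure_biUnion_finset_le I s).trans ((Finset.sum_le_sum h).trans ?_)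
  rw [Finset.sum_const, nsmul_eq_mul, ENNReal.ofReal_mul (Nat.cast_nonneg _), ENNReal.ofReal_natCast]

section Concentration
variable {X Ω A : Type*} [Fintype X] [Fintype Ω] [Fintype A] {L : ℕ}

open Classical in
/-- An exponential moment bound for the deviation `d` of a single step from `x` passes to whole
episodes, by the Markov property. -/
theorem MPP.lintegral_exp_step_le (M : MPP X Ω A L) (φ : Policy X Ω A) {x : X}
    (hx : M.layer x < L) {B : Ω → A → Prop} {V : Traj X Ω A L → Prop}
    (hV : ∀ τ, V τ ↔ ∃ k : Fin L, τ.state k.castSucc = x ∧ B (τ.outcome k) (τ.action k))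
    (d : Ω → A → X → ℝ) (l : ℝ)
    (hB : ∑ ω, ∑ a, ∑ x', M.stepProb φ x ω a x' *
      (if B ω a then Real.exp (l * d ω a x' - l ^ 2 / 8) - 1 else 0) ≤ 0) :
    ∫⁻ o, ENNReal.ofReal (Real.exp (if V o.1 then
      l * o.1.sumSteps (fun y ω a y' => if y = x ∧ B ω a then d ω a y' else 0) - l ^ 2 / 8
        else 0)) ∂M.episodeLaw φ ≤ 1 := by
  set H : Traj X Ω A L → ℝ := fun τ => Real.exp (if V τ then
      l * τ.sumSteps (fun y ω a y' => if y = x ∧ B ω a then d ω a y' else 0) - l ^ 2 / 8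
        else 0) with hH
  refine (M.lintegral_episodeLaw_le φ (H := H)
    (measurable_traj fun τ => ENNReal.ofReal (H τ)) (fun τ => (Real.exp_pos _).le)
    fun τ _ => ?_).trans ?_
  · simp [observe, hH]
  · rw [← ENNReal.ofReal_one]
    refine ENNReal.ofReal_le_ofReal ?_
    rw [M.sum_trajProb_mul_congr φ (G := fun τ => 1 + τ.sumSteps fun y ω a y' => if y = x then
      (if B ω a then Real.exp (l * d ω a y' - l ^ 2 / 8) - 1 else 0) else 0)]
    · simp_rw [mul_add, mul_one, Finset.sum_add_distrib, M.sum_trajProb]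
      rw [M.sum_trajProb_mul_step φ hx fun ω a x' =>
        if B ω a then Real.exp (l * d ω a x' - l ^ 2 / 8) - 1 else 0]
      have h1 : 0 ≤ ∑ τ, M.trajProb φ τ *
          τ.sumSteps (fun y _ _ _ => if y = x then (1 : ℝ) else 0) :=
        Finset.sum_nonneg fun τ _ => mul_nonneg (M.trajProb_nonneg φ τ)
          (Finset.sum_nonneg fun k _ => by beta_reduce; split_ifs <;> norm_num)
      have := mul_nonpos_of_nonneg_of_nonpos h1 hB
      linarith
    · intro τ hτ
      simp only [hH]
      by_cases hv : V τ
      · obtain ⟨k, hk, hkB⟩ := (hV τ).1 hv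
        have hne : ∀ j : Fin L, j ≠ k → τ.state j.castSucc ≠ x := fun j hj hjx =>
          hj (hτ.eq_of_state_eq (hjx.trans hk.symm))
        rw [if_pos hv, Traj.sumSteps, Traj.sumSteps,
          Fintype.sum_eq_single k fun j hj => if_neg fun h => hne j hj h.1,
          Fintype.sum_eq_single k fun j hj => if_neg (hne j hj), if_pos ⟨hk, hkB⟩, if_pos hk,
          if_pos hkB]
        ring
      · rw [if_neg hv, Traj.sumSteps, Finset.sum_eq_zero]
        · simp
        · intro k _
          by_cases hk : τ.state k.castSucc = x
          · rw [if_pos hk, if_neg fun hkB => hv ((hV τ).2 ⟨k, hk, hkB⟩)]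
          · rw [if_neg hk]

open Classical in
/-- Weissman's inequality along the interaction.  A label `J (ω_k, a_k, x_{k+1})` is read off at
every visit of `x` with `B (ω_k, a_k)`; given such a visit its distribution is `p`, which is
supported on `s`.  Uniformly over time, the empirical distribution of the labels is within
`√(2 |s| ℓ / N)` of `p` in `ℓ¹` after `N` visits.  The union bound runs over the proper nonempty
subsets of `s` only, so that nothing is lost when `s` is a singleton. -/
theorem MPP.historyLaw_weissman (M : MPP X Ω A L) (alg : Learner X Ω A L) {x : X}
    (hx : M.layer x < L) {κ : Type*} [Fintype κ] {B : Ω → A → Prop} {J : Ω → A → X → κ}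
    {p : κ → ℝ} (hp : ∀ j, 0 ≤ p j) (hp1 : ∑ j, p j = 1) {s : Finset κ}
    (hps : ∀ j, j ∉ s → p j = 0)
    (hJ : ∀ φ, ∃ ρ : ℝ, 0 ≤ ρ ∧ ∀ g : κ → ℝ,
      ∑ ω, ∑ a, ∑ x', M.stepProb φ x ω a x' * (if B ω a then g (J ω a x') else 0) =
        ρ * ∑ j, p j * g j)
    {V : Traj X Ω A L → Prop} {W : Traj X Ω A L → κ → Prop}
    (hV : ∀ τ, V τ ↔ ∃ k : Fin L, τ.state k.castSucc = x ∧ B (τ.outcome k) (τ.action k))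
    (hW : ∀ τ j, W τ j ↔ ∃ k : Fin L, τ.state k.castSucc = x ∧ B (τ.outcome k) (τ.action k) ∧
      J (τ.outcome k) (τ.action k) (τ.state k.succ) = j)
    (hWs : ∀ τ, M.Follows τ → ∀ j, W τ j → j ∈ s) (T : ℕ) {l : ℝ}
    (hl : 2 * Real.exp (-l) ≤ 1) (hl0 : 0 ≤ l) :
    M.historyLaw alg T {h | (∀ i, M.Follows (h i).1) ∧ ∃ n, ∃ hn : n ≤ T,
      0 < (Finset.univ.filter fun i => V (pre hn h i).1).card ∧
      √(2 * s.card * l / (Finset.univ.filter fun i => V (pre hn h i).1).card) <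
        ∑ j ∈ s, |((Finset.univ.filter fun i => W (pre hn h i).1 j).card : ℝ) /
          (Finset.univ.filter fun i => V (pre hn h i).1).card - p j|} ≤
      ENNReal.ofReal (T * (2 * Real.exp (-l)) ^ 2) := by
  set 𝒰 : Finset (Finset κ) := s.powerset.filter fun U => U ≠ ∅ ∧ U ≠ s with h𝒰
  set D : Finset κ → Ω → A → X → ℝ := fun U ω a x' =>
    (if J ω a x' ∈ U then 1 else 0) - ∑ j ∈ U, p j with hD
  set F : Finset κ → Traj X Ω A L → ℝ := fun U τ =>
    τ.sumSteps (fun y ω a y' => if y = x ∧ B ω a then D U ω a y' else 0) with hF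
  set η : ℕ → ℝ := fun m => √(2 * s.card * l / m) / 2 with hη
  have hη0 : ∀ m, 0 ≤ η m := fun m => by positivity
  set E : ℕ → Finset κ → Set (Fin T → Obs X Ω A L) := fun m U => {h | ∃ n, ∃ hn : n ≤ T,
      (Finset.univ.filter fun i => V (pre hn h i).1).card = m ∧
      m * η m ≤ ∑ i, if V (pre hn h i).1 then F U (pre hn h i).1 else 0} with hE
  have hEb : ∀ m, 0 < m → ∀ U ∈ 𝒰,
      M.historyLaw alg T (E m U) ≤ ENNReal.ofReal (Real.exp (-(s.card * l))) := by
    intro m hm U hU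
    have h1 := M.historyLaw_visits_le alg (V := fun o => V o.1) (d := fun o => F U o.1)
      (measurableSet_traj {τ | V τ}) (measurable_traj (F U)) (fun φ l' => ?_) m (hη0 m) T
    · have h2 : 2 * (m : ℝ) * η m ^ 2 = s.card * l := by
        have hm' : (m : ℝ) ≠ 0 := by positivity
        rw [hη, div_pow, Real.sq_sqrt (by positivity)]
        field_simp
      rw [h2] at h1
      exact h1
    · refine M.lintegral_exp_step_le φ hx hV (D U) l' ?_
      obtain ⟨ρ, hρ, hρ'⟩ := hJ φ
      have h3 := hρ' fun j => Real.exp (l' * ((if j ∈ U then 1 else 0) - ∑ j ∈ U, p j) -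
        l' ^ 2 / 8) - 1
      rw [hD, h3]
      refine mul_nonpos_of_nonneg_of_nonpos hρ ?_
      have h4 := sum_mul_exp_mul_sub_le hp hp1 (Z := fun j => if j ∈ U then (1 : ℝ) else 0)
        (a := 0) (b := 1) (fun j => by split_ifs <;> simp) l'
      have h5 : ∑ j, p j * (if j ∈ U then (1 : ℝ) else 0) = ∑ j ∈ U, p j := by
        simp
      rw [h5] at h4
      simp_rw [mul_sub, mul_one, Finset.sum_sub_distrib, hp1]
      simp_rw [sub_zero, one_pow, mul_one, mul_sub] at h4
      linarith
  have hcard : (𝒰.card : ℝ) * Real.exp (-(s.card * l)) ≤ (2 * Real.exp (-l)) ^ 2 := by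
    by_cases hs : 2 ≤ s.card
    · calc (𝒰.card : ℝ) * Real.exp (-(s.card * l))
          ≤ 2 ^ s.card * Real.exp (-(s.card * l)) := by
            gcongr
            have := (Finset.card_filter_le s.powerset fun U => U ≠ ∅ ∧ U ≠ s)
            rw [Finset.card_powerset] at this
            exact_mod_cast this
        _ = (2 * Real.exp (-l)) ^ s.card := by
            rw [mul_pow, ← Real.exp_nat_mul]; ring_nf
        _ ≤ (2 * Real.exp (-l)) ^ 2 := pow_le_pow_of_le_one (by positivity) hl hs
    · have : 𝒰 = ∅ := by
        refine Finset.filter_eq_empty_iff.2 fun U hU hne => ?_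
        have h1 := Finset.card_lt_card ((Finset.mem_powerset.1 hU).ssubset_of_ne hne.2)
        exact hne.1 (Finset.card_eq_zero.1 (by omega))
      rw [this]
      simp only [Finset.card_empty, Nat.cast_zero, zero_mul]
      positivity
  have hunion := measure_biUnion_finset_le_card_mul (M.historyLaw alg T) (Finset.Icc 1 T)
    (fun m => ⋃ U ∈ 𝒰, E m U) (b := (2 * Real.exp (-l)) ^ 2) fun m hm =>
      (measure_biUnion_finset_le_card_mul _ 𝒰 (E m) (hEb m (Finset.mem_Icc.1 hm).1)).trans
        (ENNReal.ofReal_le_ofReal hcard)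
  rw [Nat.card_Icc, Nat.add_sub_cancel] at hunion
  refine (measure_mono ?_).trans hunion
  rintro h ⟨hfol, n, hn, hN, hdev⟩
  set N := (Finset.univ.filter fun i => V (pre hn h i).1).card with hNdef
  set C : κ → ℕ := fun j => (Finset.univ.filter fun i => W (pre hn h i).1 j).card with hC
  have hNT : N ≤ T := (Finset.card_filter_le _ _).trans (by simpa using hn)
  have hN' : (0 : ℝ) < N := by exact_mod_cast hN
  have hpoint : ∀ (U : Finset κ) (i : Fin n),
      (if V (pre hn h i).1 then F U (pre hn h i).1 else 0) =
      ∑ j ∈ U, ((if W (pre hn h i).1 j then (1 : ℝ) else 0) -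
        (if V (pre hn h i).1 then 1 else 0) * p j) := by
    intro U i
    set τ := (pre hn h i).1
    have hτ : M.Follows τ := hfol _
    by_cases hv : V τ
    · obtain ⟨k, hk, hkB⟩ := (hV τ).1 hv
      have hne : ∀ j : Fin L, τ.state j.castSucc = x → j = k := fun j hjx =>
          hτ.eq_of_state_eq (hjx.trans hk.symm)
      have hWj : ∀ j, W τ j ↔ J (τ.outcome k) (τ.action k) (τ.state k.succ) = j := fun j => by
        rw [hW]
        refine ⟨fun ⟨k', hk', _, h'⟩ => ?_, fun h' => ⟨k, hk, hkB, h'⟩⟩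
        rw [← hne k' hk']; exact h'
      rw [if_pos hv, if_pos hv, hF]
      simp only [Traj.sumSteps, hWj]
      rw [Fintype.sum_eq_single k fun j hj => if_neg fun h => hj (hne j h.1), if_pos ⟨hk, hkB⟩,
        hD]
      simp [Finset.sum_sub_distrib]
    · have hWj : ∀ j, ¬ W τ j := fun j hw => by
        obtain ⟨k, hk, hkB, _⟩ := (hW τ j).1 hw
        exact hv ((hV τ).2 ⟨k, hk, hkB⟩)
      simp [hv, hWj]
  have hsum : ∀ U : Finset κ, ∑ i, (if V (pre hn h i).1 then F U (pre hn h i).1 else 0) =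
      ∑ j ∈ U, ((C j : ℝ) - N * p j) := by
    intro U
    simp_rw [hpoint U]
    rw [Finset.sum_comm]
    refine Finset.sum_congr rfl fun j _ => ?_
    rw [Finset.sum_sub_distrib, ← Finset.sum_mul, Finset.sum_boole, Finset.sum_boole]
  have htot : ∑ j ∈ s, ((C j : ℝ) / N - p j) = 0 := by
    have h1 : ∑ j ∈ s, ((C j : ℝ) / N - p j) = (∑ j ∈ s, ((C j : ℝ) - N * p j)) / N := by
      rw [Finset.sum_div]
      refine Finset.sum_congr rfl fun j _ => ?_
      field_simp
    have hps1 : ∑ j ∈ s, p j = 1 := by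
      rw [← hp1]
      exact Finset.sum_subset (Finset.subset_univ s) fun j _ hj => hps j hj
    rw [h1, ← hsum s, Finset.sum_eq_zero, zero_div]
    intro i _
    by_cases hv : V (pre hn h i).1
    · rw [if_pos hv]
      refine Finset.sum_eq_zero fun k _ => ?_
      beta_reduce
      by_cases hk : (pre hn h i).1.state k.castSucc = x ∧
        B ((pre hn h i).1.outcome k) ((pre hn h i).1.action k)
      · rw [if_pos hk]
        simp only [hD]
        rw [hps1, if_pos, sub_self]
        exact hWs _ (hfol _) _ ((hW _ _).2 ⟨k, hk.1, hk.2, rfl⟩)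
      · rw [if_neg hk]
    · rw [if_neg hv]
  by_contra hcon
  simp only [Set.mem_iUnion, not_exists] at hcon
  refine absurd hdev (not_lt.2 ?_)
  have h2 := sum_abs_le_of_forall_subset htot (hη0 N) fun U hUs hU0 hUs' => ?_
  · refine h2.trans (le_of_eq ?_)
    simp only [hη]; ring
  · have h3 := hcon N (Finset.mem_Icc.2 ⟨hN, hNT⟩) U
      (Finset.mem_filter.2 ⟨Finset.mem_powerset.2 hUs, hU0, hUs'⟩)
    have h4 : ¬ (N * η N ≤ ∑ i, if V (pre hn h i).1 then F U (pre hn h i).1 else 0) :=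
      fun h5 => h3 ⟨n, hn, rfl, h5⟩
    rw [hsum, not_le] at h4
    have h6 : ∑ j ∈ U, ((C j : ℝ) / N - p j) = (∑ j ∈ U, ((C j : ℝ) - N * p j)) / N := by
      rw [Finset.sum_div]
      refine Finset.sum_congr rfl fun j _ => ?_
      field_simp
    rw [h6, div_le_iff₀ hN']
    linarith

end Concentration

/-! ### Tails of the empirical rewards -/

section Rewards
variable {X Ω A : Type*} [Fintype X] [Fintype Ω] [Fintype A] {L : ℕ}

open Classical in
/-- Hoeffding's inequality for one coordinate `tab` of the reward tables, which is observed as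
`rew · k` in every episode that visits `(x, ω)` at step `k`; the sign `σ` selects the tail. -/
theorem MPP.historyLaw_reward_le (M : MPP X Ω A L) (alg : Learner X Ω A L) (x : X) (ω : Ω)
    {tab : (X → Ω → A → ℝ) × (X → Ω → A → ℝ) → ℝ} (htab : Measurable tab)
    (htab01 : ∀ᵐ r ∂M.rewardLaw, tab r ∈ Set.Icc (0 : ℝ) 1)
    {rew : Obs X Ω A L → Fin L → ℝ} (hrew : ∀ k, Measurable fun o => rew o k)
    (hrt : ∀ τ r k, τ.state k.castSucc = x → τ.outcome k = ω → rew (observe τ r) k = tab r)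
    {σ : ℝ} (hσ : σ ^ 2 = 1) (m : ℕ) {η : ℝ} (hη : 0 ≤ η) (T : ℕ) :
    M.historyLaw alg T {h | (∀ i, M.Follows (h i).1) ∧ ∃ n, ∃ hn : n ≤ T,
      cntXO (pre hn h) x ω = m ∧
      m * η ≤ σ * ((∑ i, ∑ k : Fin L, if (pre hn h i).1.state k.castSucc = x ∧
        (pre hn h i).1.outcome k = ω then rew (pre hn h i) k else 0) -
          m * ∫ r, tab r ∂M.rewardLaw)} ≤
      ENNReal.ofReal (Real.exp (-(2 * m * η ^ 2))) := by
  set rbar := ∫ r, tab r ∂M.rewardLaw with hrbar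
  set d : Obs X Ω A L → ℝ := fun o => σ * ∑ k : Fin L,
    if o.1.state k.castSucc = x ∧ o.1.outcome k = ω then rew o k - rbar else 0 with hd
  have hdm : Measurable d := by
    refine Measurable.const_mul (Finset.measurable_sum _ fun k _ => ?_) _
    exact Measurable.ite (measurableSet_traj {τ | τ.state k.castSucc = x ∧ τ.outcome k = ω})
      ((hrew k).sub_const _) measurable_const
  have hVm := measurableSet_traj {τ : Traj X Ω A L | τ.VisitsXO x ω}
  refine (measure_mono ?_).trans (M.historyLaw_visits_le alg (V := fun o => o.1.VisitsXO x ω)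
    hVm hdm (fun φ l => ?_) m hη T)
  · rintro h ⟨hfol, n, hn, hm, hs⟩
    refine ⟨n, hn, hm, hs.trans (le_of_eq ?_)⟩
    have h1 : ∀ i, (if (pre hn h i).1.VisitsXO x ω then d (pre hn h i) else 0) =
        σ * ((∑ k : Fin L, if (pre hn h i).1.state k.castSucc = x ∧
          (pre hn h i).1.outcome k = ω then rew (pre hn h i) k else 0) -
            (if (pre hn h i).1.VisitsXO x ω then 1 else 0) * rbar) := by
      intro i
      have hτ : M.Follows (pre hn h i).1 := hfol _
      by_cases hv : (pre hn h i).1.VisitsXO x ω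
      · obtain ⟨k, hk, hkω⟩ := id hv
        have hne : ∀ j : Fin L, j ≠ k → ¬ ((pre hn h i).1.state j.castSucc = x ∧
            (pre hn h i).1.outcome j = ω) := fun j hj hjx =>
          hj (hτ.eq_of_state_eq (hjx.1.trans hk.symm))
        rw [if_pos hv, if_pos hv]
        simp only [hd]
        rw [Fintype.sum_eq_single k fun j hj => if_neg (hne j hj),
          Fintype.sum_eq_single k fun j hj => if_neg (hne j hj), if_pos ⟨hk, hkω⟩,
          if_pos ⟨hk, hkω⟩, one_mul]
      · rw [if_neg hv, if_neg hv, Finset.sum_eq_zero fun k _ => if_neg fun hk => hv ⟨k, hk⟩]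
        ring
    simp_rw [h1]
    rw [← Finset.mul_sum, Finset.sum_sub_distrib, ← Finset.sum_mul, Finset.sum_boole]
    simp only [← hm, cntXO]
  · refine (M.lintegral_episodeLaw_le φ (H := fun _ => 1) ?_ (fun _ => zero_le_one)
      fun τ hτ => ?_).trans ?_
    · exact ENNReal.measurable_ofReal.comp (Real.measurable_exp.comp
        (Measurable.ite hVm ((hdm.const_mul l).sub_const _) measurable_const))
    · rw [ENNReal.ofReal_one]
      by_cases hv : τ.VisitsXO x ω
      · obtain ⟨k, hk, hkω⟩ := id hv
        have hne : ∀ j : Fin L, j ≠ k → ¬ (τ.state j.castSucc = x ∧ τ.outcome j = ω) :=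
          fun j hj hjx => hj (hτ.eq_of_state_eq (hjx.1.trans hk.symm))
        have h1 : ∀ r, d (observe τ r) = σ * (tab r - rbar) := fun r => by
          have e : (observe τ r).1 = τ := rfl
          simp only [hd, e]
          rw [Fintype.sum_eq_single k fun j hj => if_neg (hne j hj), if_pos ⟨hk, hkω⟩,
            hrt τ r k hk hkω]
        have h2 := lintegral_exp_mul_sub_integral_le M.rewardLaw htab htab01 (l * σ)
        refine le_trans (le_of_eq (lintegral_congr fun r => ?_)) h2
        rw [if_pos (show (observe τ r).1.VisitsXO x ω from hv), h1]
        congr 2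
        rw [mul_pow, hσ]
        ring
      · have h1 : ∀ r, ¬ (observe τ r).1.VisitsXO x ω := fun _ => hv
        simp [h1]
    · simp [M.sum_trajProb]

end Rewards

/-! ### Accuracy of the estimates -/

section Accuracy
variable {X Ω A : Type*} [Fintype X] [Fintype Ω] [Fintype A] {L : ℕ}

/-- The empirical transition probabilities are within their confidence bounds. -/
def MPP.TransAccurate (M : MPP X Ω A L) (T : ℕ) (δ : ℝ) {n : ℕ} (g : Fin n → Obs X Ω A L) : Prop :=
  ∀ x ω a, M.layer x < L → ∑ x' ∈ M.next x, |estP g x ω a x' - M.trans x ω a x'| ≤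
    confP M.toLayering T δ g x ω a

/-- The empirical priors are within their confidence bounds. -/
def MPP.PriorAccurate (M : MPP X Ω A L) (T : ℕ) (δ : ℝ) {n : ℕ} (g : Fin n → Obs X Ω A L) : Prop :=
  ∀ x, M.layer x < L → ∑ ω, |estPrior g x ω - M.prior x ω| ≤ confPrior T δ g x

/-- The empirical mean rewards are within their confidence bounds. -/
def MPP.RewAccurate (M : MPP X Ω A L) (T : ℕ) (δ : ℝ) {n : ℕ} (g : Fin n → Obs X Ω A L) : Prop :=
  ∀ x ω a, |estS g x ω a - M.rS x ω a| ≤ confRew T δ g x ω ∧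
    |estR g x ω a - M.rR x ω a| ≤ confRew T δ g x ω

theorem MPP.card_pos (M : MPP X Ω A L) : 1 ≤ Fintype.card X :=
  Fintype.card_pos_iff.2 ⟨M.init⟩

theorem MPP.card_outcome_pos (M : MPP X Ω A L) : 1 ≤ Fintype.card Ω := by
  refine Fintype.card_pos_iff.2 ?_
  by_contra h
  rw [not_nonempty_iff] at h
  have := (M.prior M.init).2.2
  simp at this

theorem one_le_log_div {Q δ : ℝ} (hQ : 1 ≤ Q) (hδ0 : 0 < δ) (hδ : δ < 1 / 7) :
    1 ≤ Real.log (Q / δ) := by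
  rw [Real.le_log_iff_exp_le (by positivity)]
  have h1 := Real.exp_one_lt_d9
  rw [le_div_iff₀ hδ0]
  nlinarith

theorem exp_neg_log_div {Q δ : ℝ} (hQ : 1 ≤ Q) (hδ0 : 0 < δ) :
    Real.exp (-Real.log (Q / δ)) = δ / Q := by
  rw [Real.exp_neg, Real.exp_log (by positivity), inv_div]

theorem two_mul_exp_neg_log_div_le {Q δ : ℝ} (hQ : 1 ≤ Q) (hδ0 : 0 < δ) (hδ : δ < 1 / 7) :
    2 * Real.exp (-Real.log (Q / δ)) ≤ 1 := by
  rw [exp_neg_log_div hQ hδ0, ← mul_div_assoc, div_le_one (by positivity)]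
  linarith

theorem mul_sq_exp_neg_log_div_le {Q δ : ℝ} (hQ : 1 ≤ Q) (hδ0 : 0 < δ) (hδ : δ < 1 / 7) :
    Q * (2 * Real.exp (-Real.log (Q / δ))) ^ 2 ≤ δ := by
  rw [exp_neg_log_div hQ hδ0]
  have h1 : Q * (2 * (δ / Q)) ^ 2 = 4 * δ * δ / Q := by
    field_simp
    ring
  rw [h1, div_le_iff₀ (by positivity)]
  nlinarith

theorem MPP.sum_next_trans (M : MPP X Ω A L) {x : X} (hx : M.layer x < L) (ω : Ω) (a : A) :
    ∑ x' ∈ M.next x, M.trans x ω a x' = 1 := by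
  rw [← M.trans_sum x ω a ((M.layer_lt_iff x).1 hx)]
  refine Finset.sum_subset (Finset.subset_univ _) fun x' _ hx' => ?_
  by_contra h0
  refine hx' ?_
  simp only [Layering.next, Finset.mem_filter, Finset.mem_univ, true_and]
  exact M.loop_free x ω a x' (lt_of_le_of_ne (M.trans_nonneg x ω a x') (Ne.symm h0))

theorem MPP.trans_eq_zero (M : MPP X Ω A L) {x x' : X} (hx' : x' ∉ M.next x) (ω : Ω) (a : A) :
    M.trans x ω a x' = 0 := by
  by_contra h0
  refine hx' ?_
  simp only [Layering.next, Finset.mem_filter, Finset.mem_univ, true_and]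
  exact M.loop_free x ω a x' (lt_of_le_of_ne (M.trans_nonneg x ω a x') (Ne.symm h0))

/-- The union bound over the triplets.  Before the first visit of a triplet its estimate is the
zero vector, and the confidence width exceeds one. -/
theorem MPP.historyLaw_not_transAccurate (M : MPP X Ω A L) [Nonempty A] (alg : Learner X Ω A L)
    {T : ℕ} (hT : 1 ≤ T) {δ : ℝ} (hδ0 : 0 < δ) (hδ : δ < 1 / 7) :
    M.historyLaw alg T {h | (∀ i, M.Regular (h i)) ∧ ∃ n, ∃ hn : n ≤ T,
      ¬ M.TransAccurate T δ (pre hn h)} ≤ ENNReal.ofReal δ := by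
  classical
  set Q : ℝ := T * Fintype.card X * Fintype.card Ω * Fintype.card A with hQdef
  have hQ : 1 ≤ Q := by
    have h4 : 1 ≤ T * Fintype.card X * Fintype.card Ω * Fintype.card A :=
      Nat.mul_pos (Nat.mul_pos (Nat.mul_pos hT M.card_pos) M.card_outcome_pos) Fintype.card_pos
    rw [hQdef]
    exact_mod_cast h4
  have hl1 := one_le_log_div hQ hδ0 hδ
  set l := Real.log (Q / δ) with hl
  set I : Finset (X × Ω × A) := Finset.univ.filter fun z => M.layer z.1 < L with hI
  set E : X × Ω × A → Set (Fin T → Obs X Ω A L) := fun z =>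
    {h | (∀ i, M.Follows (h i).1) ∧ ∃ n, ∃ hn : n ≤ T, 0 < cntXOA (pre hn h) z.1 z.2.1 z.2.2 ∧
      √(2 * (M.next z.1).card * l / cntXOA (pre hn h) z.1 z.2.1 z.2.2) <
        ∑ x' ∈ M.next z.1, |(cntXOAX (pre hn h) z.1 z.2.1 z.2.2 x' : ℝ) /
          cntXOA (pre hn h) z.1 z.2.1 z.2.2 - M.trans z.1 z.2.1 z.2.2 x'|} with hE
  have hb : ∀ z ∈ I, M.historyLaw alg T (E z) ≤
      ENNReal.ofReal (T * (2 * Real.exp (-l)) ^ 2) := by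
    rintro ⟨x, ω, a⟩ hz
    have hx : M.layer x < L := by simpa [hI] using hz
    refine M.historyLaw_weissman alg hx (B := fun ω' a' => ω' = ω ∧ a' = a)
      (J := fun _ _ x' => x') (p := M.trans x ω a) (s := M.next x)
      (V := fun τ => τ.VisitsXOA x ω a) (W := fun τ x' => τ.VisitsXOAX x ω a x')
      (fun j => M.trans_nonneg _ _ _ _) (M.trans_sum x ω a ((M.layer_lt_iff x).1 hx))
      (fun j hj => M.trans_eq_zero hj ω a) (fun φ => ?_) (fun τ => Iff.rfl) (fun τ x' => ?_)
      (fun τ hτ x' hv => ?_) T (two_mul_exp_neg_log_div_le hQ hδ0 hδ) (by linarith)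
    · refine ⟨M.prior x ω * φ x ω a, mul_nonneg ((M.prior x).2.1 _) ((φ x ω).2.1 _), fun g => ?_⟩
      rw [Fintype.sum_eq_single ω fun ω' hω' => by simp [hω'],
        Fintype.sum_eq_single a fun a' ha' => by simp [ha'], Finset.mul_sum]
      refine Finset.sum_congr rfl fun x' _ => ?_
      simp only [MPP.stepProb, and_self, if_true]
      ring
    · simp only [Traj.VisitsXOAX, and_assoc]
    · obtain ⟨k, hk, -, -, hk'⟩ := hv
      simp only [Layering.next, Finset.mem_filter, Finset.mem_univ, true_and]
      rw [← hk, ← hk', hτ, hτ]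
      simp
  have hu := measure_biUnion_finset_le_card_mul _ I E hb
  refine (measure_mono ?_).trans (hu.trans (ENNReal.ofReal_le_ofReal ?_))
  · rintro h ⟨hreg, n, hn, hacc⟩
    simp only [MPP.TransAccurate, not_forall, not_le] at hacc
    obtain ⟨x, ω, a, hx, hdev⟩ := hacc
    refine Set.mem_biUnion (x := (x, ω, a)) (by simpa [hI] using hx)
      ⟨fun i => (hreg i).1, n, hn, ?_⟩
    have hN : 0 < cntXOA (pre hn h) x ω a := by
      by_contra h0
      have h0 : cntXOA (pre hn h) x ω a = 0 := by omega
      have h1 : ∀ x', cntXOAX (pre hn h) x ω a x' = 0 := fun x' => by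
        refine Nat.eq_zero_of_le_zero (h0 ▸ Finset.card_le_card ?_)
        refine Finset.monotone_filter_right _ fun i _ hi => ?_
        obtain ⟨k, h1, h2, h3, -⟩ := hi
        exact ⟨k, h1, h2, h3⟩
      refine absurd hdev (not_lt.2 ?_)
      simp only [estP, h1, Nat.cast_zero, zero_div, zero_sub, abs_neg]
      simp_rw [abs_of_nonneg (M.trans_nonneg x ω a _)]
      rw [M.sum_next_trans hx, confP, h0, Nat.cast_zero, max_eq_left zero_le_one, div_one,
        Real.one_le_sqrt]
      have h2 : (1 : ℝ) ≤ (M.next x).card := by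
        have : (M.next x).Nonempty := by
          by_contra h3
          rw [Finset.not_nonempty_iff_eq_empty] at h3
          have := M.sum_next_trans hx ω a
          simp [h3] at this
        exact_mod_cast this.card_pos
      rw [← hQdef, ← hl]
      nlinarith
    refine ⟨hN, ?_⟩
    have hmax : max 1 (cntXOA (pre hn h) x ω a : ℝ) = cntXOA (pre hn h) x ω a :=
      max_eq_right (by exact_mod_cast hN)
    simpa only [confP, estP, hmax] using hdev
  · have hcard : (I.card : ℝ) ≤ Fintype.card (X × Ω × A) := by
      exact_mod_cast Finset.card_le_univ I
    refine (mul_le_mul_of_nonneg_right (a := T * (2 * Real.exp (-l)) ^ 2) hcard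
      (by positivity)).trans (le_trans (le_of_eq ?_) (mul_sq_exp_neg_log_div_le hQ hδ0 hδ))
    rw [Fintype.card_prod, Fintype.card_prod, hQdef]
    push_cast
    ring

theorem MPP.historyLaw_not_priorAccurate (M : MPP X Ω A L) (alg : Learner X Ω A L)
    {T : ℕ} (hT : 1 ≤ T) {δ : ℝ} (hδ0 : 0 < δ) (hδ : δ < 1 / 7) :
    M.historyLaw alg T {h | (∀ i, M.Regular (h i)) ∧ ∃ n, ∃ hn : n ≤ T,
      ¬ M.PriorAccurate T δ (pre hn h)} ≤ ENNReal.ofReal δ := by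
  classical
  set Q : ℝ := T * Fintype.card X with hQdef
  have hQ : 1 ≤ Q := by
    have h4 : 1 ≤ T * Fintype.card X := Nat.mul_pos hT M.card_pos
    rw [hQdef]
    exact_mod_cast h4
  have hl1 := one_le_log_div hQ hδ0 hδ
  set l := Real.log (Q / δ) with hl
  set I : Finset X := Finset.univ.filter fun x => M.layer x < L with hI
  set E : X → Set (Fin T → Obs X Ω A L) := fun x =>
    {h | (∀ i, M.Follows (h i).1) ∧ ∃ n, ∃ hn : n ≤ T, 0 < cntX (pre hn h) x ∧
      √(2 * (Finset.univ : Finset Ω).card * l / cntX (pre hn h) x) <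
        ∑ ω, |(cntXO (pre hn h) x ω : ℝ) / cntX (pre hn h) x - M.prior x ω|} with hE
  have hb : ∀ x ∈ I, M.historyLaw alg T (E x) ≤
      ENNReal.ofReal (T * (2 * Real.exp (-l)) ^ 2) := by
    intro x hz
    have hx : M.layer x < L := by simpa [hI] using hz
    refine M.historyLaw_weissman alg hx (B := fun _ _ => True)
      (J := fun ω _ _ => ω) (p := M.prior x) (s := Finset.univ)
      (V := fun τ => τ.VisitsX x) (W := fun τ ω => τ.VisitsXO x ω)
      (fun j => (M.prior x).2.1 j) (M.prior x).2.2
      (fun j hj => absurd (Finset.mem_univ j) hj) (fun φ => ?_) (fun τ => ?_) (fun τ ω => ?_)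
      (fun τ hτ x' hv => Finset.mem_univ _) T (two_mul_exp_neg_log_div_le hQ hδ0 hδ) (by linarith)
    · refine ⟨1, zero_le_one, fun g => ?_⟩
      rw [one_mul]
      refine Finset.sum_congr rfl fun ω _ => ?_
      have h1 : ∑ a, φ x ω a = 1 := (φ x ω).2.2
      simp only [if_true]
      simp_rw [← Finset.sum_mul, MPP.stepProb, ← Finset.mul_sum,
        M.trans_sum x _ _ ((M.layer_lt_iff x).1 hx), mul_one, ← Finset.mul_sum, h1, mul_one]
    · simp only [Traj.VisitsX, and_true]
    · simp only [Traj.VisitsXO, true_and]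
  have hu := measure_biUnion_finset_le_card_mul _ I E hb
  refine (measure_mono ?_).trans (hu.trans (ENNReal.ofReal_le_ofReal ?_))
  · rintro h ⟨hreg, n, hn, hacc⟩
    simp only [MPP.PriorAccurate, not_forall, not_le] at hacc
    obtain ⟨x, hx, hdev⟩ := hacc
    refine Set.mem_biUnion (x := x) (by simpa [hI] using hx)
      ⟨fun i => (hreg i).1, n, hn, ?_⟩
    have hN : 0 < cntX (pre hn h) x := by
      by_contra h0
      have h0 : cntX (pre hn h) x = 0 := by omega
      have h1 : ∀ ω, cntXO (pre hn h) x ω = 0 := fun ω => by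
        refine Nat.eq_zero_of_le_zero (h0 ▸ Finset.card_le_card ?_)
        refine Finset.monotone_filter_right _ fun i _ hi => ?_
        obtain ⟨k, h1, -⟩ := hi
        exact ⟨k, h1⟩
      refine absurd hdev (not_lt.2 ?_)
      simp only [estPrior, h1, Nat.cast_zero, zero_div, zero_sub, abs_neg]
      have h3 : ∑ ω, |M.prior x ω| = 1 := by
        have h4 : ∀ ω, |M.prior x ω| = M.prior x ω := fun ω => abs_of_nonneg ((M.prior x).2.1 ω)
        simp_rw [h4]
        exact (M.prior x).2.2
      rw [h3, confPrior, h0, Nat.cast_zero, max_eq_left zero_le_one, div_one, Real.one_le_sqrt]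
      have h2 : (1 : ℝ) ≤ Fintype.card Ω := by exact_mod_cast M.card_outcome_pos
      rw [← hQdef, ← hl]
      nlinarith
    refine ⟨hN, ?_⟩
    have hmax : max 1 (cntX (pre hn h) x : ℝ) = cntX (pre hn h) x :=
      max_eq_right (by exact_mod_cast hN)
    simpa only [confPrior, estPrior, hmax, Finset.card_univ] using hdev
  · have hcard : (I.card : ℝ) ≤ Fintype.card X := by exact_mod_cast Finset.card_le_univ I
    refine (mul_le_mul_of_nonneg_right (a := T * (2 * Real.exp (-l)) ^ 2) hcard
      (by positivity)).trans (le_trans (le_of_eq ?_) (mul_sq_exp_neg_log_div_le hQ hδ0 hδ))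
    rw [hQdef]
    ring

open Classical in
/-- The empirical mean of one reward coordinate leaves its confidence interval with small
probability; clipping the width at one is harmless as both means lie in `[0,1]`. -/
theorem MPP.historyLaw_not_rew_le (M : MPP X Ω A L) (alg : Learner X Ω A L) (x : X) (ω : Ω)
    {T : ℕ} (hT : 1 ≤ T) {δ : ℝ} (hδ0 : 0 < δ) (hδ : δ < 1 / 7)
    {tab : (X → Ω → A → ℝ) × (X → Ω → A → ℝ) → ℝ} (htab : Measurable tab)
    (htab01 : ∀ᵐ r ∂M.rewardLaw, tab r ∈ Set.Icc (0 : ℝ) 1)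
    {rew : Obs X Ω A L → Fin L → ℝ} (hrew : ∀ k, Measurable fun o => rew o k)
    (hrt : ∀ τ r k, τ.state k.castSucc = x → τ.outcome k = ω → rew (observe τ r) k = tab r)
    (hrew01 : ∀ o, M.Regular o → ∀ k, rew o k ∈ Set.Icc (0 : ℝ) 1) :
    M.historyLaw alg T {h | (∀ i, M.Regular (h i)) ∧ ∃ n, ∃ hn : n ≤ T,
      confRew T δ (pre hn h) x ω < |(∑ i, ∑ k : Fin L, if (pre hn h i).1.state k.castSucc = x ∧
        (pre hn h i).1.outcome k = ω then rew (pre hn h i) k else 0) /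
          max 1 (cntXO (pre hn h) x ω : ℝ) - ∫ r, tab r ∂M.rewardLaw|} ≤
      ENNReal.ofReal (2 * T * (δ / (3 * T * Fintype.card X * Fintype.card Ω)) ^ 2) := by
  set Q : ℝ := 3 * T * Fintype.card X * Fintype.card Ω with hQdef
  have hQ : 1 ≤ Q := by
    have h4 : 1 ≤ 3 * T * Fintype.card X * Fintype.card Ω :=
      Nat.mul_pos (Nat.mul_pos (by omega) M.card_pos) M.card_outcome_pos
    rw [hQdef]
    exact_mod_cast h4
  have hl1 := one_le_log_div hQ hδ0 hδ
  set l := Real.log (Q / δ) with hl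
  set rbar := ∫ r, tab r ∂M.rewardLaw with hrbar
  have hr0 : 0 ≤ rbar := integral_nonneg_of_ae (by filter_upwards [htab01] with r hr using hr.1)
  have hr1 : rbar ≤ 1 := by
    have h1 := integral_mono_ae (Integrable.of_mem_Icc 0 1 htab.aemeasurable htab01)
      (integrable_const (1 : ℝ)) (by filter_upwards [htab01] with r hr using hr.2)
    simpa using h1
  set S : ∀ n : ℕ, (Fin n → Obs X Ω A L) → ℝ := fun _ g =>
    ∑ i, ∑ k : Fin L, if (g i).1.state k.castSucc = x ∧ (g i).1.outcome k = ω then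
      rew (g i) k else 0 with hS
  set η : ℕ → ℝ := fun m => √(l / m) with hη
  set E : ℕ × Bool → Set (Fin T → Obs X Ω A L) := fun z =>
    {h | (∀ i, M.Follows (h i).1) ∧ ∃ n, ∃ hn : n ≤ T, cntXO (pre hn h) x ω = z.1 ∧
      z.1 * η z.1 ≤ (if z.2 then 1 else -1) * (S n (pre hn h) - z.1 * rbar)} with hE
  have hb : ∀ z ∈ Finset.Icc 1 T ×ˢ (Finset.univ : Finset Bool), M.historyLaw alg T (E z) ≤
      ENNReal.ofReal ((δ / Q) ^ 2) := by
    rintro ⟨m, b⟩ hz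
    simp only [Finset.mem_product, Finset.mem_Icc, Finset.mem_univ, and_true] at hz
    have hσ : (if b then (1 : ℝ) else -1) ^ 2 = 1 := by split_ifs <;> norm_num
    have h1 := M.historyLaw_reward_le alg x ω htab htab01 hrew hrt hσ m
      (Real.sqrt_nonneg (l / m)) T
    have h2 : Real.exp (-(2 * m * √(l / m) ^ 2)) = (δ / Q) ^ 2 := by
      have hm : (m : ℝ) ≠ 0 := by
        have := hz.1
        positivity
      rw [← exp_neg_log_div hQ hδ0, ← hl, Real.sq_sqrt (by positivity), ← Real.exp_nat_mul]
      congr 1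
      field_simp
      norm_num
    rw [h2] at h1
    exact h1
  have hu := measure_biUnion_finset_le_card_mul _ _ E hb
  refine (measure_mono ?_).trans (hu.trans (le_of_eq ?_))
  · rintro h ⟨hreg, n, hn, hdev⟩
    have hdev' : confRew T δ (pre hn h) x ω <
        |S n (pre hn h) / max 1 (cntXO (pre hn h) x ω : ℝ) - rbar| := hdev
    set N := cntXO (pre hn h) x ω with hN
    have hNT : N ≤ T := (Finset.card_filter_le _ _).trans (by simpa using hn)
    have hS0 : 0 ≤ S n (pre hn h) := Finset.sum_nonneg fun i _ => Finset.sum_nonneg fun k _ => by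
      split_ifs
      · exact (hrew01 _ (hreg _) k).1
      · exact le_rfl
    have hSN : S n (pre hn h) ≤ N := by
      have h1 : (N : ℝ) = ∑ i, if (pre hn h i).1.VisitsXO x ω then (1 : ℝ) else 0 := by
        rw [Finset.sum_boole]; rfl
      rw [h1]
      refine Finset.sum_le_sum fun i _ => ?_
      rw [ite_eq_sum_of_iff_exists (q := (pre hn h i).1.VisitsXO x ω) Iff.rfl
        (fun k k' hk hk' => (hreg _).1.eq_of_state_eq (hk.1.trans hk'.1.symm)) (1 : ℝ)]
      refine Finset.sum_le_sum fun k _ => ?_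
      split_ifs
      · exact (hrew01 _ (hreg _) k).2
      · exact le_rfl
    have hmax : (0 : ℝ) < max 1 (N : ℝ) := lt_max_of_lt_left one_pos
    have hdev1 : |S n (pre hn h) / max 1 (N : ℝ) - rbar| ≤ 1 := by
      have h1 : 0 ≤ S n (pre hn h) / max 1 (N : ℝ) := by positivity
      have h2 : S n (pre hn h) / max 1 (N : ℝ) ≤ 1 := by
        rw [div_le_one hmax]
        exact hSN.trans (le_max_right _ _)
      rw [abs_le]
      constructor <;> linarith
    have hconf : √(l / max 1 (N : ℝ)) < |S n (pre hn h) / max 1 (N : ℝ) - rbar| := by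
      simp only [confRew] at hdev'
      rcases min_lt_iff.1 hdev' with h1 | h1
      · linarith
      · exact h1
    have hN1 : 1 ≤ N := by
      by_contra h0
      have h0 : N = 0 := by omega
      rw [h0, Nat.cast_zero, max_eq_left zero_le_one, div_one] at hconf
      have h1 : 1 ≤ √l := Real.one_le_sqrt.2 hl1
      rw [h0, Nat.cast_zero, max_eq_left zero_le_one] at hdev1
      linarith
    have hN1' : (1 : ℝ) ≤ N := by exact_mod_cast hN1
    rw [max_eq_right hN1'] at hconf
    have h3 : S n (pre hn h) - N * rbar = N * (S n (pre hn h) / N - rbar) := by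
      field_simp
    refine Set.mem_biUnion (x := (N, decide (0 ≤ S n (pre hn h) / N - rbar)))
      (Finset.mk_mem_product (Finset.mem_Icc.2 ⟨hN1, hNT⟩) (Finset.mem_univ _)) ⟨fun i => (hreg i).1, n, hn, rfl, ?_⟩
    simp only [hη, h3]
    by_cases hs : 0 ≤ S n (pre hn h) / N - rbar
    · rw [abs_of_nonneg hs] at hconf
      simp only [hs, decide_true, if_true, one_mul]
      gcongr
    · rw [abs_of_neg (not_le.1 hs)] at hconf
      simp only [hs, decide_false, Bool.false_eq_true, if_false]
      have := mul_le_mul_of_nonneg_left hconf.le (by positivity : (0 : ℝ) ≤ N)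
      linarith
  · rw [Finset.card_product, Nat.card_Icc, Finset.card_univ, Fintype.card_bool]
    push_cast
    congr 1
    ring

/-- The confidence widths of the rewards do not depend on the number of actions, so the union
bound over the actions needs `|A| ≤ T`. -/
theorem MPP.historyLaw_not_rewAccurate (M : MPP X Ω A L) (alg : Learner X Ω A L)
    {T : ℕ} (hT : 1 ≤ T) (hAT : Fintype.card A ≤ T) {δ : ℝ} (hδ0 : 0 < δ) (hδ : δ < 1 / 7) :
    M.historyLaw alg T {h | (∀ i, M.Regular (h i)) ∧ ∃ n, ∃ hn : n ≤ T,
      ¬ M.RewAccurate T δ (pre hn h)} ≤ ENNReal.ofReal δ := by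
  classical
  set b := 2 * T * (δ / (3 * T * Fintype.card X * Fintype.card Ω)) ^ 2 with hb
  set E : (X × Ω × A) × Bool → Set (Fin T → Obs X Ω A L) := fun z =>
    {h | (∀ i, M.Regular (h i)) ∧ ∃ n, ∃ hn : n ≤ T,
      confRew T δ (pre hn h) z.1.1 z.1.2.1 <
        if z.2 then |estS (pre hn h) z.1.1 z.1.2.1 z.1.2.2 - M.rS z.1.1 z.1.2.1 z.1.2.2|
        else |estR (pre hn h) z.1.1 z.1.2.1 z.1.2.2 - M.rR z.1.1 z.1.2.1 z.1.2.2|} with hE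
  have hEb : ∀ z ∈ (Finset.univ : Finset ((X × Ω × A) × Bool)),
      M.historyLaw alg T (E z) ≤ ENNReal.ofReal b := by
    rintro ⟨⟨x, ω, a⟩, c⟩ -
    cases c
    · refine M.historyLaw_not_rew_le alg x ω hT hδ0 hδ (tab := fun r => r.2 x ω a)
        (rew := fun o k => o.2.2 k a) (by fun_prop)
        (by filter_upwards [M.rewardLaw_mem] with r hr using (hr x ω a).2)
        (fun k => measurable_rewR k a) (fun τ r k h1 h2 => ?_) fun o ho k => (ho.2 k a).2
      simp [observe, h1, h2]
    · refine M.historyLaw_not_rew_le alg x ω hT hδ0 hδ (tab := fun r => r.1 x ω a)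
        (rew := fun o k => o.2.1 k a) (by fun_prop)
        (by filter_upwards [M.rewardLaw_mem] with r hr using (hr x ω a).1)
        (fun k => measurable_rewS k a) (fun τ r k h1 h2 => ?_) fun o ho k => (ho.2 k a).1
      simp [observe, h1, h2]
  refine (measure_mono ?_).trans ((measure_biUnion_finset_le_card_mul _ _ E hEb).trans
    (ENNReal.ofReal_le_ofReal ?_))
  · rintro h ⟨hreg, n, hn, hacc⟩
    simp only [MPP.RewAccurate, not_forall] at hacc
    obtain ⟨x, ω, a, hdev⟩ := hacc
    rw [not_and_or, not_le, not_le] at hdev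
    rcases hdev with hdev | hdev
    · exact Set.mem_biUnion (x := ((x, ω, a), true)) (Finset.mem_coe.2 (Finset.mem_univ _))
        ⟨hreg, n, hn, hdev⟩
    · exact Set.mem_biUnion (x := ((x, ω, a), false)) (Finset.mem_coe.2 (Finset.mem_univ _))
        ⟨hreg, n, hn, hdev⟩
  · rw [Finset.card_univ, Fintype.card_prod, Fintype.card_prod, Fintype.card_prod,
      Fintype.card_bool, hb]
    push_cast
    have hX : (1 : ℝ) ≤ Fintype.card X := by exact_mod_cast M.card_pos
    have hΩ : (1 : ℝ) ≤ Fintype.card Ω := by exact_mod_cast M.card_outcome_pos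
    have hT' : (1 : ℝ) ≤ T := by exact_mod_cast hT
    have hA : (Fintype.card A : ℝ) ≤ T := by exact_mod_cast hAT
    generalize (Fintype.card X : ℝ) = cx at *
    generalize (Fintype.card Ω : ℝ) = co at *
    generalize (Fintype.card A : ℝ) = ca at *
    have h1 : cx * (co * ca) * 2 * (2 * T * (δ / (3 * T * cx * co)) ^ 2) =
        (4 / 9) * δ * δ * (ca / T) / (cx * co) := by
      field_simp
      ring
    rw [h1, div_le_iff₀ (by positivity)]
    have h2 : ca / T ≤ 1 := by rw [div_le_one (by positivity)]; exact hA
    have h3 : 1 ≤ cx * co := by nlinarith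
    have h4 : (4 / 9) * δ * δ * (ca / T) ≤ (4 / 9) * δ * δ * 1 := by gcongr
    nlinarith

end Accuracy

/-! ### Optimism and the comparison of occupancy measures -/

/-- If `v` has mass `V` and is `c V`-close to the multiple `V p` of a distribution `p`, then
replacing `V` by another mass `Q` costs only `c Q`, on top of the difference of the masses. -/
theorem sum_abs_sub_mul_le {ι : Type*} [Fintype ι] {v p : ι → ℝ} (hv : ∀ i, 0 ≤ v i)
    (hp : ∀ i, 0 ≤ p i) (hp1 : ∑ i, p i = 1) {V Q c : ℝ} (hV : ∑ i, v i = V) (hQ : 0 ≤ Q)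
    (hc : ∑ i, |v i - p i * V| ≤ c * V) (hc0 : 0 ≤ c) :
    ∑ i, |v i - p i * Q| ≤ |V - Q| + c * Q := by
  have hV0 : 0 ≤ V := hV ▸ Finset.sum_nonneg fun i _ => hv i
  rcases hV0.eq_or_lt with h0 | h0
  · have hv0 : ∀ i, v i = 0 := fun i =>
      (Finset.sum_eq_zero_iff_of_nonneg fun i _ => hv i).1 (hV.trans h0.symm) i (Finset.mem_univ i)
    have h1 : ∀ i, |v i - p i * Q| = p i * Q := fun i => by
      rw [hv0, zero_sub, abs_neg, abs_of_nonneg (mul_nonneg (hp i) hQ)]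
    simp_rw [h1]
    rw [← Finset.sum_mul, hp1, one_mul, ← h0, zero_sub, abs_neg, abs_of_nonneg hQ]
    have := mul_nonneg hc0 hQ
    linarith
  · have h1 : ∀ i, |v i - p i * Q| ≤ |v i - p i * V| * (Q / V) + v i * |1 - Q / V| := fun i => by
      have e : v i - p i * Q = (v i - p i * V) * (Q / V) + v i * (1 - Q / V) := by
        field_simp
        ring
      rw [e]
      refine (abs_add_le _ _).trans ?_
      rw [abs_mul, abs_mul, abs_of_nonneg (hv i), abs_of_nonneg (div_nonneg hQ hV0)]
    refine (Finset.sum_le_sum fun i _ => h1 i).trans ?_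
    rw [Finset.sum_add_distrib, ← Finset.sum_mul, ← Finset.sum_mul, hV]
    have h2 : V * |1 - Q / V| = |V - Q| := by
      rw [← abs_of_pos h0, ← abs_mul, abs_of_pos h0]
      congr 1
      field_simp
    have h3 : (∑ i, |v i - p i * V|) * (Q / V) ≤ c * V * (Q / V) := by gcongr
    have h4 : c * V * (Q / V) = c * Q := by field_simp
    linarith

theorem sum_abs_sub_mul_self_le {ι : Type*} [Fintype ι] {v p : ι → ℝ} (hv : ∀ i, 0 ≤ v i)
    (hp : ∀ i, 0 ≤ p i) (hp1 : ∑ i, p i = 1) {V : ℝ} (hV : ∑ i, v i = V) :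
    ∑ i, |v i - p i * V| ≤ 2 * V := by
  have hV0 : 0 ≤ V := hV ▸ Finset.sum_nonneg fun i _ => hv i
  refine (Finset.sum_le_sum fun i _ => abs_sub (v i) (p i * V)).trans ?_
  simp_rw [abs_of_nonneg (hv _), abs_of_nonneg (mul_nonneg (hp _) hV0)]
  rw [Finset.sum_add_distrib, ← Finset.sum_mul, hp1, hV]
  linarith

theorem confRew_nonneg {X Ω A : Type*} [Fintype X] [Fintype Ω] {L n T : ℕ} {δ : ℝ}
    (g : Fin n → Obs X Ω A L) (x : X) (ω : Ω) : 0 ≤ confRew T δ g x ω :=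
  le_min zero_le_one (Real.sqrt_nonneg _)

section Deterministic
variable {X Ω A : Type*} [Fintype X] [Fintype Ω] [Fintype A] {L n T : ℕ} {δ : ℝ}

theorem MPP.rS_mem (M : MPP X Ω A L) (x : X) (ω : Ω) (a : A) : M.rS x ω a ∈ Set.Icc (0 : ℝ) 1 := by
  have hm : ∀ᵐ r ∂M.rewardLaw, r.1 x ω a ∈ Set.Icc (0 : ℝ) 1 := by
    filter_upwards [M.rewardLaw_mem] with r hr using (hr x ω a).1
  refine ⟨integral_nonneg_of_ae (by filter_upwards [hm] with r hr using hr.1), ?_⟩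
  have hmeas : Measurable fun r : (X → Ω → A → ℝ) × (X → Ω → A → ℝ) => r.1 x ω a := by fun_prop
  have h1 := integral_mono_ae (Integrable.of_mem_Icc 0 1 hmeas.aemeasurable hm)
    (integrable_const (1 : ℝ)) (by filter_upwards [hm] with r hr using hr.2)
  simpa [MPP.rS] using h1

theorem MPP.margXOA_occ_nonneg (M : MPP X Ω A L) (φ : Policy X Ω A) (x : X) (ω : Ω) (a : A) :
    0 ≤ margXOA (M.occ φ) x ω a :=
  Finset.sum_nonneg fun _ _ => M.occ_nonneg φ _ _ _ _

theorem MPP.margX_occ_nonneg (M : MPP X Ω A L) (φ : Policy X Ω A) (x : X) :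
    0 ≤ margX (M.occ φ) x :=
  Finset.sum_nonneg fun ω _ => Finset.sum_nonneg fun a _ => M.margXOA_occ_nonneg φ x ω a

/-- While the estimates are accurate, the occupancy measure of a persuasive policy satisfies the
constraints of `Opt-Opt`. -/
theorem MPP.optOptFeasible_occ (M : MPP X Ω A L) {g : Fin n → Obs X Ω A L}
    (hP : M.TransAccurate T δ g) (hμ : M.PriorAccurate T δ g) (hR : M.RewAccurate T δ g)
    {φ : Policy X Ω A} (hφ : M.Persuasive φ) :
    OptOptFeasible M.toLayering T δ g (M.occ φ)
      (fun x ω => |margXO (M.occ φ) x ω - estPrior g x ω * margX (M.occ φ) x|)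
      (fun x ω a x' => |M.occ φ x ω a x' - estP g x ω a x' * margXOA (M.occ φ) x ω a|) where
  eq_zero x ω a x' hx' := M.occ_eq_zero_of_not_mem_next φ hx' ω a
  nonneg := M.occ_nonneg φ
  sum_layer k hk := M.sum_margX_occ_layer φ hk
  flow x h0 hL := M.flow_occ φ h0 hL
  trans_upper x ω a x' _ := le_abs_self _
  trans_lower x ω a x' _ := by rw [abs_sub_comm]; exact le_abs_self _
  trans_sum x ω a := by
    by_cases hx : M.layer x < L
    · have h1 : ∀ x', |M.occ φ x ω a x' - estP g x ω a x' * margXOA (M.occ φ) x ω a| =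
          |estP g x ω a x' - M.trans x ω a x'| * margXOA (M.occ φ) x ω a := fun x' => by
        rw [M.occ_eq_margXOA_mul, mul_comm, ← sub_mul, abs_mul,
          abs_of_nonneg (M.margXOA_occ_nonneg φ x ω a), abs_sub_comm]
      simp_rw [h1]
      rw [← Finset.sum_mul]
      exact mul_le_mul_of_nonneg_right (hP x ω a hx) (M.margXOA_occ_nonneg φ x ω a)
    · have h1 : margXOA (M.occ φ) x ω a = 0 :=
        Finset.sum_eq_zero fun x' _ => M.occ_eq_zero_of_final φ hx ω a x'
      simp [h1, M.occ_eq_zero_of_final φ hx]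
  prior_upper x ω _ := le_abs_self _
  prior_lower x ω _ := by rw [abs_sub_comm]; exact le_abs_self _
  prior_sum x hx := by
    have h1 : ∀ ω, |margXO (M.occ φ) x ω - estPrior g x ω * margX (M.occ φ) x| =
        |estPrior g x ω - M.prior x ω| * margX (M.occ φ) x := fun ω => by
      rw [M.margXO_occ, mul_comm, ← sub_mul, abs_mul, abs_of_nonneg (M.margX_occ_nonneg φ x),
        abs_sub_comm]
    simp_rw [h1]
    rw [← Finset.sum_mul]
    exact mul_le_mul_of_nonneg_right (hμ x hx) (M.margX_occ_nonneg φ x)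
  persuasive x a a' _ := by
    refine (hφ x a a').trans (Finset.sum_le_sum fun ω _ => ?_)
    refine mul_le_mul_of_nonneg_left ?_ (M.margXOA_occ_nonneg φ x ω a)
    have h1 := abs_le.1 (hR x ω a).2
    have h2 := abs_le.1 (hR x ω a').2
    linarith [h1.1, h2.2]

theorem MPP.value_le_optOptObjective (M : MPP X Ω A L) {g : Fin n → Obs X Ω A L}
    (hR : M.RewAccurate T δ g) (φ : Policy X Ω A) :
    M.value φ ≤ optOptObjective T δ g (M.occ φ) := by
  refine Finset.sum_le_sum fun x _ => Finset.sum_le_sum fun ω _ => Finset.sum_le_sum fun a _ => ?_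
  refine mul_le_mul_of_nonneg_left ?_ (M.margXOA_occ_nonneg φ x ω a)
  have h1 := abs_le.1 (hR x ω a).1
  linarith [h1.1]

/-- The `ℓ¹` error of the prior and of the transitions out of `x`, weighted by the true occupancy
measure. -/
noncomputable def MPP.stateError (M : MPP X Ω A L) (T : ℕ) (δ : ℝ) (g : Fin n → Obs X Ω A L)
    (φ : Policy X Ω A) (x : X) : ℝ :=
  2 * min 1 (confPrior T δ g x) * margX (M.occ φ) x +
    ∑ ω, ∑ a, 2 * min 1 (confP M.toLayering T δ g x ω a) * margXOA (M.occ φ) x ω a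

section Comparison
variable {M : MPP X Ω A L} {g : Fin n → Obs X Ω A L} {q : X → Ω → A → X → ℝ} {ζ : X → Ω → ℝ}
  {ε : X → Ω → A → X → ℝ} {φ : Policy X Ω A}

theorem OptOptFeasible.margXOA_nonneg {G : Layering X L} (hq : OptOptFeasible G T δ g q ζ ε)
    (x : X) (ω : Ω) (a : A) : 0 ≤ margXOA q x ω a :=
  Finset.sum_nonneg fun _ _ => hq.nonneg _ _ _ _

theorem OptOptFeasible.margXO_nonneg {G : Layering X L} (hq : OptOptFeasible G T δ g q ζ ε)
    (x : X) (ω : Ω) : 0 ≤ margXO q x ω :=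
  Finset.sum_nonneg fun _ _ => hq.margXOA_nonneg _ _ _

theorem OptOptFeasible.margX_nonneg {G : Layering X L} (hq : OptOptFeasible G T δ g q ζ ε)
    (x : X) : 0 ≤ margX q x :=
  Finset.sum_nonneg fun _ _ => hq.margXO_nonneg _ _

/-- The constraints on the prior hold relative to the mass of `q`; the comparison with the true occupancy
measure is weighted by the true mass instead. -/
theorem OptOptFeasible.sum_outcome_le (hq : OptOptFeasible M.toLayering T δ g q ζ ε)
    (hμ : M.PriorAccurate T δ g) {x : X} (hx : M.layer x < L) :
    ∑ ω, |margXO q x ω - margXO (M.occ φ) x ω| ≤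
      |margX q x - margX (M.occ φ) x| + 2 * min 1 (confPrior T δ g x) * margX (M.occ φ) x := by
  simp_rw [M.margXO_occ, mul_comm (margX (M.occ φ) x) (M.prior x _)]
  have hc : 0 ≤ confPrior T δ g x := Real.sqrt_nonneg _
  refine sum_abs_sub_mul_le (hq.margXO_nonneg x) (M.prior x).2.1 (M.prior x).2.2 rfl
    (M.margX_occ_nonneg φ x) ?_ (by positivity)
  change ∑ ω, |margXO q x ω - M.prior x ω * margX q x| ≤ _
  have h2 : ∑ ω, |margXO q x ω - M.prior x ω * margX q x| ≤ 2 * margX q x :=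
    sum_abs_sub_mul_self_le (hq.margXO_nonneg x) (M.prior x).2.1 (M.prior x).2.2 rfl
  have h3 : ∑ ω, |margXO q x ω - M.prior x ω * margX q x| ≤
      2 * confPrior T δ g x * margX q x := by
    have h4 : ∀ ω, |margXO q x ω - M.prior x ω * margX q x| ≤
        ζ x ω + |estPrior g x ω - M.prior x ω| * margX q x := fun ω => by
      rw [← abs_of_nonneg (hq.margX_nonneg x), ← abs_mul, abs_of_nonneg (hq.margX_nonneg x)]
      refine le_trans (le_of_eq ?_) ((abs_add_le (margXO q x ω - estPrior g x ω * margX q x)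
        ((estPrior g x ω - M.prior x ω) * margX q x)).trans (add_le_add_left ?_ _))
      · congr 1; ring
      · exact abs_le'.2 ⟨hq.prior_upper x ω hx, by linarith [hq.prior_lower x ω hx]⟩
    refine (Finset.sum_le_sum fun ω _ => h4 ω).trans ?_
    rw [Finset.sum_add_distrib, ← Finset.sum_mul]
    have h5 := mul_le_mul_of_nonneg_right (hμ x hx) (hq.margX_nonneg x)
    linarith [hq.prior_sum x hx]
  rcases min_choice 1 (confPrior T δ g x) with h | h <;> rw [h]
  · simpa using h2
  · exact h3

/-- The action adds no error, since `q` and the true occupancy measure share the policy. -/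
theorem OptOptFeasible.sum_action_eq {G : Layering X L} (hq : OptOptFeasible G T δ g q ζ ε)
    (hφ : Induces q φ) (x : X) (ω : Ω) :
    ∑ a, |margXOA q x ω a - margXOA (M.occ φ) x ω a| = |margXO q x ω - margXO (M.occ φ) x ω| := by
  have h1 : ∀ a, margXOA q x ω a = φ x ω a * margXO q x ω := fun a => by
    by_cases h0 : margXO q x ω = 0
    · rw [h0, mul_zero]
      exact (Finset.sum_eq_zero_iff_of_nonneg fun a _ => hq.margXOA_nonneg x ω a).1 h0 a
        (Finset.mem_univ a)
    · rw [hφ x ω a h0, div_mul_cancel₀ _ h0]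
  have h2 : ∀ a, |margXOA q x ω a - margXOA (M.occ φ) x ω a| =
      φ x ω a * |margXO q x ω - margXO (M.occ φ) x ω| := fun a => by
    have h3 : 0 ≤ φ x ω a := (φ x ω).2.1 a
    rw [h1, M.margXOA_occ, ← M.margXO_occ, mul_comm (margXO (M.occ φ) x ω), ← mul_sub, abs_mul,
      abs_of_nonneg h3]
  have h4 : ∑ a, φ x ω a = 1 := (φ x ω).2.2
  simp_rw [h2]
  rw [← Finset.sum_mul, h4, one_mul]

theorem OptOptFeasible.sum_next_le (hq : OptOptFeasible M.toLayering T δ g q ζ ε)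
    (hP : M.TransAccurate T δ g) {x : X} (hx : M.layer x < L) (ω : Ω) (a : A) :
    ∑ x', |q x ω a x' - M.occ φ x ω a x'| ≤ |margXOA q x ω a - margXOA (M.occ φ) x ω a| +
      2 * min 1 (confP M.toLayering T δ g x ω a) * margXOA (M.occ φ) x ω a := by
  simp_rw [M.occ_eq_margXOA_mul φ x ω a, mul_comm (margXOA (M.occ φ) x ω a) (M.trans x ω a _)]
  have hc : 0 ≤ confP M.toLayering T δ g x ω a := Real.sqrt_nonneg _
  have hp1 := M.trans_sum x ω a ((M.layer_lt_iff x).1 hx)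
  refine sum_abs_sub_mul_le (hq.nonneg x ω a) (M.trans_nonneg x ω a) hp1 rfl
    (M.margXOA_occ_nonneg φ x ω a) ?_ (by positivity)
  change ∑ x', |q x ω a x' - M.trans x ω a x' * margXOA q x ω a| ≤ _
  have h0 := hq.margXOA_nonneg x ω a
  have h2 : ∑ x', |q x ω a x' - M.trans x ω a x' * margXOA q x ω a| ≤ 2 * margXOA q x ω a :=
    sum_abs_sub_mul_self_le (hq.nonneg x ω a) (M.trans_nonneg x ω a) hp1 rfl
  have h3 : ∑ x', |q x ω a x' - M.trans x ω a x' * margXOA q x ω a| ≤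
      2 * confP M.toLayering T δ g x ω a * margXOA q x ω a := by
    have h6 : ∑ x', |q x ω a x' - M.trans x ω a x' * margXOA q x ω a| =
        ∑ x' ∈ M.next x, |q x ω a x' - M.trans x ω a x' * margXOA q x ω a| := by
      symm
      refine Finset.sum_subset (Finset.subset_univ _) fun x' _ hx' => ?_
      rw [hq.eq_zero x ω a x' hx', M.trans_eq_zero hx', zero_mul, sub_zero, abs_zero]
    rw [h6]
    have h4 : ∀ x' ∈ M.next x, |q x ω a x' - M.trans x ω a x' * margXOA q x ω a| ≤
        ε x ω a x' + |estP g x ω a x' - M.trans x ω a x'| * margXOA q x ω a := fun x' hx' => by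
      rw [← abs_of_nonneg h0, ← abs_mul, abs_of_nonneg h0]
      refine le_trans (le_of_eq ?_) ((abs_add_le (q x ω a x' - estP g x ω a x' * margXOA q x ω a)
        ((estP g x ω a x' - M.trans x ω a x') * margXOA q x ω a)).trans (add_le_add_left ?_ _))
      · congr 1; ring
      · exact abs_le'.2 ⟨hq.trans_upper x ω a x' hx', by linarith [hq.trans_lower x ω a x' hx']⟩
    refine (Finset.sum_le_sum h4).trans ?_
    rw [Finset.sum_add_distrib, ← Finset.sum_mul]
    have h5 := mul_le_mul_of_nonneg_right (hP x ω a hx) h0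
    linarith [hq.trans_sum x ω a]
  rcases min_choice 1 (confP M.toLayering T δ g x ω a) with h | h <;> rw [h]
  · simpa using h2
  · exact h3

theorem MPP.stateError_nonneg (M : MPP X Ω A L) (g : Fin n → Obs X Ω A L) (φ : Policy X Ω A)
    (x : X) : 0 ≤ M.stateError T δ g φ x := by
  have hc : 0 ≤ confPrior T δ g x := Real.sqrt_nonneg _
  refine add_nonneg (mul_nonneg (by positivity) (M.margX_occ_nonneg φ x))
    (Finset.sum_nonneg fun ω _ => Finset.sum_nonneg fun a _ => ?_)
  have hc : 0 ≤ confP M.toLayering T δ g x ω a := Real.sqrt_nonneg _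
  exact mul_nonneg (by positivity) (M.margXOA_occ_nonneg φ x ω a)

/-- The occupancy of the states of layer `k` is off by at most the errors made in the earlier
layers: errors add up along the layers, they do not multiply. -/
theorem OptOptFeasible.sum_layer_le (hq : OptOptFeasible M.toLayering T δ g q ζ ε)
    (hP : M.TransAccurate T δ g) (hμ : M.PriorAccurate T δ g) (hφ : Induces q φ) (k : ℕ) :
    k < L → ∑ x ∈ Finset.univ.filter (fun x => M.layer x = k),
      |margX q x - margX (M.occ φ) x| ≤
      ∑ x ∈ Finset.univ.filter (fun x => M.layer x < k), M.stateError T δ g φ x := by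
  classical
  induction k with
  | zero =>
    intro hk
    have h1 : Finset.univ.filter (fun x => M.layer x = 0) = {M.init} := by
      ext x; simp [M.layer_eq_zero_iff]
    have h2 := hq.sum_layer 0 hk
    have h3 := M.sum_margX_occ_layer φ hk
    rw [h1, Finset.sum_singleton] at h2 h3
    rw [h1, Finset.sum_singleton, h2, h3]
    simp
  | succ k ih =>
    intro hk
    have h1 : ∀ x ∈ Finset.univ.filter (fun x => M.layer x = k + 1),
        |margX q x - margX (M.occ φ) x| ≤ ∑ y ∈ Finset.univ.filter (fun x => M.layer x = k),
          ∑ ω, ∑ a, |q y ω a x - M.occ φ y ω a x| := by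
      intro x hx
      have hx' : M.layer x = k + 1 := by simpa using hx
      rw [← hq.flow x (by omega) (by omega), ← M.flow_occ φ (by omega) (by omega)]
      simp_rw [← Finset.sum_sub_distrib]
      rw [← Finset.sum_subset (Finset.subset_univ
        (Finset.univ.filter (fun x => M.layer x = k))) fun y _ hy => ?_]
      · refine (Finset.abs_sum_le_sum_abs _ _).trans (Finset.sum_le_sum fun y _ => ?_)
        refine (Finset.abs_sum_le_sum_abs _ _).trans (Finset.sum_le_sum fun ω _ => ?_)
        exact Finset.abs_sum_le_sum_abs _ _
      · have hn : x ∉ M.next y := by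
          simp only [Layering.next, Finset.mem_filter, Finset.mem_univ, true_and]
          intro h
          exact hy (by simp; omega)
        simp [hq.eq_zero y _ _ x hn, M.occ_eq_zero_of_not_mem_next φ hn]
    refine (Finset.sum_le_sum h1).trans ?_
    rw [Finset.sum_comm]
    have h2 : ∀ y ∈ Finset.univ.filter (fun x => M.layer x = k),
        ∑ x ∈ Finset.univ.filter (fun x => M.layer x = k + 1),
          ∑ ω, ∑ a, |q y ω a x - M.occ φ y ω a x| ≤
        |margX q y - margX (M.occ φ) y| + M.stateError T δ g φ y := by
      intro y hy
      have hy' : M.layer y < L := by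
        have : M.layer y = k := by simpa using hy
        omega
      refine (Finset.sum_le_sum_of_subset_of_nonneg (Finset.subset_univ _) fun x _ _ =>
        Finset.sum_nonneg fun ω _ => Finset.sum_nonneg fun a _ => abs_nonneg _).trans ?_
      rw [Finset.sum_comm]
      have h3 : ∀ ω, ∑ x, ∑ a, |q y ω a x - M.occ φ y ω a x| ≤
          |margXO q y ω - margXO (M.occ φ) y ω| +
          ∑ a, 2 * min 1 (confP M.toLayering T δ g y ω a) * margXOA (M.occ φ) y ω a := fun ω => by
        rw [Finset.sum_comm, ← hq.sum_action_eq hφ, ← Finset.sum_add_distrib]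
        exact Finset.sum_le_sum fun a _ => hq.sum_next_le hP hy' ω a
      refine (Finset.sum_le_sum fun ω _ => h3 ω).trans ?_
      rw [Finset.sum_add_distrib, MPP.stateError, ← add_assoc]
      exact add_le_add_left (hq.sum_outcome_le hμ hy') _
    refine (Finset.sum_le_sum h2).trans ?_
    rw [Finset.sum_add_distrib]
    refine (add_le_add_left (ih (by omega)) _).trans (le_of_eq ?_)
    rw [← Finset.sum_union]
    · congr 1
      ext x
      simp only [Finset.mem_union, Finset.mem_filter, Finset.mem_univ, true_and]
      omega
    · refine Finset.disjoint_filter.2 fun x _ h => ?_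
      omega

/-- Each of the `L` layers is off by at most the total of the state errors. -/
theorem OptOptFeasible.sum_abs_le (hq : OptOptFeasible M.toLayering T δ g q ζ ε)
    (hP : M.TransAccurate T δ g) (hμ : M.PriorAccurate T δ g) (hφ : Induces q φ) :
    ∑ x, ∑ ω, ∑ a, |margXOA q x ω a - margXOA (M.occ φ) x ω a| ≤
      L * ∑ x, M.stateError T δ g φ x := by
  classical
  have hmaps : ∀ x ∈ Finset.univ.filter (fun x => M.layer x < L),
      M.layer x ∈ Finset.range L := fun x hx => by simpa using hx
  have h0 : ∑ x, ∑ ω, ∑ a, |margXOA q x ω a - margXOA (M.occ φ) x ω a| =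
      ∑ x ∈ Finset.univ.filter (fun x => M.layer x < L),
        ∑ ω, ∑ a, |margXOA q x ω a - margXOA (M.occ φ) x ω a| := by
    symm
    refine Finset.sum_subset (Finset.subset_univ _) fun x _ hx => ?_
    have hx' : ¬ M.layer x < L := by simpa using hx
    have hle := M.layer_le x
    have h1 : ∀ ω a x', q x ω a x' = 0 := fun ω a x' => hq.eq_zero x ω a x' (by
      simp only [Layering.next, Finset.mem_filter, Finset.mem_univ, true_and]
      have := M.layer_le x'
      omega)
    simp [margXOA, h1, M.occ_eq_zero_of_final φ hx']
  rw [h0, ← Finset.sum_fiberwise_of_maps_to hmaps]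
  have h1 : ∀ k ∈ Finset.range L, ∑ x ∈ (Finset.univ.filter (fun x => M.layer x < L)).filter
      (fun x => M.layer x = k), ∑ ω, ∑ a, |margXOA q x ω a - margXOA (M.occ φ) x ω a| ≤
      ∑ x, M.stateError T δ g φ x := by
    intro k hk
    have hk' := Finset.mem_range.1 hk
    have e : (Finset.univ.filter (fun x => M.layer x < L)).filter (fun x => M.layer x = k) =
        Finset.univ.filter (fun x => M.layer x = k) := by
      ext x
      simp only [Finset.mem_filter, Finset.mem_univ, true_and]
      omega
    rw [e]
    have h2 : ∀ x ∈ Finset.univ.filter (fun x => M.layer x = k),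
        ∑ ω, ∑ a, |margXOA q x ω a - margXOA (M.occ φ) x ω a| ≤
        |margX q x - margX (M.occ φ) x| + M.stateError T δ g φ x := by
      intro x hx
      have hx' : M.layer x < L := by
        have : M.layer x = k := by simpa using hx
        omega
      simp_rw [hq.sum_action_eq hφ]
      refine (hq.sum_outcome_le hμ hx').trans (add_le_add_right ?_ _)
      refine le_add_of_nonneg_right (Finset.sum_nonneg fun ω _ => Finset.sum_nonneg fun a _ => ?_)
      have hc : 0 ≤ confP M.toLayering T δ g x ω a := Real.sqrt_nonneg _
      exact mul_nonneg (by positivity) (M.margXOA_occ_nonneg φ x ω a)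
    refine (Finset.sum_le_sum h2).trans ?_
    rw [Finset.sum_add_distrib]
    refine (add_le_add_left (hq.sum_layer_le hP hμ hφ k hk') _).trans ?_
    rw [← Finset.sum_union]
    · exact Finset.sum_le_sum_of_subset_of_nonneg (Finset.subset_univ _)
        fun x _ _ => M.stateError_nonneg g φ x
    · refine Finset.disjoint_filter.2 fun x _ h => ?_
      omega
  refine (Finset.sum_le_sum h1).trans (le_of_eq ?_)
  rw [Finset.sum_const, Finset.card_range, nsmul_eq_mul]

end Comparison

/-- The price of one visit of `(x, ω, a)`: the confidence widths, clipped at one, with the factors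
with which they enter the regret. -/
noncomputable def Layering.price (G : Layering X L) (T : ℕ) (δ : ℝ) (g : Fin n → Obs X Ω A L)
    (x : X) (ω : Ω) (a : A) : ℝ :=
  6 * L * min 1 (confPrior T δ g x) + 6 * L * min 1 (confP G T δ g x ω a) + 2 * confRew T δ g x ω

/-- Optimism: while the estimates are accurate, the value lost in one episode is at most the
expected price of the episode. -/
theorem MPP.value_sub_value_le (M : MPP X Ω A L) {g : Fin n → Obs X Ω A L}
    (hP : M.TransAccurate T δ g) (hμ : M.PriorAccurate T δ g) (hR : M.RewAccurate T δ g)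
    {q : X → Ω → A → X → ℝ} {ζ : X → Ω → ℝ} {ε : X → Ω → A → X → ℝ}
    (hq : IsOptOptSolution M.toLayering T δ g q ζ ε) {φ φ' : Policy X Ω A} (hφ : Induces q φ)
    (hφ' : M.Persuasive φ') :
    M.value φ' - M.value φ ≤
      ∑ τ, M.trajProb φ τ * τ.sumSteps fun x ω a _ => M.price T δ g x ω a := by
  have h1 := (M.value_le_optOptObjective hR φ').trans
    (hq.2 _ _ _ (M.optOptFeasible_occ hP hμ hR hφ'))
  have h2 : optOptObjective T δ g q ≤ M.value φ +
      3 * ∑ x, ∑ ω, ∑ a, |margXOA q x ω a - margXOA (M.occ φ) x ω a| +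
      ∑ x, ∑ ω, ∑ a, 2 * confRew T δ g x ω * margXOA (M.occ φ) x ω a := by
    simp only [optOptObjective, MPP.value, Finset.mul_sum, ← Finset.sum_add_distrib]
    refine Finset.sum_le_sum fun x _ => Finset.sum_le_sum fun ω _ =>
      Finset.sum_le_sum fun a _ => ?_
    have h3 := (abs_le.1 (hR x ω a).1).2
    have h4 := M.rS_mem x ω a
    have h5 : confRew T δ g x ω ≤ 1 := min_le_left _ _
    have h6 : 0 ≤ confRew T δ g x ω := confRew_nonneg g x ω
    have h7 := hq.1.margXOA_nonneg x ω a
    set u := margXOA q x ω a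
    set v := margXOA (M.occ φ) x ω a
    set ξ := confRew T δ g x ω
    calc u * (estS g x ω a + ξ) ≤ u * (M.rS x ω a + 2 * ξ) := by
          exact mul_le_mul_of_nonneg_left (by linarith) h7
      _ = v * M.rS x ω a + (u - v) * (M.rS x ω a + 2 * ξ) + 2 * ξ * v := by ring
      _ ≤ v * M.rS x ω a + |u - v| * 3 + 2 * ξ * v := by
          gcongr
          · linarith [h4.1]
          · exact le_abs_self _
          · linarith [h4.2]
      _ = _ := by ring
  have h3 := hq.1.sum_abs_le hP hμ hφ
  have h4 : ∑ τ, M.trajProb φ τ * (τ.sumSteps fun x ω a _ => M.price T δ g x ω a) =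
      3 * (L * ∑ x, M.stateError T δ g φ x) +
      ∑ x, ∑ ω, ∑ a, 2 * confRew T δ g x ω * margXOA (M.occ φ) x ω a := by
    rw [← M.sum_occ_mul]
    simp only [MPP.stateError, margX, margXO, Finset.mul_sum, ← Finset.sum_add_distrib,
      ← Finset.sum_mul]
    refine Finset.sum_congr rfl fun x _ => Finset.sum_congr rfl fun ω _ =>
      Finset.sum_congr rfl fun a _ => ?_
    rw [Layering.price]
    change margXOA (M.occ φ) x ω a * _ = _
    ring
  linarith

end Deterministic

/-! ### The total price of the visits -/

open Classical in
/-- The harmonic-type sum behind the regret bound: an item pays `1 / √N` at every visit, where `N`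
is the number of earlier visits. -/
theorem sum_one_div_sqrt_count_le {T : ℕ} (v : Fin T → Prop) :
    ∑ t : Fin T, (if v t then 1 / √(max 1 ((Finset.univ.filter fun j : Fin t =>
      v (Fin.castLE t.is_lt.le j)).card : ℝ)) else 0) ≤
      3 * √((Finset.univ.filter v).card : ℝ) := by
  induction T with
  | zero => simp
  | succ T ih =>
    have ih' := ih fun t => v t.castSucc
    have hcard : ((Finset.univ.filter v).card : ℝ) =
        (Finset.univ.filter fun t : Fin T => v t.castSucc).card +
          (if v (Fin.last T) then 1 else 0) := by
      rw [← Finset.sum_boole, Fin.sum_univ_castSucc, Finset.sum_boole]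
    rw [Fin.sum_univ_castSucc, hcard]
    set N : ℕ := (Finset.univ.filter fun t : Fin T => v t.castSucc).card with hN
    have hlast : (Finset.univ.filter fun j : Fin ((Fin.last T : Fin (T + 1)) : ℕ) =>
        v (Fin.castLE (Fin.last T).is_lt.le j)).card = N := rfl
    rw [hlast]
    refine (add_le_add ih' le_rfl).trans ?_
    by_cases hv : v (Fin.last T)
    · rw [if_pos hv, if_pos hv]
      rcases Nat.eq_zero_or_pos N with h0 | h0
      · rw [h0]; norm_num
      · have h1 : (1 : ℝ) ≤ N := by exact_mod_cast h0
        rw [max_eq_right h1]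
        have hs : 1 ≤ √(N : ℝ) := Real.one_le_sqrt.2 h1
        have hs2 : √(N : ℝ) ^ 2 = N := Real.sq_sqrt (by positivity)
        suffices (3 * √(N : ℝ) + 1 / √(N : ℝ)) / 3 ≤ √((N : ℝ) + 1) by linarith
        refine Real.le_sqrt_of_sq_le ?_
        have h2 : ((3 * √(N : ℝ) + 1 / √(N : ℝ)) / 3) ^ 2 =
            √(N : ℝ) ^ 2 + 2 / 3 + 1 / (9 * √(N : ℝ) ^ 2) := by
          field_simp
          ring
        rw [h2, hs2]
        have h3 : 1 / (9 * (N : ℝ)) ≤ 1 / 9 := by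
          refine one_div_le_one_div_of_le (by norm_num) (by linarith)
        linarith
    · rw [if_neg hv, if_neg hv, add_zero, add_zero]

/-- Summed over time and over the steps of the episodes, the widths `√(c / N)` of the visited items
are at most `3 √(c |ι| L T)`, by the Cauchy–Schwarz inequality over the items. -/
theorem sum_width_le {ι : Type*} [Fintype ι] {T L : ℕ} (s : Fin T → Fin L → ι)
    (hs : ∀ t, Function.Injective (s t)) {N : Fin T → ι → ℕ}
    (hN : ∀ t i, N t i = {j : Fin t | ∃ k, s (Fin.castLE t.is_lt.le j) k = i}.ncard)
    {c : ℝ} {w : Fin T → Fin L → ℝ}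
    (hw : ∀ t k, w t k ≤ √(c / max 1 (N t (s t k) : ℝ))) :
    ∑ t, ∑ k, w t k ≤ 3 * √(c * (Fintype.card ι * (L * T))) := by
  classical
  have hN' : ∀ t i, N t i = (Finset.univ.filter fun j : Fin t =>
      ∃ k, s (Fin.castLE t.is_lt.le j) k = i).card := fun t i => by
    rw [hN, ← Set.ncard_coe_finset]
    congr 1
    ext; simp
  set C : ι → ℕ := fun i => (Finset.univ.filter fun t => ∃ k, s t k = i).card with hC
  have hinj : ∀ t i k k', s t k = i → s t k' = i → k = k' := fun t i k k' h h' =>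
    hs t (h.trans h'.symm)
  have h1 : ∑ t, ∑ k, 1 / √(max 1 (N t (s t k) : ℝ)) ≤ ∑ i, 3 * √(C i : ℝ) := by
    have h2 : ∀ t, ∑ k, 1 / √(max 1 (N t (s t k) : ℝ)) =
        ∑ i, if ∃ k, s t k = i then 1 / √(max 1 (N t i : ℝ)) else 0 := fun t => by
      simp_rw [ite_eq_sum_of_iff_exists Iff.rfl (hinj t _)]
      rw [Finset.sum_comm]
      refine Finset.sum_congr rfl fun k _ => ?_
      simp
    simp_rw [h2]
    rw [Finset.sum_comm]
    refine Finset.sum_le_sum fun i _ => ?_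
    have h3 := sum_one_div_sqrt_count_le fun t => ∃ k, s t k = i
    refine le_trans (le_of_eq ?_) (h3.trans (le_of_eq ?_))
    · refine Finset.sum_congr rfl fun t _ => ?_
      rw [hN']
      congr!
    · simp only [hC]
      congr!
  have h4 : ∑ i, (C i : ℝ) = L * T := by
    simp only [hC]
    simp_rw [← Finset.sum_boole]
    rw [Finset.sum_comm]
    have h5 : ∀ t, ∑ i, (if ∃ k, s t k = i then (1 : ℝ) else 0) = L := fun t => by
      simp_rw [ite_eq_sum_of_iff_exists Iff.rfl (hinj t _)]
      rw [Finset.sum_comm]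
      simp
    simp_rw [h5]
    simp [mul_comm]
  have h6 : ∑ i, √(C i : ℝ) ≤ √(Fintype.card ι * (L * T)) := by
    refine Real.le_sqrt_of_sq_le ?_
    refine (sq_sum_le_card_mul_sum_sq (s := Finset.univ) (f := fun i => √(C i : ℝ))).trans
      (le_of_eq ?_)
    simp_rw [Real.sq_sqrt (Nat.cast_nonneg _)]
    rw [h4, Finset.card_univ]
  calc ∑ t, ∑ k, w t k ≤ ∑ t, ∑ k, √c * (1 / √(max 1 (N t (s t k) : ℝ))) := by
        refine Finset.sum_le_sum fun t _ => Finset.sum_le_sum fun k _ => (hw t k).trans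
          (le_of_eq ?_)
        rw [Real.sqrt_div' _ (by positivity)]
        ring
    _ = √c * ∑ t, ∑ k, 1 / √(max 1 (N t (s t k) : ℝ)) := by
        simp_rw [Finset.mul_sum]
    _ ≤ √c * (3 * √(Fintype.card ι * (L * T))) := by
        refine mul_le_mul_of_nonneg_left (h1.trans ?_) (Real.sqrt_nonneg _)
        rw [← Finset.mul_sum]
        linarith
    _ = 3 * √(c * (Fintype.card ι * (L * T))) := by
        rw [Real.sqrt_mul' c (by positivity)]
        ring

section Price
variable {X Ω A : Type*} [Fintype X] [Fintype Ω] [Fintype A] {L : ℕ}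

theorem Layering.price_nonneg (G : Layering X L) {n : ℕ} (T : ℕ) (δ : ℝ) (g : Fin n → Obs X Ω A L)
    (x : X) (ω : Ω) (a : A) : 0 ≤ G.price T δ g x ω a := by
  have h1 : 0 ≤ confPrior T δ g x := Real.sqrt_nonneg _
  have h2 : 0 ≤ confP G T δ g x ω a := Real.sqrt_nonneg _
  have h3 : 0 ≤ confRew T δ g x ω := confRew_nonneg g x ω
  unfold Layering.price
  positivity

theorem Layering.price_le (G : Layering X L) (hL : 1 ≤ L) {n : ℕ} (T : ℕ) (δ : ℝ)
    (g : Fin n → Obs X Ω A L) (x : X) (ω : Ω) (a : A) : G.price T δ g x ω a ≤ 14 * L := by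
  have h0 : (1 : ℝ) ≤ L := by exact_mod_cast hL
  have h1 : min 1 (confPrior T δ g x) ≤ 1 := min_le_left _ _
  have h2 : min 1 (confP G T δ g x ω a) ≤ 1 := min_le_left _ _
  have h3 : confRew T δ g x ω ≤ 1 := min_le_left _ _
  unfold Layering.price
  nlinarith

/-- The price of the trajectory `τ` after the history `g`. -/
noncomputable def Layering.episodePrice (G : Layering X L) (T : ℕ) (δ : ℝ) {n : ℕ}
    (g : Fin n → Obs X Ω A L) (τ : Traj X Ω A L) : ℝ :=
  τ.sumSteps fun x ω a _ => G.price T δ g x ω a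

theorem Layering.episodePrice_mem (G : Layering X L) (hL : 1 ≤ L) {n : ℕ} (T : ℕ) (δ : ℝ)
    (g : Fin n → Obs X Ω A L) (τ : Traj X Ω A L) :
    G.episodePrice T δ g τ ∈ Set.Icc (0 : ℝ) (14 * L ^ 2) := by
  unfold Layering.episodePrice Traj.sumSteps
  refine ⟨Finset.sum_nonneg fun k _ => G.price_nonneg T δ g _ _ _, ?_⟩
  refine (Finset.sum_le_sum fun k _ => G.price_le hL T δ g _ _ _).trans (le_of_eq ?_)
  rw [Finset.sum_const, Finset.card_univ, Fintype.card_fin, nsmul_eq_mul]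
  ring

/-- The total price of the episodes of a history is at most `42 L √(2 |X|² |Ω| |A| L T ℓ)`. -/
theorem Layering.sum_price_le (G : Layering X L) (hL : 1 ≤ L) [Nonempty X] [Nonempty Ω] [Nonempty A]
    {T : ℕ} (hT : 1 ≤ T) {δ : ℝ} (hδ0 : 0 < δ) (hδ1 : δ < 1) {h : Fin T → Obs X Ω A L}
    (hh : ∀ t, G.Follows (h t).1) :
    ∑ t : Fin T, G.episodePrice T δ (pre t.is_lt.le h) (h t).1 ≤
      42 * L * √(2 * Fintype.card X ^ 2 * Fintype.card Ω * Fintype.card A * L * T *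
        Real.log (3 * (T * Fintype.card X * Fintype.card Ω * Fintype.card A) / δ)) := by
  classical
  have hX : (1 : ℝ) ≤ Fintype.card X := by exact_mod_cast Fintype.card_pos (α := X)
  have hΩ : (1 : ℝ) ≤ Fintype.card Ω := by exact_mod_cast Fintype.card_pos (α := Ω)
  have hA : (1 : ℝ) ≤ Fintype.card A := by exact_mod_cast Fintype.card_pos (α := A)
  have hT' : (1 : ℝ) ≤ T := by exact_mod_cast hT
  have hL' : (1 : ℝ) ≤ L := by exact_mod_cast hL
  have hXc : ∀ x, ((G.next x).card : ℝ) ≤ Fintype.card X := fun x => by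
    exact_mod_cast Finset.card_le_univ _
  set cx : ℝ := ((Fintype.card X : ℕ) : ℝ)
  set co : ℝ := ((Fintype.card Ω : ℕ) : ℝ)
  set ca : ℝ := ((Fintype.card A : ℕ) : ℝ)
  set l := Real.log (3 * (T * cx * co * ca) / δ) with hl
  have hTX : 1 ≤ T * cx := one_le_mul_of_one_le_of_one_le hT' hX
  have hTXO : 1 ≤ T * cx * co := one_le_mul_of_one_le_of_one_le hTX hΩ
  have hTXOA : 1 ≤ T * cx * co * ca := one_le_mul_of_one_le_of_one_le hTXO hA
  have hlog : ∀ y : ℝ, 1 ≤ y → y ≤ 3 * (T * cx * co * ca) → Real.log (y / δ) ≤ l :=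
    fun y hy0 hy => by
      refine Real.log_le_log (by positivity) ?_
      gcongr
  have hlog0 : ∀ y : ℝ, 1 ≤ y → 0 ≤ Real.log (y / δ) := fun y hy => by
    refine Real.log_nonneg ?_
    rw [le_div_iff₀ hδ0]; linarith
  have hl0 : 0 ≤ l := hlog0 _ (by linarith)
  set W := √(2 * cx ^ 2 * co * ca * L * T * l) with hW
  have hWle : ∀ c : ℝ, ∀ m : ℝ, 0 ≤ c → c * m ≤ 2 * cx ^ 2 * co * ca * l →
      3 * √(c * (m * (L * T))) ≤ 3 * W := by
    intro c m hc hcm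
    refine mul_le_mul_of_nonneg_left (Real.sqrt_le_sqrt ?_) (by norm_num)
    have := mul_le_mul_of_nonneg_right hcm (by positivity : (0 : ℝ) ≤ L * T)
    linarith
  have hinj : ∀ t : Fin T, Function.Injective fun k : Fin L => (h t).1.state k.castSucc :=
    fun t k k' e => (hh t).eq_of_state_eq e
  have h1 : ∑ t : Fin T, ∑ k : Fin L,
      min 1 (confPrior T δ (pre t.is_lt.le h) ((h t).1.state k.castSucc)) ≤ 3 * W := by
    refine (sum_width_le (fun t k => (h t).1.state k.castSucc) hinj
      (N := fun t x => cntX (pre t.is_lt.le h) x) (c := 2 * co * l) (fun t x => ?_)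
      fun t k => ?_).trans (hWle _ _ (by positivity) ?_)
    · rw [cntX, ← Set.ncard_coe_finset]
      congr 1
      ext j
      rw [Finset.mem_coe, Finset.mem_filter]
      simp [Traj.VisitsX, pre]
    · refine (min_le_right _ _).trans (Real.sqrt_le_sqrt ?_)
      gcongr
      exact hlog _ hTX (by nlinarith)
    · change 2 * co * l * cx ≤ _
      have : 1 ≤ cx * ca := one_le_mul_of_one_le_of_one_le hX hA
      have h2 := mul_le_mul_of_nonneg_left this (by positivity : 0 ≤ 2 * co * l * cx)
      linarith
  have h2 : ∑ t : Fin T, ∑ k : Fin L,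
      min 1 (confP G T δ (pre t.is_lt.le h) ((h t).1.state k.castSucc) ((h t).1.outcome k)
        ((h t).1.action k)) ≤ 3 * W := by
    refine (sum_width_le
      (fun t k => ((h t).1.state k.castSucc, (h t).1.outcome k, (h t).1.action k))
      (fun t k k' e => hinj t (Prod.ext_iff.1 e).1)
      (N := fun t z => cntXOA (pre t.is_lt.le h) z.1 z.2.1 z.2.2) (c := 2 * cx * l)
      (fun t x => ?_) fun t k => ?_).trans (hWle _ _ (by positivity) ?_)
    · rw [cntXOA, ← Set.ncard_coe_finset]
      congr 1
      ext j
      rw [Finset.mem_coe, Finset.mem_filter]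
      simp [Traj.VisitsXOA, pre, Prod.ext_iff]
    · refine (min_le_right _ _).trans (Real.sqrt_le_sqrt ?_)
      have := hlog0 _ hTXOA
      gcongr
      · exact hXc _
      · exact hlog _ hTXOA (by linarith)
    · rw [Fintype.card_prod, Fintype.card_prod]
      push_cast
      change 2 * cx * l * (cx * (co * ca)) ≤ _
      linarith
  have h3 : ∑ t : Fin T, ∑ k : Fin L,
      confRew T δ (pre t.is_lt.le h) ((h t).1.state k.castSucc) ((h t).1.outcome k) ≤ 3 * W := by
    refine (sum_width_le (fun t k => ((h t).1.state k.castSucc, (h t).1.outcome k))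
      (fun t k k' e => hinj t (Prod.ext_iff.1 e).1)
      (N := fun t z => cntXO (pre t.is_lt.le h) z.1 z.2) (c := l)
      (fun t x => ?_) fun t k => ?_).trans (hWle _ _ (by positivity) ?_)
    · rw [cntXO, ← Set.ncard_coe_finset]
      congr 1
      ext j
      rw [Finset.mem_coe, Finset.mem_filter]
      simp [Traj.VisitsXO, pre, Prod.ext_iff]
    · refine (min_le_right _ _).trans (Real.sqrt_le_sqrt ?_)
      gcongr
      exact hlog _ (by nlinarith) (by nlinarith)
    · rw [Fintype.card_prod]
      push_cast
      change l * (cx * co) ≤ _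
      have : 1 ≤ cx * ca := one_le_mul_of_one_le_of_one_le hX hA
      have h2 := mul_le_mul_of_nonneg_left this (by positivity : 0 ≤ l * (cx * co))
      have h4 : 0 ≤ l * (cx * co) * (cx * ca) := by positivity
      linarith
  have hWnn : 0 ≤ W := Real.sqrt_nonneg _
  have h4 : ∑ t : Fin T, G.episodePrice T δ (pre t.is_lt.le h) (h t).1 =
      6 * L * (∑ t : Fin T, ∑ k : Fin L,
        min 1 (confPrior T δ (pre t.is_lt.le h) ((h t).1.state k.castSucc))) +
      6 * L * (∑ t : Fin T, ∑ k : Fin L,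
        min 1 (confP G T δ (pre t.is_lt.le h) ((h t).1.state k.castSucc) ((h t).1.outcome k)
          ((h t).1.action k))) +
      2 * ∑ t : Fin T, ∑ k : Fin L,
        confRew T δ (pre t.is_lt.le h) ((h t).1.state k.castSucc) ((h t).1.outcome k) := by
    simp only [Finset.mul_sum, ← Finset.sum_add_distrib]
    rfl
  rw [h4]
  have h5 := mul_le_mul_of_nonneg_left h1 (by positivity : (0 : ℝ) ≤ 6 * L)
  have h6 := mul_le_mul_of_nonneg_left h2 (by positivity : (0 : ℝ) ≤ 6 * L)
  have h7 := mul_le_mul_of_nonneg_right hL' hWnn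
  linarith

end Price

/-! ### The regret bound -/

section Measurability
variable {X Ω A : Type*} {L : ℕ}

theorem measurable_count {n : ℕ} (p : Traj X Ω A L → Prop) [DecidablePred p] :
    Measurable fun g : Fin n → Obs X Ω A L =>
      ((Finset.univ.filter fun i => p (g i).1).card : ℝ) := by
  simp_rw [← Finset.sum_boole]
  refine Finset.measurable_sum _ fun i _ => ?_
  have h1 : Measurable fun o : Obs X Ω A L => if p o.1 then (1 : ℝ) else 0 :=
    measurable_traj fun τ => if p τ then (1 : ℝ) else 0
  exact h1.comp (measurable_pi_apply i)

theorem measurable_sqrt_div_max_count {n : ℕ} (c : ℝ) (p : Traj X Ω A L → Prop)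
    [DecidablePred p] :
    Measurable fun g : Fin n → Obs X Ω A L =>
      √(c / max 1 ((Finset.univ.filter fun i => p (g i).1).card : ℝ)) :=
  Real.continuous_sqrt.measurable.comp
    (measurable_const.div (measurable_const.max (measurable_count p)))

end Measurability

section Regret
variable {X Ω A : Type*} [Fintype X] [Fintype Ω] [Fintype A] {L : ℕ}

theorem Layering.measurable_price (G : Layering X L) (n T : ℕ) (δ : ℝ) (x : X) (ω : Ω) (a : A) :
    Measurable fun g : Fin n → Obs X Ω A L => G.price T δ g x ω a := by
  classical
  unfold Layering.price confPrior confP confRew cntX cntXOA cntXO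
  refine ((Measurable.const_mul (measurable_const.min ?_) _).add
    (Measurable.const_mul (measurable_const.min ?_) _)).add
    (Measurable.const_mul (measurable_const.min ?_) _)
  · exact measurable_sqrt_div_max_count _ fun τ => τ.VisitsX x
  · exact measurable_sqrt_div_max_count _ fun τ => τ.VisitsXOA x ω a
  · exact measurable_sqrt_div_max_count _ fun τ => τ.VisitsXO x ω

/-- The expected price of the episode that follows the history `g`. -/
noncomputable def MPP.expectedPrice (M : MPP X Ω A L) (alg : Learner X Ω A L) (T : ℕ) (δ : ℝ)
    {n : ℕ} (g : Fin n → Obs X Ω A L) : ℝ :=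
  ∑ τ, M.trajProb (alg.act n g) τ * M.episodePrice T δ g τ

theorem Layering.measurable_episodePrice (G : Layering X L) (n T : ℕ) (δ : ℝ)
    (τ : Traj X Ω A L) : Measurable fun g : Fin n → Obs X Ω A L => G.episodePrice T δ g τ := by
  unfold Layering.episodePrice Traj.sumSteps
  exact Finset.measurable_sum _ fun _ _ => G.measurable_price n T δ _ _ _

/-- The Azuma–Hoeffding inequality for the prices of the episodes. -/
theorem MPP.historyLaw_price_le (M : MPP X Ω A L) (alg : Learner X Ω A L) (hL : 1 ≤ L) {T : ℕ}
    (hT : 1 ≤ T) (δ : ℝ) {u : ℝ} (hu : 0 < u) :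
    M.historyLaw alg T {h | (∑ t : Fin T, M.episodePrice T δ (pre t.is_lt.le h) (h t).1) +
      28 * L ^ 2 * √(T * u) < ∑ t : Fin T, M.expectedPrice alg T δ (pre t.is_lt.le h)} ≤
      ENNReal.ofReal (Real.exp (-u)) := by
  have hT' : (0 : ℝ) < T := by exact_mod_cast hT
  have hL' : (0 : ℝ) < L := by exact_mod_cast hL
  set c : ℝ := 14 * L ^ 2 with hc
  -- With this exponent the level `u` costs `u / l = c √(T u)`, and the variance terms add up to
  -- `u / 8`; the factor `28 = 2 * 14` leaves room for both.
  set l : ℝ := √(u / T) / c with hl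
  set g : ∀ n, (Fin n → Obs X Ω A L) → Obs X Ω A L → ℝ := fun n h o =>
    l * (M.expectedPrice alg T δ h - M.episodePrice T δ h o.1) - l ^ 2 * c ^ 2 / 8 with hg
  have hgm : ∀ n, Measurable fun p : (Fin n → Obs X Ω A L) × Obs X Ω A L => g n p.1 p.2 := by
    intro n
    have h1 : Measurable fun h : Fin n → Obs X Ω A L => M.expectedPrice alg T δ h :=
      Finset.measurable_sum _ fun τ _ =>
        ((M.measurable_trajProb τ).comp (alg.measurable_act n)).mul
          (M.measurable_episodePrice n T δ τ)
    have h2 : Measurable fun p : (Fin n → Obs X Ω A L) × Traj X Ω A L =>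
        M.episodePrice T δ p.1 p.2 :=
      measurable_from_prod_countable_left fun τ => M.measurable_episodePrice n T δ τ
    have h3 : Measurable fun p : (Fin n → Obs X Ω A L) × Obs X Ω A L => (p.1, p.2.1) :=
      measurable_fst.prodMk (measurable_fst.comp measurable_snd)
    exact (((h1.comp measurable_fst).sub (h2.comp h3)).const_mul _).sub_const _
  refine (measure_mono ?_).trans
    (M.historyLaw_exists_le_sum alg (g := g) hgm (fun n h => ?_) u T)
  · intro h hh
    have hh : (∑ t : Fin T, M.episodePrice T δ (pre t.is_lt.le h) (h t).1) +
      28 * L ^ 2 * √(T * u) < ∑ t : Fin T, M.expectedPrice alg T δ (pre t.is_lt.le h) := hh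
    refine ⟨T, le_rfl, ?_⟩
    have h1 : ∑ i : Fin T, g i (pre (i.is_lt.le.trans le_rfl) h) (h (Fin.castLE le_rfl i)) =
        l * (∑ t : Fin T, M.expectedPrice alg T δ (pre t.is_lt.le h) -
          ∑ t : Fin T, M.episodePrice T δ (pre t.is_lt.le h) (h t).1) - T * (l ^ 2 * c ^ 2 / 8) := by
      simp only [hg]
      rw [Finset.sum_sub_distrib, ← Finset.mul_sum, Finset.sum_sub_distrib]
      simp
    rw [h1]
    have hc0 : 0 < c := by positivity
    have hs : 0 < √(u / T) := Real.sqrt_pos.2 (by positivity)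
    have h2 : T * (l ^ 2 * c ^ 2 / 8) = u / 8 := by
      rw [hl, div_pow, Real.sq_sqrt (by positivity)]
      field_simp
    have h3 : l * (28 * L ^ 2 * √(T * u)) = 2 * u := by
      have h4 : √(u / T) * √(T * u) = u := by
        rw [← Real.sqrt_mul (by positivity)]
        have : u / T * (T * u) = u ^ 2 := by field_simp
        rw [this, Real.sqrt_sq hu.le]
      calc l * (28 * L ^ 2 * √(T * u)) = 2 * (√(u / T) * √(T * u)) := by
            rw [hl, hc]; field_simp; ring
        _ = 2 * u := by rw [h4]
    have hl0 : 0 < l := by positivity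
    have h5 := mul_lt_mul_of_pos_left hh hl0
    rw [mul_add, h3] at h5
    rw [h2]
    linarith
  · set φ := alg.act n h
    have h1 := sum_mul_exp_mul_sub_le (p := M.trajProb φ) (Z := M.episodePrice T δ h)
      (fun τ => M.trajProb_nonneg φ τ) (M.sum_trajProb φ) (M.episodePrice_mem hL T δ h) (-l)
    set H : Traj X Ω A L → ℝ := fun τ => Real.exp (l * (M.expectedPrice alg T δ h -
      M.episodePrice T δ h τ) - l ^ 2 * c ^ 2 / 8) with hH
    refine (M.lintegral_episodeLaw_le φ (H := H) ?_ (fun τ => (Real.exp_pos _).le)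
      fun τ _ => ?_).trans ?_
    · have h2 : Measurable fun o => g n h o := (hgm n).of_uncurry_left (x := h)
      exact ENNReal.measurable_ofReal.comp (Real.measurable_exp.comp h2)
    · have h2 : ∀ r, g n h (observe τ r) = l * (M.expectedPrice alg T δ h -
          M.episodePrice T δ h τ) - l ^ 2 * c ^ 2 / 8 := fun _ => rfl
      simp only [h2, hH, lintegral_const, measure_univ, mul_one, le_refl]
    · rw [← ENNReal.ofReal_one]
      refine ENNReal.ofReal_le_ofReal (le_trans (le_of_eq ?_) h1)
      refine Finset.sum_congr rfl fun τ _ => ?_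
      have h2 : M.expectedPrice alg T δ h = ∑ τ, M.trajProb φ τ * M.episodePrice T δ h τ := rfl
      simp only [hH, h2, hc]
      congr 2
      ring

theorem MPP.value_nonneg (M : MPP X Ω A L) (φ : Policy X Ω A) : 0 ≤ M.value φ :=
  Finset.sum_nonneg fun x _ => Finset.sum_nonneg fun ω _ => Finset.sum_nonneg fun a _ =>
    mul_nonneg (M.margXOA_occ_nonneg φ x ω a) (M.rS_mem x ω a).1

theorem MPP.value_le (M : MPP X Ω A L) (φ : Policy X Ω A) : M.value φ ≤ L := by
  have h1 : ∑ x, ∑ ω, ∑ a, margXOA (M.occ φ) x ω a = L := by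
    have h2 := M.sum_occ_mul φ fun _ _ _ _ => 1
    simp only [mul_one, Traj.sumSteps, Finset.sum_const, Finset.card_univ, Fintype.card_fin,
      nsmul_eq_mul, ← Finset.sum_mul, M.sum_trajProb, one_mul] at h2
    exact h2
  rw [← h1]
  refine Finset.sum_le_sum fun x _ => Finset.sum_le_sum fun ω _ => Finset.sum_le_sum fun a _ => ?_
  exact mul_le_of_le_one_right (M.margXOA_occ_nonneg φ x ω a) (M.rS_mem x ω a).2

/-- The supremum defining `OPT` is `0` if no policy is persuasive, which is why the upper bound
has to be nonnegative. -/
theorem MPP.opt_le (M : MPP X Ω A L) {b : ℝ} (hb : 0 ≤ b)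
    (h : ∀ φ, M.Persuasive φ → M.value φ ≤ b) : M.opt ≤ b :=
  Real.sSup_le (by rintro v ⟨φ, hφ, rfl⟩; exact h φ hφ) hb

theorem MPP.regret_le_mul (M : MPP X Ω A L) (alg : Learner X Ω A L) {T : ℕ}
    (h : Fin T → Obs X Ω A L) : M.regret alg h ≤ T * L := by
  have h1 : M.opt ≤ L := M.opt_le (Nat.cast_nonneg _) fun φ _ => M.value_le φ
  have h2 : 0 ≤ ∑ t : Fin T, M.value (alg.act t fun i : Fin t => h (Fin.castLE t.is_le' i)) :=
    Finset.sum_nonneg fun t _ => M.value_nonneg _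
  have h3 : T * M.opt ≤ T * L := mul_le_mul_of_nonneg_left h1 (Nat.cast_nonneg _)
  unfold MPP.regret
  linarith

/-- Optimism summed over the episodes.  `Opt-Opt` is feasible as soon as some persuasive policy
exists; otherwise there is nothing to compare with. -/
theorem MPP.regret_le_sum_expectedPrice (M : MPP X Ω A L) (alg : Learner X Ω A L) (hL : 1 ≤ L)
    {T : ℕ} {δ : ℝ} (halg : IsOPPS M.toLayering T δ alg) {h : Fin T → Obs X Ω A L}
    (hP : ∀ n (hn : n ≤ T), M.TransAccurate T δ (pre hn h))
    (hμ : ∀ n (hn : n ≤ T), M.PriorAccurate T δ (pre hn h))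
    (hR : ∀ n (hn : n ≤ T), M.RewAccurate T δ (pre hn h)) :
    M.regret alg h ≤ ∑ t : Fin T, M.expectedPrice alg T δ (pre t.is_lt.le h) := by
  have h1 : ∀ t : Fin T, M.opt ≤ M.value (alg.act t (pre t.is_lt.le h)) +
      M.expectedPrice alg T δ (pre t.is_lt.le h) := fun t => by
    refine M.opt_le (add_nonneg (M.value_nonneg _) (Finset.sum_nonneg fun τ _ =>
      mul_nonneg (M.trajProb_nonneg _ _) (M.episodePrice_mem hL T δ _ τ).1)) fun φ hφ => ?_
    have hfeas := M.optOptFeasible_occ (hP t t.is_lt.le) (hμ t t.is_lt.le) (hR t t.is_lt.le) hφ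
    obtain ⟨q, ζ, ε, hq, hind⟩ := halg t t.is_lt (pre t.is_lt.le h) ⟨_, _, _, hfeas⟩
    have h2 := M.value_sub_value_le (hP t t.is_lt.le) (hμ t t.is_lt.le) (hR t t.is_lt.le) hq hind hφ
    change _ ≤ M.expectedPrice alg T δ (pre t.is_lt.le h) at h2
    linarith
  have h2 := Finset.sum_le_sum fun t (_ : t ∈ (Finset.univ : Finset (Fin T))) => h1 t
  rw [Finset.sum_const, Finset.card_univ, Fintype.card_fin, nsmul_eq_mul,
    Finset.sum_add_distrib] at h2
  change T * M.opt - ∑ t : Fin T, M.value (alg.act t (pre t.is_lt.le h)) ≤ _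
  linarith

/-- The arithmetic of the final bound. -/
theorem price_bound_le {cX cO cA L T δ : ℝ} (hX : 1 ≤ cX) (hO : 1 ≤ cO) (hA : 1 ≤ cA) (hL : 1 ≤ L)
    (hT : 1 ≤ T) (hδ0 : 0 < δ) (hδ : 1 ≤ Real.log (1 / δ)) :
    42 * L * √(2 * cX ^ 2 * cO * cA * L * T * Real.log (3 * (T * cX * cO * cA) / δ)) +
      28 * L ^ 2 * √(T * Real.log (1 / δ)) ≤
    154 * (L ^ 2 * cX * √(T * cA * cO * Real.log (1 / δ))) *
      (1 + Real.log (T * cX * cO * cA)) := by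
  set u := Real.log (1 / δ) with hu
  set Q := T * cX * cO * cA with hQ
  have hQ1 : 1 ≤ Q := one_le_mul_of_one_le_of_one_le
    (one_le_mul_of_one_le_of_one_le (one_le_mul_of_one_le_of_one_le hT hX) hO) hA
  have hlQ : 0 ≤ Real.log Q := Real.log_nonneg hQ1
  set S := √(T * cA * cO * u) with hS
  have hS0 : 0 ≤ S := Real.sqrt_nonneg _
  have h1 : Real.log (3 * Q / δ) ≤ 3 * u * (1 + Real.log Q) ^ 2 := by
    have e : 3 * Q / δ = 3 * (Q * (1 / δ)) := by ring
    rw [e, Real.log_mul (by norm_num) (by positivity), Real.log_mul (by positivity)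
      (by positivity), ← hu]
    have h3 : Real.log 3 ≤ 2 := by
      have := Real.log_le_sub_one_of_pos (by norm_num : (0 : ℝ) < 3)
      linarith
    have h4 : 0 ≤ (u - 1) * Real.log Q := mul_nonneg (by linarith) hlQ
    nlinarith [mul_nonneg (by linarith : 0 ≤ u) (sq_nonneg (Real.log Q))]
  have h2 : √(2 * cX ^ 2 * cO * cA * L * T * Real.log (3 * Q / δ)) ≤
      3 * L * cX * S * (1 + Real.log Q) := by
    refine Real.sqrt_le_iff.2 ⟨by positivity, ?_⟩
    have h3 : S ^ 2 = T * cA * cO * u := Real.sq_sqrt (by positivity)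
    calc 2 * cX ^ 2 * cO * cA * L * T * Real.log (3 * Q / δ)
        ≤ 2 * cX ^ 2 * cO * cA * L * T * (3 * u * (1 + Real.log Q) ^ 2) := by gcongr
      _ = 6 * L * (cX ^ 2 * (T * cA * cO * u) * (1 + Real.log Q) ^ 2) := by ring
      _ ≤ 9 * L ^ 2 * (cX ^ 2 * (T * cA * cO * u) * (1 + Real.log Q) ^ 2) := by
          exact mul_le_mul_of_nonneg_right (by nlinarith) (by positivity)
      _ = (3 * L * cX * S * (1 + Real.log Q)) ^ 2 := by rw [← h3]; ring
  have h3 : √(T * u) ≤ S := by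
    refine Real.sqrt_le_sqrt ?_
    have : 1 ≤ cA * cO := one_le_mul_of_one_le_of_one_le hA hO
    have h4 : 0 ≤ T * u := by positivity
    nlinarith
  have h4 : √(T * u) ≤ cX * S * (1 + Real.log Q) := by
    have h5 : 1 ≤ cX * (1 + Real.log Q) := one_le_mul_of_one_le_of_one_le hX (by linarith)
    nlinarith
  have h5 := mul_le_mul_of_nonneg_left h2 (by positivity : 0 ≤ 42 * L)
  have h6 := mul_le_mul_of_nonneg_left h4 (by positivity : 0 ≤ 28 * L ^ 2)
  linarith

end Regret

end Persuasion

open Persuasion in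
theorem mainTheorem1 : ∃ (C : ℝ) (p : ℕ), 0 < C ∧
    ∀ (X : Type*) (Ω : Type*) (A : Type*) [Fintype X] [Fintype Ω] [Fintype A] [Nonempty A]
      (L T : ℕ) (_hL : 1 ≤ L) (_hT : 1 ≤ T) (M : Persuasion.MPP X Ω A L)
      (δ : ℝ) (_hδ0 : 0 < δ) (_hδ1 : δ < 1) (alg : Persuasion.Learner X Ω A L)
      (_halg : Persuasion.IsOPPS M.toLayering T δ alg),
      ENNReal.ofReal (1 - 7 * δ) ≤ M.historyLaw alg T
        {h | M.regret alg h ≤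
          C * ((L : ℝ) ^ 2 * Fintype.card X *
              √(T * Fintype.card A * Fintype.card Ω * Real.log (1 / δ))) *
            (1 + Real.log (T * Fintype.card X * Fintype.card Ω * Fintype.card A)) ^ p} := by
  refine ⟨154, 1, by norm_num, ?_⟩
  intro X Ω A _ _ _ _ L T hL hT M δ hδ0 hδ1 alg halg
  rw [pow_one]
  -- For `δ ≥ 1 / 7` the claimed probability is at most zero; below, `ln (1 / δ) ≥ 1`.
  by_cases hδ : δ < 1 / 7
  swap
  · rw [ENNReal.ofReal_of_nonpos (by linarith)]
    exact zero_le
  have hu : 1 ≤ Real.log (1 / δ) := one_le_log_div le_rfl hδ0 hδ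
  have hX : (1 : ℝ) ≤ Fintype.card X := by exact_mod_cast M.card_pos
  have hO : (1 : ℝ) ≤ Fintype.card Ω := by exact_mod_cast M.card_outcome_pos
  have hA : (1 : ℝ) ≤ Fintype.card A := by exact_mod_cast Fintype.card_pos (α := A)
  have hL' : (1 : ℝ) ≤ L := by exact_mod_cast hL
  have hT' : (1 : ℝ) ≤ T := by exact_mod_cast hT
  have hbound := price_bound_le hX hO hA hL' hT' hδ0 hu
  set R : ℝ := 154 * ((L : ℝ) ^ 2 * Fintype.card X *
    √(T * Fintype.card A * Fintype.card Ω * Real.log (1 / δ))) *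
    (1 + Real.log (T * Fintype.card X * Fintype.card Ω * Fintype.card A)) with hR
  set S : Set (Fin T → Obs X Ω A L) := {h | M.regret alg h ≤ R} with hS
  rcases Nat.lt_or_ge T (Fintype.card A) with hTA | hAT
  · -- With more actions than episodes the bound exceeds the trivial bound `T L`.
    have hall : S = Set.univ := by
      refine Set.eq_univ_of_forall fun h => (M.regret_le_mul alg h).trans ?_
      have hTA' : (T : ℝ) ≤ Fintype.card A := by exact_mod_cast hTA.le
      have h1 : (T : ℝ) ≤ √(T * Fintype.card A * Fintype.card Ω * Real.log (1 / δ)) := by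
        refine Real.le_sqrt_of_sq_le ?_
        calc (T : ℝ) ^ 2 = T * T * 1 * 1 := by ring
          _ ≤ T * Fintype.card A * Fintype.card Ω * Real.log (1 / δ) := by gcongr
      have hQ : 0 ≤ Real.log (T * Fintype.card X * Fintype.card Ω * Fintype.card A) :=
        Real.log_nonneg (one_le_mul_of_one_le_of_one_le
          (one_le_mul_of_one_le_of_one_le (one_le_mul_of_one_le_of_one_le hT' hX) hO) hA)
      calc (T : ℝ) * L = 1 * (L * 1 * T) * 1 := by ring
        _ ≤ R := by
          rw [hR]
          gcongr
          · norm_num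
          · nlinarith
          · linarith
    rw [hall, measure_univ]
    exact ENNReal.ofReal_le_one.2 (by linarith)
  · have : Nonempty X := ⟨M.init⟩
    have : Nonempty Ω := Fintype.card_pos_iff.1 M.card_outcome_pos
    set B₁ : Set (Fin T → Obs X Ω A L) := {h | ∃ i, ¬ M.Regular (h i)} with hB₁
    set B₂ : Set (Fin T → Obs X Ω A L) := {h | (∀ i, M.Regular (h i)) ∧ ∃ n, ∃ hn : n ≤ T,
      ¬ M.TransAccurate T δ (pre hn h)} with hB₂
    set B₃ : Set (Fin T → Obs X Ω A L) := {h | (∀ i, M.Regular (h i)) ∧ ∃ n, ∃ hn : n ≤ T,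
      ¬ M.PriorAccurate T δ (pre hn h)} with hB₃
    set B₄ : Set (Fin T → Obs X Ω A L) := {h | (∀ i, M.Regular (h i)) ∧ ∃ n, ∃ hn : n ≤ T,
      ¬ M.RewAccurate T δ (pre hn h)} with hB₄
    set B₅ : Set (Fin T → Obs X Ω A L) :=
      {h | (∑ t : Fin T, M.episodePrice T δ (pre t.is_lt.le h) (h t).1) +
        28 * L ^ 2 * √(T * Real.log (1 / δ)) <
        ∑ t : Fin T, M.expectedPrice alg T δ (pre t.is_lt.le h)} with hB₅
    have hcover : Sᶜ ⊆ B₁ ∪ (B₂ ∪ (B₃ ∪ (B₄ ∪ B₅))) := by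
      intro h hh
      by_contra hcon
      simp only [Set.mem_union, not_or] at hcon
      obtain ⟨h1, h2, h3, h4, h5⟩ := hcon
      have h1 : ∀ i, M.Regular (h i) := not_exists_not.1 h1
      refine hh ?_
      have r1 := M.regret_le_sum_expectedPrice alg hL halg (h := h)
        (fun n hn => by_contra fun hc => h2 ⟨h1, n, hn, hc⟩)
        (fun n hn => by_contra fun hc => h3 ⟨h1, n, hn, hc⟩)
        (fun n hn => by_contra fun hc => h4 ⟨h1, n, hn, hc⟩)
      have r2 : ∑ t : Fin T, M.expectedPrice alg T δ (pre t.is_lt.le h) ≤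
          (∑ t : Fin T, M.episodePrice T δ (pre t.is_lt.le h) (h t).1) +
            28 * L ^ 2 * √(T * Real.log (1 / δ)) := not_lt.1 h5
      have r3 := M.toLayering.sum_price_le hL hT hδ0 hδ1 (h := h) fun t => (h1 t).1
      change M.regret alg h ≤ R
      linarith
    have hB5 : M.historyLaw alg T B₅ ≤ ENNReal.ofReal δ := by
      have h1 := M.historyLaw_price_le alg hL hT δ (lt_of_lt_of_le one_pos hu)
      rwa [exp_neg_log_div le_rfl hδ0, div_one] at h1
    have hbad : M.historyLaw alg T Sᶜ ≤ ENNReal.ofReal (7 * δ) := by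
      calc M.historyLaw alg T Sᶜ
          ≤ M.historyLaw alg T B₁ + (M.historyLaw alg T B₂ + (M.historyLaw alg T B₃ +
            (M.historyLaw alg T B₄ + M.historyLaw alg T B₅))) := by
            refine (measure_mono hcover).trans ((measure_union_le _ _).trans ?_)
            gcongr
            refine (measure_union_le _ _).trans ?_
            gcongr
            refine (measure_union_le _ _).trans ?_
            gcongr
            exact measure_union_le _ _
        _ ≤ 0 + (ENNReal.ofReal δ + (ENNReal.ofReal δ + (ENNReal.ofReal δ +
            ENNReal.ofReal δ))) := by
            gcongr
            · exact (M.historyLaw_not_regular alg T).le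
            · exact M.historyLaw_not_transAccurate alg hT hδ0 hδ
            · exact M.historyLaw_not_priorAccurate alg hT hδ0 hδ
            · exact M.historyLaw_not_rewAccurate alg hT hAT hδ0 hδ
        _ ≤ ENNReal.ofReal (7 * δ) := by
            rw [zero_add, ← ENNReal.ofReal_add hδ0.le hδ0.le, ← ENNReal.ofReal_add hδ0.le
              (by positivity), ← ENNReal.ofReal_add hδ0.le (by positivity)]
            exact ENNReal.ofReal_le_ofReal (by linarith)
    rw [ENNReal.ofReal_sub _ (by positivity), ENNReal.ofReal_one, tsub_le_iff_right]
    calc (1 : ENNReal) = M.historyLaw alg T (S ∪ Sᶜ) := by rw [Set.union_compl_self, measure_univ]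
      _ ≤ M.historyLaw alg T S + M.historyLaw alg T Sᶜ := measure_union_le _ _
      _ ≤ M.historyLaw alg T S + ENNReal.ofReal (7 * δ) := by gcongr
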